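/- **Setting.** Let $\Gamma\subset\mathbb C$ be an isoradial graph of mesh $\delta>0$: a locally finite planar graph with straight edges such that every face is inscribed into a circle of radius $\delta$ whose center lies inside that face. For adjacent vertices $u\sim v$ let $\theta_{uv}=\arccos\frac{|u-v|}{2\delta}$; this is the half-angle at $u$ of the rhombus with side $\delta$ whose diagonal is the edge $uv$ and whose other two vertices are the centers of the two faces adjacent to $uv$. Let $\eta>0$ and assume that all rhombus angles belong to $[\eta,\pi-\eta]$. The random walk on $\Gamma$ steps from $u$ to a neighbour $v$ with probability $\tan\theta_{uv}\big/\sum_{s\sim u}\tan\theta_{us}$. A connected discrete domain is given by sets $F$, $E_\Omega$, $V$ of open faces, open edges and vertices of $\Gamma$ such that $\Omega:=F\cup E_\Omega\cup V$ is (as a subset of the plane) open and connected and $E_\Omega\cup V$ is connected; it is simply connected if $\Omega$ is. Its interior vertices are the elements of $V$, and its boundary vertices are the pairs $(a;a_{\rm int})$ with $a_{\rm int}\in V$, $a\notin V$ a vertex of $\Gamma$, and $(a_{\rm int}a)\in E_\Omega$; their set is denoted by $\partial\Omega$. The domain is not assumed to be bounded. For $u\in V$ and $E\subset\partial\Omega$: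 * $\omega(u;E;\Omega)$ is the discrete harmonic measure, i.e. the probability that the random walk started at $u$ first exits the domain through an element of $E$ (it runs through interior vertices and then steps from $a_{\rm int}$ to $a$ for some $(a;a_{\rm int})\in E$); * $\operatorname{dist}(u;\partial\Omega)$ is the Euclidean distance from $u$ to the set of points $a$ with $(a;a_{\rm int})\in\partial\Omega$; * $\operatorname{dist}_\Omega(u;E)$ is the infimum of those $R$ for which $u$ and $E$ are connected in the part of the discrete domain lying in $B(u,R)$, i.e. for which there are $(a;a_{\rm int})\in E$ with $a\in B(u,R)$ and a path from $u$ to $a_{\rm int}$ along edges of the domain whose vertices all belong to $V\cap B(u,R)$ (with $\inf\emptyset=\infty$); * $\operatorname{diam}E$ is the Euclidean diameter of the set of points $a$ with $(a;a_{\rm int})\in E$ (possibly $\infty$), and $\operatorname{diam}E:=\delta$ if there is only one such point. **Proposition 2.10 (weak Beurling-type estimates).** For every $\eta>0$ there exist constants $\beta>0$ and $C>0$, depending only on $\eta$ (not on $\delta$, on the graph or on the domain), such that for every $\delta>0$, every isoradial graph $\Gamma$ of mesh $\delta$ all of whose rhombus angles belong to $[\eta,\pi-\eta]$, every simply connected discrete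 domain $\Omega$ of $\Gamma$, every interior vertex $u$ and every $E\subset\partial\Omega$, $$\omega(u;E;\Omega)\le C\left[\frac{\operatorname{dist}(u;\partial\Omega)}{\operatorname{dist}_\Omega(u;E)}\right]^\beta\qquad\text{and}\qquad \omega(u;E;\Omega)\le C\left[\frac{\operatorname{diam}E}{\operatorname{dist}_\Omega(u;E)}\right]^\beta .$$ (If $E=\emptyset$, then $\operatorname{dist}_\Omega(u;E)=\infty$ and the right-hand sides are read as $0$.) -/

import Mathlib

open Set
open scoped ENNReal NNReal

noncomputable section

/-- A locally finite straight-line graph embedded in the complex plane. Its vertices are the points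
of `verts`; complex numbers outside `verts` have no neighbours. The (open) edge between adjacent
vertices `u` and `v` is the open segment between them. -/
structure PlaneGraph where
  verts : Set ℂ
  graph : SimpleGraph ℂ
  mem_verts : ∀ u v : ℂ, graph.Adj u v → u ∈ verts
  /-- Every bounded region contains finitely many vertices. -/
  locallyFinite : ∀ (z : ℂ) (R : ℝ), (verts ∩ Metric.ball z R).Finite
  /-- No open edge passes through a vertex. -/
  edge_disjoint_verts : ∀ u v : ℂ, graph.Adj u v → Disjoint (openSegment ℝ u v) verts
  /-- Different open edges do not meet. -/
  edge_disjoint_edge : ∀ u v x y : ℂ, graph.Adj u v → graph.Adj x y →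
    s(u, v) ≠ s(x, y) → Disjoint (openSegment ℝ u v) (openSegment ℝ x y)

namespace PlaneGraph

/-- The set of open edges, each of them regarded as a subset of the plane. -/
def edges (Γ : PlaneGraph) : Set (Set ℂ) :=
  {e | ∃ u v : ℂ, Γ.graph.Adj u v ∧ e = openSegment ℝ u v}

/-- The union of all vertices and all edges. -/
def skeleton (Γ : PlaneGraph) : Set ℂ := Γ.verts ∪ ⋃₀ Γ.edges

/-- The set of open faces: the connected components of the complement of the graph. -/
def faces (Γ : PlaneGraph) : Set (Set ℂ) :=
  {f | ∃ z ∈ Γ.skeletonᶜ, f = connectedComponentIn Γ.skeletonᶜ z}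

end PlaneGraph

/-- An isoradial graph of mesh `δ`, with the circle centers inside the faces: each face is inscribed
into a circle of radius `δ` (it lies in the disc, and the vertices on its boundary lie on the
circle) whose center `c` belongs to the face. -/
structure IsoradialGraph (δ : ℝ) extends PlaneGraph where
  mesh_pos : 0 < δ
  isoradial : ∀ f ∈ toPlaneGraph.faces, ∃ c ∈ f,
    f ⊆ Metric.ball c δ ∧ ∀ v ∈ verts ∩ frontier f, dist v c = δ

namespace IsoradialGraph

variable {δ : ℝ}

/-- The half-angle `θ`, at the vertices `u` and `v`, of the rhombus attached to the edge `uv`.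
That rhombus has side `δ` and the edge `uv` as a diagonal, its other two vertices being the centers
of the two faces adjacent to the edge; hence `cos θ = |u - v| / (2δ)`. -/
def halfAngle (_Γ : IsoradialGraph δ) (u v : ℂ) : ℝ := Real.arccos (dist u v / (2 * δ))

/-- The half-angle is the geometric one: the angle at `u` between the edge `uv` and the side of the
rhombus from `u` to a circle center `w`. -/
theorem halfAngle_eq_angle (Γ : IsoradialGraph δ) {u v w : ℂ} (huv : u ≠ v)
    (hu : dist w u = δ) (hv : dist w v = δ) :
    Γ.halfAngle u v = EuclideanGeometry.angle w u v := by
  have hδ := Γ.mesh_pos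
  have hd : 0 < dist v u := dist_pos.mpr huv.symm
  have h := EuclideanGeometry.law_cos w u v
  rw [hu, hv] at h
  have hc : Real.cos (EuclideanGeometry.angle w u v) = dist u v / (2 * δ) := by
    rw [dist_comm u v, eq_div_iff (by positivity)]
    exact mul_left_cancel₀ hd.ne' (by linarith)
  rw [halfAngle, ← hc]
  exact Real.arccos_cos (EuclideanGeometry.angle_nonneg _ _ _) (EuclideanGeometry.angle_le_pi _ _ _)

/-- All rhombus angles belong to `[η, π - η]`. (The angles of the rhombus on `uv` are `2θ` and
`π - 2θ`.) -/
def AnglesBounded (Γ : IsoradialGraph δ) (η : ℝ) : Prop :=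
  ∀ u v : ℂ, Γ.graph.Adj u v → 2 * Γ.halfAngle u v ∈ Icc η (Real.pi - η)

open Classical in
/-- The weight `tan θ` of the edge `uv` (zero if `u` and `v` are not adjacent). -/
def weight (Γ : IsoradialGraph δ) (u v : ℂ) : ℝ≥0∞ :=
  if Γ.graph.Adj u v then ENNReal.ofReal (Real.tan (Γ.halfAngle u v)) else 0

open Classical in
/-- The law of one step of the random walk on `Γ` from the vertex `u`: the walk moves to the
neighbour `v` with probability `tan θ_{uv} / ∑ₛ tan θ_{u uₛ}`. (At points that are not vertices,
where this makes no sense, the walk stays put.) -/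
def step (Γ : IsoradialGraph δ) (u : ℂ) : PMF ℂ :=
  if h : ∑' v, Γ.weight u v ≠ 0 ∧ ∑' v, Γ.weight u v ≠ ∞ then
    PMF.normalize (Γ.weight u) h.1 h.2
  else PMF.pure u

/-- The joint law of the positions at times `0, 1, …, n` of the random walk on `Γ` started
at `u`. -/
def walk (Γ : IsoradialGraph δ) : (n : ℕ) → ℂ → PMF (Fin (n + 1) → ℂ)
  | 0, u => PMF.pure fun _ => u
  | n + 1, u => (Γ.step u).bind fun v => (walk Γ n v).map fun x => Fin.cons u x

end IsoradialGraph

/-- A connected discrete domain of `Γ`: sets of faces, edges and vertices of `Γ` whose union is an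
open connected subset of the plane and for which the union of the edges and vertices is
connected. The set `verts` is the set of interior vertices. -/
structure DiscreteDomain {δ : ℝ} (Γ : IsoradialGraph δ) where
  faces : Set (Set ℂ)
  edges : Set (Set ℂ)
  verts : Set ℂ
  faces_subset : faces ⊆ Γ.faces
  edges_subset : edges ⊆ Γ.edges
  verts_subset : verts ⊆ Γ.verts
  isOpen_union : IsOpen (⋃₀ faces ∪ ⋃₀ edges ∪ verts)
  isConnected_union : IsConnected (⋃₀ faces ∪ ⋃₀ edges ∪ verts)
  isConnected_skeleton : IsConnected (⋃₀ edges ∪ verts)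

namespace DiscreteDomain

variable {δ : ℝ} {Γ : IsoradialGraph δ}

/-- The continuous counterpart of the discrete domain, a subset of the plane. -/
def region (Ω : DiscreteDomain Γ) : Set ℂ := ⋃₀ Ω.faces ∪ ⋃₀ Ω.edges ∪ Ω.verts

/-- The boundary of the discrete domain: pairs `(a, a_int)` of an exterior vertex and an interior
vertex that are joined by an edge of the domain. -/
def boundary (Ω : DiscreteDomain Γ) : Set (ℂ × ℂ) :=
  {p | Γ.graph.Adj p.2 p.1 ∧ openSegment ℝ p.2 p.1 ∈ Ω.edges ∧ p.2 ∈ Ω.verts ∧ p.1 ∉ Ω.verts}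

/-- The event that a trajectory `x` of `n` steps exits the domain through `E`: it stays at interior
vertices up to some time `k`, and its next step crosses a boundary edge belonging to `E`. -/
def exitEvent (Ω : DiscreteDomain Γ) (E : Set (ℂ × ℂ)) (n : ℕ) : Set (Fin (n + 1) → ℂ) :=
  {x | ∃ k : Fin n, (∀ i ≤ k.castSucc, x i ∈ Ω.verts) ∧ (x k.succ, x k.castSucc) ∈ E}

/-- The discrete harmonic measure of `E` seen from `u`: the probability that the random walk on `Γ`
started at `u` first exits the domain through `E`, that is, the limit of the (increasing)
probabilities that it does so within `n` steps. -/
def harmonicMeasure (Ω : DiscreteDomain Γ) (u : ℂ) (E : Set (ℂ × ℂ)) : ℝ≥0∞ :=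
  ⨆ n : ℕ, (Γ.walk n u).toOuterMeasure (Ω.exitEvent E n)

/-- The Euclidean distance from `u` to the set of boundary vertices. -/
def distBoundary (Ω : DiscreteDomain Γ) (u : ℂ) : ℝ≥0∞ :=
  Metric.infEDist u (Prod.fst '' Ω.boundary)

/-- The interior vertices `u` and the set `E` of boundary vertices are connected in the part of the
discrete domain that lies in the disc `B(u, R)`: some path of interior vertices in the disc, along
edges of the domain, leads from `u` to the interior endpoint of an element of `E` whose exterior
endpoint lies in the disc too. -/
def ConnectedInBall (Ω : DiscreteDomain Γ) (u : ℂ) (E : Set (ℂ × ℂ)) (R : ℝ) : Prop :=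
  ∃ p ∈ E, u ∈ Ω.verts ∩ Metric.ball u R ∧ p.1 ∈ Metric.ball u R ∧
    Relation.ReflTransGen
      (fun x y => Γ.graph.Adj x y ∧ openSegment ℝ x y ∈ Ω.edges ∧
        x ∈ Ω.verts ∩ Metric.ball u R ∧ y ∈ Ω.verts ∩ Metric.ball u R) u p.2

/-- The inner distance `dist_Ω(u; E) = inf {R : u and E are connected in Ω ∩ B(u, R)}`
(it is `∞` if `E` is empty). -/
def innerDist (Ω : DiscreteDomain Γ) (u : ℂ) (E : Set (ℂ × ℂ)) : ℝ≥0∞ :=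
  ⨅ (R : ℝ) (_ : Ω.ConnectedInBall u E R), ENNReal.ofReal R

open Classical in
/-- The Euclidean diameter of a set of boundary vertices, set to be `δ` if it consists of one
point of the plane. -/
def boundaryDiam (_Ω : DiscreteDomain Γ) (E : Set (ℂ × ℂ)) : ℝ≥0∞ :=
  if ∃ a : ℂ, Prod.fst '' E = {a} then ENNReal.ofReal δ else Metric.ediam (Prod.fst '' E)

end DiscreteDomain

end

/-! Fix a point `a` outside the simply connected region. A nonnegative function that is subharmonic
in an annulus around `a`, vanishes off the domain and is at most 1 there has bounded energy, by
Caccioppoli's inequality with logarithmically scale-invariant cutoffs. If the function exceeds 1/2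
somewhere near the circle of radius ρ, it drops to 0 along a path of the graph inside a ring of
width of order δ (`exists_reachable_notMem`). Such a ring contains O(ρ/δ) edges, so by
Cauchy–Schwarz its energy there is at least a constant times δ/ρ. Summed over disjoint rings between
radii r and Λr, this is of order log Λ. Hence, for a suitable Λ depending only on the angle bound,
the function is at most 1/2 on an entire ring (`SubharmonicIn.exists_ring`).

The maximum principle `hm_le_of_exit` carries that bound across the ring. Iteration over scales
gives the decay 2^(-k), which is a power of the ratio of radii: `hm_le_outward` centered at a
boundary vertex near `u` yields the first estimate, `hm_le_inward` centered at a point of `E` the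
second.

The topological input is that every circle around `a` through an interior vertex is joined to the
complement in a thin ring. Isoradiality makes z and z² discrete harmonic (`sum_cond_eq_zero`), so
powers of z - a are harmonic up to third order and have no local maximum of the real part
(`exists_re_lt_of_sum_eq_zero`). If the component of the vertex in the ring stayed inside the
domain, a branch of log(z - a) would define on it the function Re exp(-iμ log((z - a)/ρ)), positive
in the ring and nonpositive just outside, and its maximum would be contradictory. -/

noncomputable section

/-! ### Edges and skeleton of a straight-line plane graph. -/

namespace PlaneGraph

variable {Γ : PlaneGraph}

theorem mem_verts_left {u v : ℂ} (h : Γ.graph.Adj u v) : u ∈ Γ.verts := Γ.mem_verts u v h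

theorem mem_verts_right {u v : ℂ} (h : Γ.graph.Adj u v) : v ∈ Γ.verts := Γ.mem_verts v u h.symm

theorem notMem_verts_of_mem_openSegment {u v q : ℂ} (h : Γ.graph.Adj u v)
    (hq : q ∈ openSegment ℝ u v) : q ∉ Γ.verts := fun hv =>
  Set.disjoint_left.mp (Γ.edge_disjoint_verts u v h) hq hv

theorem openSegment_subset_skeleton {u v : ℂ} (h : Γ.graph.Adj u v) :
    openSegment ℝ u v ⊆ Γ.skeleton := fun _ hq =>
  Or.inr ⟨_, ⟨u, v, h, rfl⟩, hq⟩

theorem edge_eq_of_mem {u v x y q : ℂ} (h : Γ.graph.Adj u v) (h' : Γ.graph.Adj x y)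
    (hq : q ∈ openSegment ℝ u v) (hq' : q ∈ openSegment ℝ x y) : s(u, v) = s(x, y) := by
  by_contra hne
  exact Set.disjoint_left.mp (Γ.edge_disjoint_edge u v x y h h' hne) hq hq'

theorem openSegment_eq_of_sym2_eq {u v x y : ℂ} (h : s(u, v) = s(x, y)) :
    openSegment ℝ u v = openSegment ℝ x y := by
  rcases Sym2.eq_iff.mp h with ⟨rfl, rfl⟩ | ⟨rfl, rfl⟩
  · rfl
  · exact openSegment_symm ℝ _ _

theorem mem_skeleton_iff {p : ℂ} :
    p ∈ Γ.skeleton ↔ p ∈ Γ.verts ∨ ∃ x y, Γ.graph.Adj x y ∧ p ∈ openSegment ℝ x y := by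
  constructor
  · rintro (h | ⟨_, ⟨x, y, hxy, rfl⟩, hp⟩)
    · exact Or.inl h
    · exact Or.inr ⟨x, y, hxy, hp⟩
  · rintro (h | ⟨x, y, hxy, hp⟩)
    · exact Or.inl h
    · exact openSegment_subset_skeleton hxy hp

theorem mem_openSegment_of_mem_segment {x y z : ℂ} (h : z ∈ segment ℝ x y) (hx : z ≠ x)
    (hy : z ≠ y) : z ∈ openSegment ℝ x y :=
  mem_openSegment_of_ne_left_right hx.symm hy.symm h

end PlaneGraph

/-! ### Conductance bounds and the local structure of the skeleton. -/

namespace IsoradialGraph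

variable {δ : ℝ}

/-- The conductance `tan θ` of an edge. -/
def cond (Γ : IsoradialGraph δ) (u v : ℂ) : ℝ := Real.tan (Γ.halfAngle u v)

/-- All conductances lie between `T⁻¹` and `T`, and the law of sines for the edge lengths. -/
structure CondBounded (Γ : IsoradialGraph δ) (T : ℝ) : Prop where
  one_le : 1 ≤ T
  lower : ∀ u v, Γ.graph.Adj u v → T⁻¹ ≤ Γ.cond u v
  upper : ∀ u v, Γ.graph.Adj u v → Γ.cond u v ≤ T
  dist_sq : ∀ u v, Γ.graph.Adj u v → dist u v ^ 2 * (1 + Γ.cond u v ^ 2) = 4 * δ ^ 2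

theorem cond_comm (Γ : IsoradialGraph δ) (u v : ℂ) : Γ.cond u v = Γ.cond v u := by
  simp [cond, halfAngle, dist_comm]

/-- Here θ ranges over [η/2, π/2 - η/2], and tan(η/2) is the inverse of the upper bound. All later
estimates depend on η only through this `T`. -/
theorem AnglesBounded.condBounded {Γ : IsoradialGraph δ} {η : ℝ} (hη : 0 < η)
    (hη' : η ≤ Real.pi / 2) (h : Γ.AnglesBounded η) :
    Γ.CondBounded (Real.tan (Real.pi / 2 - η / 2)) := by
  have hpi := Real.pi_pos
  have hδ := Γ.mesh_pos
  have htan : ∀ x y : ℝ, 0 ≤ x → y < Real.pi / 2 → x ≤ y → Real.tan x ≤ Real.tan y := by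
    intro x y hx hy hxy
    rcases hxy.eq_or_lt with rfl | hlt
    · exact le_rfl
    · exact (Real.tan_lt_tan_of_nonneg_of_lt_pi_div_two hx hy hlt).le
  refine ⟨?_, fun u v huv => ?_, fun u v huv => ?_, fun u v huv => ?_⟩
  · rw [← Real.tan_pi_div_four]
    exact htan _ _ (by positivity) (by linarith) (by linarith)
  · have hb := h u v huv
    rw [Real.tan_pi_div_two_sub, inv_inv]
    exact htan _ _ (by linarith) (by linarith [hb.2]) (by linarith [hb.1])
  · have hb := h u v huv
    exact htan _ _ (by linarith [hb.1]) (by linarith) (by linarith [hb.2])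
  · have hb := h u v huv
    have hlt : dist u v / (2 * δ) < 1 := by
      by_contra hcon
      have := Real.arccos_eq_zero.mpr (not_lt.mp hcon)
      have h1 := hb.1
      rw [halfAngle, this] at h1
      linarith
    have hcos : Real.cos (Γ.halfAngle u v) = dist u v / (2 * δ) :=
      Real.cos_arccos (by linarith [show 0 ≤ dist u v / (2 * δ) by positivity]) hlt.le
    have hd : 0 < dist u v := dist_pos.mpr huv.ne
    have hc0 : Real.cos (Γ.halfAngle u v) ≠ 0 := by rw [hcos]; positivity
    have := Real.inv_one_add_tan_sq hc0
    rw [cond]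
    have h2 : 0 < 1 + Real.tan (Γ.halfAngle u v) ^ 2 := by positivity
    rw [hcos] at this
    field_simp at this
    nlinarith [this]

theorem CondBounded.cond_pos {Γ : IsoradialGraph δ} {T : ℝ} (hT : Γ.CondBounded T) {u v : ℂ}
    (h : Γ.graph.Adj u v) : 0 < Γ.cond u v :=
  lt_of_lt_of_le (inv_pos.mpr (by linarith [hT.one_le])) (hT.lower u v h)

theorem CondBounded.dist_lt {Γ : IsoradialGraph δ} {T : ℝ} (hT : Γ.CondBounded T) {u v : ℂ}
    (h : Γ.graph.Adj u v) : dist u v < 2 * δ := by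
  have h1 := hT.dist_sq u v h
  have h2 := hT.cond_pos h
  have h3 : 0 < dist u v := dist_pos.mpr h.ne
  have hδ := Γ.mesh_pos
  have h4 : 0 < dist u v ^ 2 * Γ.cond u v ^ 2 := by positivity
  nlinarith

theorem CondBounded.le_dist_sq {Γ : IsoradialGraph δ} {T : ℝ} (hT : Γ.CondBounded T) {u v : ℂ}
    (h : Γ.graph.Adj u v) : 4 * δ ^ 2 / (1 + T ^ 2) ≤ dist u v ^ 2 := by
  have h1 := hT.dist_sq u v h
  have h2 := hT.cond_pos h
  have h3 := hT.upper u v h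
  rw [div_le_iff₀ (by positivity), ← h1]
  gcongr

/-- Near a point `z`, the skeleton consists of `z` and of the edges whose closures contain `z`. -/
theorem exists_ball_skeleton {Γ : IsoradialGraph δ} {T : ℝ} (hT : Γ.CondBounded T) (z : ℂ) :
    ∃ ε > 0, ∀ p ∈ Metric.ball z ε, p ∈ Γ.skeleton →
      p = z ∨ ∃ x y, Γ.graph.Adj x y ∧ p ∈ openSegment ℝ x y ∧ z ∈ segment ℝ x y := by
  have hδ := Γ.mesh_pos
  -- Edges are shorter than 2δ, so an edge coming within δ of `z` has its endpoints within 3δ. Only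
  -- finitely many segments matter, and those missing `z` form a closed set.
  set S : Set ℂ := Γ.verts ∩ Metric.ball z (3 * δ) with hS
  have hfin : S.Finite := Γ.locallyFinite z (3 * δ)
  set P : Set (ℂ × ℂ) := {p | p ∈ S ×ˢ S ∧ z ∉ segment ℝ p.1 p.2} with hP
  have hPfin : P.Finite := (hfin.prod hfin).subset fun p hp => hp.1
  set bad : Set ℂ := (S \ {z}) ∪ ⋃ p ∈ P, segment ℝ p.1 p.2 with hbad
  have hclosed : IsClosed bad := by
    refine IsClosed.union (hfin.subset sdiff_subset).isClosed ?_
    refine hPfin.isClosed_biUnion fun p _ => ?_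
    rw [segment_eq_image_lineMap]
    exact (isCompact_Icc.image AffineMap.lineMap_continuous).isClosed
  have hz : z ∉ bad := by
    rintro (h | h)
    · exact h.2 rfl
    · obtain ⟨p, hp, hzp⟩ := mem_iUnion₂.mp h
      exact hp.2 hzp
  obtain ⟨ε, hε, hball⟩ := Metric.isOpen_iff.mp hclosed.isOpen_compl z hz
  refine ⟨min ε δ, lt_min hε hδ, fun p hp hps => ?_⟩
  have hp1 : p ∉ bad := hball (Metric.ball_subset_ball (min_le_left _ _) hp)
  have hp2 : dist p z < δ := lt_of_lt_of_le hp (min_le_right _ _)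
  rcases PlaneGraph.mem_skeleton_iff.mp hps with hv | ⟨x, y, hxy, hpe⟩
  · left
    by_contra hne
    exact hp1 (Or.inl ⟨⟨hv, by rw [Metric.mem_ball]; linarith⟩, hne⟩)
  · right
    refine ⟨x, y, hxy, hpe, ?_⟩
    by_contra hzs
    refine hp1 (Or.inr (mem_iUnion₂.mpr
      ⟨(x, y), ⟨⟨?_, ?_⟩, hzs⟩, openSegment_subset_segment _ _ _ hpe⟩))
    · refine ⟨PlaneGraph.mem_verts_left hxy, ?_⟩
      have h1 := dist_add_dist_of_mem_segment (openSegment_subset_segment ℝ _ _ hpe)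
      have h2 := hT.dist_lt hxy
      have h3 := dist_triangle x p z
      have h4 : 0 ≤ dist p y := dist_nonneg
      rw [Metric.mem_ball]; linarith
    · refine ⟨PlaneGraph.mem_verts_right hxy, ?_⟩
      have h1 := dist_add_dist_of_mem_segment (openSegment_subset_segment ℝ _ _ hpe)
      have h2 := hT.dist_lt hxy
      have h3 := dist_triangle y p z
      have h4 : 0 ≤ dist x p := dist_nonneg
      rw [dist_comm y p] at h3
      rw [Metric.mem_ball]; linarith

theorem isOpen_compl_skeleton {Γ : IsoradialGraph δ} {T : ℝ} (hT : Γ.CondBounded T) :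
    IsOpen Γ.skeletonᶜ := by
  refine Metric.isOpen_iff.mpr fun z hz => ?_
  obtain ⟨ε, hε, h⟩ := exists_ball_skeleton hT z
  refine ⟨ε, hε, fun p hp hps => ?_⟩
  rcases h p hp hps with rfl | ⟨x, y, hxy, -, hzs⟩
  · exact hz hps
  · refine hz (PlaneGraph.mem_skeleton_iff.mpr ?_)
    by_cases hx : z = x
    · exact Or.inl (hx ▸ PlaneGraph.mem_verts_left hxy)
    by_cases hy : z = y
    · exact Or.inl (hy ▸ PlaneGraph.mem_verts_right hxy)
    exact Or.inr ⟨x, y, hxy, PlaneGraph.mem_openSegment_of_mem_segment hzs hx hy⟩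

theorem exists_ball_skeleton_edge {Γ : IsoradialGraph δ} {T : ℝ} (hT : Γ.CondBounded T)
    {x y q : ℂ} (hxy : Γ.graph.Adj x y) (hq : q ∈ openSegment ℝ x y) :
    ∃ ε > 0, ∀ p ∈ Metric.ball q ε, p ∈ Γ.skeleton → p ∈ openSegment ℝ x y := by
  obtain ⟨ε, hε, h⟩ := exists_ball_skeleton hT q
  have hqv := PlaneGraph.notMem_verts_of_mem_openSegment hxy hq
  refine ⟨ε, hε, fun p hp hps => ?_⟩
  rcases h p hp hps with rfl | ⟨x', y', hxy', hp', hqs⟩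
  · exact hq
  · have hq' : q ∈ openSegment ℝ x' y' :=
      PlaneGraph.mem_openSegment_of_mem_segment hqs
        (fun he => hqv (he ▸ PlaneGraph.mem_verts_left hxy'))
        (fun he => hqv (he ▸ PlaneGraph.mem_verts_right hxy'))
    rwa [PlaneGraph.openSegment_eq_of_sym2_eq (PlaneGraph.edge_eq_of_mem hxy hxy' hq hq')]

theorem exists_ball_skeleton_vertex {Γ : IsoradialGraph δ} {T : ℝ} (hT : Γ.CondBounded T)
    {u : ℂ} (hu : u ∈ Γ.verts) :
    ∃ ε > 0, ∀ p ∈ Metric.ball u ε, p ∈ Γ.skeleton →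
      p = u ∨ ∃ s, Γ.graph.Adj u s ∧ p ∈ openSegment ℝ u s := by
  obtain ⟨ε, hε, h⟩ := exists_ball_skeleton hT u
  refine ⟨ε, hε, fun p hp hps => ?_⟩
  rcases h p hp hps with rfl | ⟨x, y, hxy, hp', hus⟩
  · exact Or.inl rfl
  · right
    by_cases hx : u = x
    · exact ⟨y, hx ▸ hxy, hx ▸ hp'⟩
    by_cases hy : u = y
    · exact ⟨x, hy ▸ hxy.symm, by rw [openSegment_symm]; exact hy ▸ hp'⟩
    · exact absurd hu (PlaneGraph.notMem_verts_of_mem_openSegment hxy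
        (PlaneGraph.mem_openSegment_of_mem_segment hus hx hy))

/-! ### Faces inscribed in circles. -/

section Faces

variable {Γ : IsoradialGraph δ} {f : Set ℂ}

theorem face_subset (hf : f ∈ Γ.faces) : f ⊆ Γ.skeletonᶜ := by
  obtain ⟨z, -, rfl⟩ := hf
  exact connectedComponentIn_subset _ _

theorem face_isPreconnected (hf : f ∈ Γ.faces) : IsPreconnected f := by
  obtain ⟨z, -, rfl⟩ := hf
  exact isPreconnected_connectedComponentIn

theorem face_isOpen {T : ℝ} (hT : Γ.CondBounded T) (hf : f ∈ Γ.faces) : IsOpen f := by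
  obtain ⟨z, -, rfl⟩ := hf
  exact (isOpen_compl_skeleton hT).connectedComponentIn

theorem subset_face (hf : f ∈ Γ.faces) {S : Set ℂ} (hS : IsPreconnected S)
    (hsub : S ⊆ Γ.skeletonᶜ) (hmeet : (S ∩ f).Nonempty) : S ⊆ f := by
  obtain ⟨z, -, rfl⟩ := hf
  obtain ⟨p, hpS, hpf⟩ := hmeet
  rw [connectedComponentIn_eq hpf]
  exact hS.subset_connectedComponentIn hpS hsub

theorem exists_face_of_isPreconnected {S : Set ℂ} (hS : IsPreconnected S)
    (hsub : S ⊆ Γ.skeletonᶜ) (hne : S.Nonempty) : ∃ f ∈ Γ.faces, S ⊆ f := by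
  obtain ⟨p, hp⟩ := hne
  exact ⟨_, ⟨p, hsub hp, rfl⟩, hS.subset_connectedComponentIn hp hsub⟩

theorem frontier_face_subset {T : ℝ} (hT : Γ.CondBounded T) (hf : f ∈ Γ.faces) :
    frontier f ⊆ Γ.skeleton := by
  intro p hp
  by_contra hps
  obtain ⟨g, hg, hpg⟩ := exists_face_of_isPreconnected (Γ := Γ) (S := {p})
    isPreconnected_singleton (by simpa using hps) (singleton_nonempty p)
  have hgo := face_isOpen hT hg
  have hpg' : p ∈ g := hpg rfl
  obtain ⟨q, hqg, hqf⟩ := mem_closure_iff.mp (frontier_subset_closure hp) g hgo hpg'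
  have hgf : g ⊆ f := subset_face hf (face_isPreconnected hg) (face_subset hg) ⟨q, hqg, hqf⟩
  rw [(face_isOpen hT hf).frontier_eq] at hp
  exact hp.2 (hgf hpg')

theorem mem_frontier_of_mem_closure {T : ℝ} (hT : Γ.CondBounded T) (hf : f ∈ Γ.faces) {p : ℂ}
    (hp : p ∈ closure f) (hps : p ∈ Γ.skeleton) : p ∈ frontier f := by
  rw [(face_isOpen hT hf).frontier_eq]
  exact ⟨hp, fun h => face_subset hf h hps⟩

/-- A half disc with its diameter on an edge lies in one face. -/
theorem edge_near_subset_closure {T : ℝ} (hT : Γ.CondBounded T) (hf : f ∈ Γ.faces)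
    {x y q : ℂ} (hxy : Γ.graph.Adj x y) (hq : q ∈ openSegment ℝ x y) (hqf : q ∈ closure f) :
    ∃ ε > 0, ∀ p ∈ Metric.ball q ε, p ∈ openSegment ℝ x y → p ∈ closure f := by
  obtain ⟨ε, hε, hball⟩ := exists_ball_skeleton_edge hT hxy hq
  have hd : y - x ≠ 0 := sub_ne_zero.mpr hxy.ne'
  have hline : ∀ p ∈ openSegment ℝ x y, ∀ r ∈ openSegment ℝ x y, ((p - r) / (y - x)).im = 0 := by
    intro p hp r hr
    rw [openSegment_eq_image'] at hp hr
    obtain ⟨a, -, rfl⟩ := hp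
    obtain ⟨b, -, rfl⟩ := hr
    have : (x + a • (y - x) - (x + b • (y - x))) / (y - x) = ((a - b : ℝ) : ℂ) := by
      rw [div_eq_iff hd]; push_cast; simp only [Complex.real_smul]; ring
    simp only [this, Complex.ofReal_im]
  -- `f` meets the ball off the line
  obtain ⟨p, hpb, hpf, hpim⟩ :
      ∃ p ∈ Metric.ball q ε, p ∈ f ∧ ((p - q) / (y - x)).im ≠ 0 := by
    obtain ⟨p, hpb, hpf⟩ := mem_closure_iff.mp hqf _ Metric.isOpen_ball (Metric.mem_ball_self hε)
    by_cases him : ((p - q) / (y - x)).im = 0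
    · have ho : IsOpen (Metric.ball q ε ∩ f) := Metric.isOpen_ball.inter (face_isOpen hT hf)
      have hc : Filter.Tendsto (fun t : ℝ => p + t * Complex.I * (y - x)) (nhdsWithin 0 (Ioi 0))
          (nhds p) := by
        have : Continuous fun t : ℝ => p + t * Complex.I * (y - x) := by fun_prop
        simpa using (this.tendsto 0).mono_left nhdsWithin_le_nhds
      have hev := hc.eventually (ho.mem_nhds ⟨hpb, hpf⟩)
      obtain ⟨t, ht, ht0⟩ := (hev.and self_mem_nhdsWithin).exists
      refine ⟨_, ht.1, ht.2, ?_⟩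
      have : (p + t * Complex.I * (y - x) - q) / (y - x) = (p - q) / (y - x) + t * Complex.I := by
        field_simp; ring
      rw [this]
      simp only [Complex.add_im, him, Complex.mul_im, Complex.ofReal_re, Complex.I_im,
        Complex.ofReal_im, Complex.I_re]
      simpa using ne_of_gt ht0
    · exact ⟨p, hpb, hpf, him⟩
  obtain ⟨σ, hσ, hσp⟩ : ∃ σ : ℝ, σ ≠ 0 ∧ 0 < σ * ((p - q) / (y - x)).im :=
    ⟨_, hpim, mul_self_pos.mpr hpim⟩
  -- The half disc on the side of `p` is convex and misses the skeleton, which inside the ball is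
  -- only the edge. So it lies in `f`, and its diameter in the closure of `f`.
  set H : Set ℂ := Metric.ball q ε ∩ {r | 0 < σ * ((r - q) / (y - x)).im} with hH
  have hconv : Convex ℝ H := by
    refine (convex_ball q ε).inter ?_
    intro r hr r' hr' a b ha hb hab
    have : (a • r + b • r' - q) / (y - x) = a * ((r - q) / (y - x)) + b * ((r' - q) / (y - x)) := by
      have hab' : (a : ℂ) + b = 1 := by exact_mod_cast hab
      field_simp
      simp only [Complex.real_smul]
      linear_combination q * hab'
    simp only [mem_ofPred_eq] at hr hr' ⊢
    rw [this]
    simp only [Complex.add_im, Complex.im_ofReal_mul]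
    rcases ha.eq_or_lt with rfl | ha'
    · have : b = 1 := by linarith
      subst this; simpa using hr'
    · nlinarith [mul_pos ha' hr, mul_nonneg hb hr'.le]
  have hHf : H ⊆ f := by
    refine subset_face hf hconv.isPreconnected (fun r hr hrs => ?_) ⟨p, ⟨hpb, hσp⟩, hpf⟩
    have := hline r (hball r hr.1 hrs) q hq
    have h2 := hr.2
    simp [this] at h2
  refine ⟨ε, hε, fun r hr hrs => closure_mono hHf ?_⟩
  have hc : Filter.Tendsto (fun t : ℝ => r + t * (σ * Complex.I * (y - x)))
      (nhdsWithin 0 (Ioi 0)) (nhds r) := by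
    have : Continuous fun t : ℝ => r + t * (σ * Complex.I * (y - x)) := by fun_prop
    simpa using (this.tendsto 0).mono_left nhdsWithin_le_nhds
  refine mem_closure_of_tendsto hc ?_
  filter_upwards [hc.eventually (Metric.isOpen_ball.mem_nhds hr), self_mem_nhdsWithin] with t ht ht0
  refine ⟨ht, ?_⟩
  have : (r + t * (σ * Complex.I * (y - x)) - q) / (y - x) =
      (r - q) / (y - x) + (t * σ : ℝ) * Complex.I := by
    push_cast; field_simp; ring
  have ht0' : 0 < t := ht0
  simp only [mem_ofPred_eq, this, Complex.add_im, hline r hrs q hq, Complex.im_ofReal_mul,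
    Complex.I_im]
  have : 0 < σ ^ 2 := by positivity
  nlinarith

/-- A face whose closure meets an open edge has both endpoints of the edge on its frontier. -/
theorem endpoints_mem_frontier {T : ℝ} (hT : Γ.CondBounded T) (hf : f ∈ Γ.faces)
    {x y q : ℂ} (hxy : Γ.graph.Adj x y) (hq : q ∈ openSegment ℝ x y) (hqf : q ∈ closure f) :
    x ∈ frontier f ∧ y ∈ frontier f := by
  have hsub : openSegment ℝ x y ⊆ closure f := by
    set γ : ℝ → ℂ := fun t => AffineMap.lineMap x y t with hγ
    have hγc : Continuous γ := AffineMap.lineMap_continuous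
    have himg : openSegment ℝ x y = γ '' Ioo 0 1 := openSegment_eq_image_lineMap ℝ x y
    set A : Set ℝ := γ ⁻¹' closure f with hA
    have hAc : IsClosed A := isClosed_closure.preimage hγc
    -- The parameters whose points lie in the closure of `f` form a closed set, which the half-disc
    -- argument shows to be open in (0, 1) as well; connectedness spreads it over the whole edge.
    have hint : ∀ t ∈ Ioo (0 : ℝ) 1, t ∈ A → t ∈ interior A := by
      intro t ht htA
      obtain ⟨ε, hε, h⟩ := edge_near_subset_closure hT hf hxy (himg ▸ mem_image_of_mem γ ht) htA
      rw [mem_interior_iff_mem_nhds]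
      filter_upwards [hγc.continuousAt.eventually (Metric.ball_mem_nhds (γ t) hε),
        Ioo_mem_nhds ht.1 ht.2] with t' h1 h2
      exact h _ h1 (himg ▸ mem_image_of_mem γ h2)
    obtain ⟨t₀, ht₀, rfl⟩ : q ∈ γ '' Ioo 0 1 := himg ▸ hq
    have := (isPreconnected_Ioo (a := (0 : ℝ)) (b := 1)).subset_of_closure_inter_subset
      (u := interior A) isOpen_interior ⟨t₀, ht₀, hint t₀ ht₀ hqf⟩
      (fun t ht => hint t ht.2 ((closure_mono interior_subset).trans hAc.closure_eq.subset ht.1))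
    rw [himg]
    rintro _ ⟨t, ht, rfl⟩
    exact (interior_subset (this ht) : t ∈ A)
  have hcl : segment ℝ x y ⊆ closure f :=
    segment_subset_closure_openSegment.trans (closure_minimal hsub isClosed_closure)
  exact ⟨mem_frontier_of_mem_closure hT hf (hcl (left_mem_segment ℝ x y))
      (Or.inl (PlaneGraph.mem_verts_left hxy)),
    mem_frontier_of_mem_closure hT hf (hcl (right_mem_segment ℝ x y))
      (Or.inl (PlaneGraph.mem_verts_right hxy))⟩

/-- A face inscribed in a circle lies on one side of each of its boundary chords. -/
theorem face_side (hf : f ∈ Γ.faces) {c : ℂ} (hc : c ∈ f) (hball : f ⊆ Metric.ball c δ)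
    {x y : ℂ} (hxy : Γ.graph.Adj x y) (hx : dist x c = δ) (hy : dist y c = δ) :
    ∀ p ∈ f, 0 < ((p - x) / (y - x)).im * ((c - x) / (y - x)).im := by
  have hd : y - x ≠ 0 := sub_ne_zero.mpr hxy.ne'
  -- The line through the chord meets the open disc only in the open chord, which belongs to the
  -- skeleton. So the face misses the whole line and, being connected, stays on the side of `c`.
  have hne : ∀ p ∈ f, ((p - x) / (y - x)).im ≠ 0 := by
    intro p hp him
    set a : ℝ := ((p - x) / (y - x)).re with ha
    have hpa : p = x + a • (y - x) := by
      have : (p - x) / (y - x) = (a : ℂ) := Complex.ext rfl (by simp [him])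
      rw [div_eq_iff hd] at this
      rw [Complex.real_smul, ← this]; ring
    have hps : p ∉ openSegment ℝ x y := fun h =>
      face_subset hf hp (PlaneGraph.openSegment_subset_skeleton hxy h)
    rw [openSegment_eq_image'] at hps
    have haI : ¬ (0 < a ∧ a < 1) := fun h => hps ⟨a, h, hpa.symm⟩
    have hpc : ‖p - c‖ < δ := by simpa [dist_eq_norm] using hball hp
    rw [dist_eq_norm] at hx hy
    have hδ := Γ.mesh_pos
    -- Stewart's theorem: as both endpoints are at distance δ from `c`, a point of the line inside
    -- the disc has `a * (1 - a) > 0`.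
    have key : ‖p - c‖ ^ 2 = (1 - a) * ‖x - c‖ ^ 2 + a * ‖y - c‖ ^ 2
        - a * (1 - a) * ‖y - x‖ ^ 2 := by
      rw [hpa]
      simp only [Complex.sq_norm, Complex.normSq_apply, Complex.real_smul, Complex.add_re,
        Complex.sub_re, Complex.sub_im, Complex.add_im, Complex.re_ofReal_mul,
        Complex.im_ofReal_mul]
      ring
    have h1 : ‖p - c‖ ^ 2 < δ ^ 2 := by gcongr
    rw [hx, hy] at key
    have h2 : 0 < a * (1 - a) := by
      have : 0 ≤ ‖y - x‖ ^ 2 := by positivity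
      by_contra hcon
      nlinarith
    exact haI (by
      constructor
      · by_contra h; nlinarith
      · by_contra h; nlinarith)
  intro p hp
  by_contra hcon
  have hcont : ContinuousOn (fun p : ℂ => ((p - x) / (y - x)).im * ((c - x) / (y - x)).im) f := by
    fun_prop
  have hcc : 0 < ((c - x) / (y - x)).im * ((c - x) / (y - x)).im := mul_self_pos.mpr (hne c hc)
  obtain ⟨r, hr, hr0⟩ := (face_isPreconnected hf).intermediate_value hp hc hcont
    ⟨not_lt.mp hcon, hcc.le⟩
  rcases mul_eq_zero.mp hr0 with h | h
  · exact hne r hr h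
  · exact hne c hc h

end Faces

end IsoradialGraph

/-! ### Polar coordinates and the cyclic order of the edges at a vertex. -/

theorem polar_unique {a b φ ψ : ℝ} (ha : 0 < a) (hb : 0 < b) (hlt : |φ - ψ| < 2 * Real.pi)
    (h : (a : ℂ) * Complex.exp (φ * Complex.I) = b * Complex.exp (ψ * Complex.I)) :
    a = b ∧ φ = ψ := by
  have hn := congrArg norm h
  simp only [norm_mul, Complex.norm_exp_ofReal_mul_I, mul_one, Complex.norm_real,
    Real.norm_eq_abs, abs_of_pos ha, abs_of_pos hb] at hn
  refine ⟨hn, ?_⟩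
  subst hn
  have h2 := mul_left_cancel₀ (by exact_mod_cast ha.ne') h
  rw [Complex.exp_eq_exp_iff_exists_int] at h2
  obtain ⟨n, hn⟩ := h2
  have h3 : φ - ψ = n * (2 * Real.pi) := by
    have := congrArg Complex.im hn
    simp at this
    linarith
  rw [h3, abs_mul, abs_of_pos Real.two_pi_pos] at hlt
  have h4 : |(n : ℝ)| < 1 := by
    by_contra hcon
    nlinarith [Real.two_pi_pos]
  have h5 : n = 0 := by
    rw [← Int.abs_lt_one_iff]; exact_mod_cast h4
  rw [h5] at h3
  simp at h3
  linarith

theorem exists_polar_Ioc {w : ℂ} (hw : w ≠ 0) :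
    ∃ a > (0 : ℝ), ∃ φ ∈ Ioc 0 (2 * Real.pi), w = a * Complex.exp (φ * Complex.I) := by
  have h := Complex.norm_mul_exp_arg_mul_I w
  have hn : 0 < ‖w‖ := norm_pos_iff.mpr hw
  have h1 := Complex.neg_pi_lt_arg w
  have h2 := Complex.arg_le_pi w
  rcases lt_or_ge 0 w.arg with h0 | h0
  · exact ⟨_, hn, w.arg, ⟨h0, by linarith [Real.pi_pos]⟩, h.symm⟩
  · refine ⟨_, hn, w.arg + 2 * Real.pi, ⟨by linarith, by linarith⟩, ?_⟩
    push_cast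
    rw [add_mul, Complex.exp_add, Complex.exp_two_pi_mul_I, mul_one]
    exact h.symm

theorem exists_polar_Ico {w : ℂ} (hw : w ≠ 0) :
    ∃ a > (0 : ℝ), ∃ φ ∈ Ico 0 (2 * Real.pi), w = a * Complex.exp (φ * Complex.I) := by
  obtain ⟨a, ha, φ, hφ, h⟩ := exists_polar_Ioc hw
  rcases hφ.2.eq_or_lt with rfl | hlt
  · refine ⟨a, ha, 0, ⟨le_rfl, Real.two_pi_pos⟩, ?_⟩
    rw [h]; push_cast
    rw [Complex.exp_two_pi_mul_I]; simp
  · exact ⟨a, ha, φ, ⟨hφ.1.le, hlt⟩, h⟩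

namespace IsoradialGraph

variable {δ : ℝ} {Γ : IsoradialGraph δ} {T : ℝ}

theorem finite_neighbors (hT : Γ.CondBounded T) (u : ℂ) : {s | Γ.graph.Adj u s}.Finite :=
  (Γ.locallyFinite u (2 * δ)).subset fun s hs =>
    ⟨PlaneGraph.mem_verts_right hs, by
      rw [Metric.mem_ball, dist_comm]; exact hT.dist_lt hs⟩

/-- A sector at a vertex without edges inside lies, near the vertex, in a single face. -/
theorem exists_face_sector (hT : Γ.CondBounded T) {u D : ℂ} (hu : u ∈ Γ.verts) (hD : D ≠ 0)
    {β : ℝ} (hβ : 0 < β)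
    (hno : ∀ s, Γ.graph.Adj u s → ∀ φ ∈ Ioo 0 β, ∀ a > (0 : ℝ),
      s - u ≠ a * Complex.exp (φ * Complex.I) * D) :
    ∃ f ∈ Γ.faces, ∃ ε > 0, ∀ r ∈ Ioo 0 ε, ∀ φ ∈ Ioo 0 β,
      u + (r : ℝ) * Complex.exp ((φ : ℝ) * Complex.I) * D ∈ f := by
  obtain ⟨ε, hε, hball⟩ := exists_ball_skeleton_vertex hT hu
  have hDn : 0 < ‖D‖ := norm_pos_iff.mpr hD
  set F : ℝ × ℝ → ℂ := fun p => u + (p.1 : ℝ) * Complex.exp ((p.2 : ℝ) * Complex.I) * D with hF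
  have hpre : IsPreconnected (F '' (Ioo 0 (ε / ‖D‖) ×ˢ Ioo 0 β)) :=
    (isPreconnected_Ioo.prod isPreconnected_Ioo).image _ (by fun_prop)
  have hsub : F '' (Ioo 0 (ε / ‖D‖) ×ˢ Ioo 0 β) ⊆ Γ.skeletonᶜ := by
    rintro _ ⟨⟨r, φ⟩, ⟨hr, hφ⟩, rfl⟩ hsk
    simp only at hr hφ
    have hrD : (r : ℂ) * Complex.exp (φ * Complex.I) * D ≠ 0 :=
      mul_ne_zero (mul_ne_zero (by exact_mod_cast hr.1.ne') (Complex.exp_ne_zero _)) hD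
    have hb : F (r, φ) ∈ Metric.ball u ε := by
      simp only [hF, Metric.mem_ball, dist_eq_norm, add_sub_cancel_left, norm_mul,
        Complex.norm_exp_ofReal_mul_I, Complex.norm_real, Real.norm_eq_abs, abs_of_pos hr.1,
        mul_one]
      exact (lt_div_iff₀ hDn).mp hr.2
    rcases hball _ hb hsk with h | ⟨s, hs, h⟩
    · simp only [hF] at h
      exact hrD (by linear_combination h)
    · rw [openSegment_eq_image'] at h
      obtain ⟨a, ha, h⟩ := h
      refine hno s hs φ hφ (r / a) (div_pos hr.1 ha.1) ?_
      have ha0 : (a : ℂ) ≠ 0 := by exact_mod_cast ha.1.ne'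
      simp only [hF, Complex.real_smul] at h
      push_cast
      field_simp
      linear_combination h
  obtain ⟨f, hf, hsubf⟩ := exists_face_of_isPreconnected hpre hsub
    ⟨_, mem_image_of_mem _ (⟨⟨half_pos (div_pos hε hDn), half_lt_self (div_pos hε hDn)⟩,
      ⟨half_pos hβ, half_lt_self hβ⟩⟩ :
      ((ε / ‖D‖ / 2, β / 2) : ℝ × ℝ) ∈ Ioo 0 (ε / ‖D‖) ×ˢ Ioo 0 β)⟩
  exact ⟨f, hf, ε / ‖D‖, div_pos hε hDn, fun r hr φ hφ =>
    hsubf ⟨(r, φ), ⟨hr, hφ⟩, rfl⟩⟩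

/-- The closure of the sector is in the closure of the face. -/
theorem sector_closure {f : Set ℂ} {u D : ℂ} {β ε : ℝ} (hβ : 0 < β) (hε : 0 < ε)
    (h : ∀ r ∈ Ioo 0 ε, ∀ φ ∈ Ioo 0 β,
      u + (r : ℝ) * Complex.exp ((φ : ℝ) * Complex.I) * D ∈ f) :
    ∀ r ∈ Icc 0 ε, ∀ φ ∈ Icc 0 β,
      u + (r : ℝ) * Complex.exp ((φ : ℝ) * Complex.I) * D ∈ closure f := by
  intro r hr φ hφ
  set F : ℝ × ℝ → ℂ := fun p => u + (p.1 : ℝ) * Complex.exp ((p.2 : ℝ) * Complex.I) * D with hF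
  have hc : Continuous F := by fun_prop
  have hmem : (r, φ) ∈ closure (Ioo 0 ε ×ˢ Ioo 0 β) := by
    rw [closure_prod_eq, closure_Ioo hε.ne, closure_Ioo hβ.ne]
    exact ⟨hr, hφ⟩
  have := image_closure_subset_closure_image hc ⟨_, hmem, rfl⟩
  refine closure_mono ?_ this
  rintro _ ⟨p, hp, rfl⟩
  exact h p.1 hp.1 p.2 hp.2

/-- Around an isolated vertex a punctured disc would lie in one face. That face is contained in a
disc with `u` on its circle, and moving from `u` away from the center leaves the closed disc. -/
theorem exists_neighbor (hT : Γ.CondBounded T) {u : ℂ} (hu : u ∈ Γ.verts) :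
    ∃ s, Γ.graph.Adj u s := by
  by_contra hcon
  push Not at hcon
  have hδ := Γ.mesh_pos
  obtain ⟨f, hf, ε, hε, h⟩ := exists_face_sector hT hu one_ne_zero Real.two_pi_pos
    (fun s hs => absurd hs (hcon s))
  have hcl := sector_closure Real.two_pi_pos hε h
  have huf : u ∈ closure f := by
    simpa using hcl 0 ⟨le_rfl, hε.le⟩ 0 ⟨le_rfl, Real.two_pi_pos.le⟩
  obtain ⟨c, hc, hball, hcirc⟩ := Γ.isoradial f hf
  have huc := hcirc u ⟨hu, mem_frontier_of_mem_closure hT hf huf (Or.inl hu)⟩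
  have huc' : u - c ≠ 0 := by
    intro h0; rw [dist_eq_norm, h0] at huc; simp at huc; linarith
  obtain ⟨a, ha, φ, hφ, hp⟩ := exists_polar_Ioc huc'
  have hmem := hcl ε ⟨hε.le, le_rfl⟩ φ ⟨hφ.1.le, hφ.2⟩
  have h2 := closure_minimal (hball.trans Metric.ball_subset_closedBall)
    Metric.isClosed_closedBall hmem
  rw [mul_one, Metric.mem_closedBall, dist_eq_norm] at h2
  have h3 : u + ε * Complex.exp (φ * Complex.I) - c = ((a + ε : ℝ) : ℂ) * Complex.exp (φ * Complex.I) := by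
    push_cast; linear_combination hp
  rw [h3, norm_mul, Complex.norm_exp_ofReal_mul_I, Complex.norm_real, Real.norm_eq_abs,
    abs_of_pos (by positivity)] at h2
  rw [dist_eq_norm, hp, norm_mul, Complex.norm_exp_ofReal_mul_I, Complex.norm_real,
    Real.norm_eq_abs, abs_of_pos ha] at huc
  linarith

/-- `t` is the next neighbour of `u` after `s`, counterclockwise. -/
structure IsNext (Γ : IsoradialGraph δ) (u s t : ℂ) (β a : ℝ) : Prop where
  adj_left : Γ.graph.Adj u s
  adj_right : Γ.graph.Adj u t
  angle_pos : 0 < β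
  angle_le : β ≤ 2 * Real.pi
  ratio_pos : 0 < a
  eq : t - u = a * Complex.exp (β * Complex.I) * (s - u)
  minimal : ∀ v, Γ.graph.Adj u v → ∀ φ ∈ Ioo 0 β, ∀ b > (0 : ℝ),
    v - u ≠ b * Complex.exp (φ * Complex.I) * (s - u)

theorem exists_isNext (hT : Γ.CondBounded T) {u s : ℂ} (hs : Γ.graph.Adj u s) :
    ∃ t β a, Γ.IsNext u s t β a := by
  have hsu : s - u ≠ 0 := sub_ne_zero.mpr hs.ne'
  -- Angles are taken in (0, 2π], so `s` itself has angle 2π and becomes its own successor only if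
  -- it is the sole neighbour.
  have hex : ∀ t : {t // Γ.graph.Adj u t}, ∃ a > (0 : ℝ), ∃ φ ∈ Ioc 0 (2 * Real.pi),
      ((t : ℂ) - u) / (s - u) = a * Complex.exp (φ * Complex.I) := fun t =>
    exists_polar_Ioc (div_ne_zero (sub_ne_zero.mpr t.2.ne') hsu)
  choose a ha φ hφ h using hex
  have : Finite {t // Γ.graph.Adj u t} := (finite_neighbors hT u).to_subtype
  have : Nonempty {t // Γ.graph.Adj u t} := ⟨⟨s, hs⟩⟩
  obtain ⟨t, ht⟩ := Finite.exists_min φ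
  refine ⟨t, φ t, a t, hs, t.2, (hφ t).1, (hφ t).2, ha t, ?_, ?_⟩
  · rw [← h t, div_mul_cancel₀ _ hsu]
  · intro v hv ψ hψ b hb heq
    have h1 := h ⟨v, hv⟩
    rw [heq, mul_div_cancel_right₀ _ hsu] at h1
    have h2 := (polar_unique hb (ha ⟨v, hv⟩) (by
      rw [abs_lt]
      constructor <;> linarith [(hφ ⟨v, hv⟩).1, (hφ ⟨v, hv⟩).2, hψ.1, hψ.2, (hφ t).2]) h1).2
    have h3 := ht ⟨v, hv⟩
    linarith [hψ.2]

theorem neighbor_eq_of_ray {u s t : ℂ} (hs : Γ.graph.Adj u s) (ht : Γ.graph.Adj u t) {a : ℝ}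
    (ha : 0 < a) (h : t - u = a * (s - u)) : s = t := by
  set b : ℝ := min 1 a / 2 with hb
  have hb0 : 0 < b := by positivity
  have hb1 : b < 1 := by have := min_le_left 1 a; linarith
  have hba : b < a := by have := min_le_right 1 a; have : 0 < min 1 a := by positivity
                         linarith
  have h1 : u + b • (s - u) ∈ openSegment ℝ u s := by
    rw [openSegment_eq_image']; exact ⟨b, ⟨hb0, hb1⟩, rfl⟩
  have h2 : u + b • (s - u) ∈ openSegment ℝ u t := by
    rw [openSegment_eq_image']
    refine ⟨b / a, ⟨by positivity, (div_lt_one ha).mpr hba⟩, ?_⟩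
    have ha0 : (a : ℂ) ≠ 0 := by exact_mod_cast ha.ne'
    simp only [Complex.real_smul, h]
    push_cast
    field_simp
  rcases Sym2.eq_iff.mp (PlaneGraph.edge_eq_of_mem hs ht h1 h2) with ⟨-, h⟩ | ⟨h, -⟩
  · exact h
  · exact absurd h ht.ne

/-- If `t` followed two neighbours, the one at the smaller angle from `t` would lie inside the empty
sector of the other one, or on the same ray. -/
theorem IsNext.injective {u s s' t : ℂ} {β β' a a' : ℝ} (h : Γ.IsNext u s t β a)
    (h' : Γ.IsNext u s' t β' a') : s = s' := by
  wlog hle : β' ≤ β generalizing s s' β β' a a'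
  · exact (this h' h (not_le.mp hle).le).symm
  have hE : Complex.exp (β' * Complex.I) ≠ 0 := Complex.exp_ne_zero _
  have ha' : (a' : ℂ) ≠ 0 := by exact_mod_cast h'.ratio_pos.ne'
  have key : s' - u = ((a / a' : ℝ) : ℂ) * Complex.exp (((β - β' : ℝ) : ℂ) * Complex.I) * (s - u) := by
    have h1 := h.eq.symm.trans h'.eq
    push_cast
    rw [sub_mul, Complex.exp_sub]
    generalize Complex.exp (β' * Complex.I) = B at *
    field_simp
    linear_combination -h1
  rcases hle.eq_or_lt with rfl | hlt
  · refine neighbor_eq_of_ray h.adj_left h'.adj_left (div_pos h.ratio_pos h'.ratio_pos) ?_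
    simpa using key
  · exact absurd key (h.minimal s' h'.adj_left _ ⟨by linarith, by linarith [h'.angle_pos]⟩ _
      (div_pos h.ratio_pos h'.ratio_pos))

/-- The center is equidistant from `u` and `s`, hence projects to the midpoint of the edge, and its
height over the edge is |s - u| tan θ / 2. The sign is settled by the side on which the face lies.
-/
theorem center_eq (hT : Γ.CondBounded T) {u s c : ℂ} (hs : Γ.graph.Adj u s)
    (hu : dist u c = δ) (hsc : dist s c = δ) :
    ((c - u) / (s - u)).re = 1 / 2 ∧ ((c - u) / (s - u)).im ^ 2 = (Γ.cond u s / 2) ^ 2 := by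
  have hsu : s - u ≠ 0 := sub_ne_zero.mpr hs.ne'
  set w := (c - u) / (s - u) with hw
  have hcw : c - u = w * (s - u) := by rw [hw, div_mul_cancel₀ _ hsu]
  have h1 : ‖w‖ ^ 2 * ‖s - u‖ ^ 2 = δ ^ 2 := by
    rw [← mul_pow, ← norm_mul, ← hcw, ← hu, dist_comm, dist_eq_norm]
  have h2 : ‖1 - w‖ ^ 2 * ‖s - u‖ ^ 2 = δ ^ 2 := by
    rw [← mul_pow, ← norm_mul, ← hsc, dist_eq_norm]
    congr 2; linear_combination hcw
  have h3 := hT.dist_sq u s hs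
  rw [dist_comm, dist_eq_norm] at h3
  have hn : 0 < ‖s - u‖ ^ 2 := by positivity
  simp only [Complex.sq_norm w, Complex.sq_norm (1 - w), Complex.normSq_apply, Complex.sub_re,
    Complex.sub_im, Complex.one_re, Complex.one_im] at h1 h2
  have h4 : w.re = 1 / 2 := by
    have : (1 - 2 * w.re) * ‖s - u‖ ^ 2 = 0 := by linear_combination h2 - h1
    rcases mul_eq_zero.mp this with h | h
    · linarith
    · exact absurd h hn.ne'
  refine ⟨h4, ?_⟩
  rw [h4] at h1
  have : (w.im ^ 2 - (Γ.cond u s / 2) ^ 2) * ‖s - u‖ ^ 2 = 0 := by linear_combination h1 - h3 / 4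
  rcases mul_eq_zero.mp this with h | h
  · linarith
  · exact absurd h hn.ne'

theorem center_eq_left (hT : Γ.CondBounded T) {u s c : ℂ} (hs : Γ.graph.Adj u s)
    (hu : dist u c = δ) (hsc : dist s c = δ) (him : 0 < ((c - u) / (s - u)).im) :
    c - u = (s - u) * (1 + Γ.cond u s * Complex.I) / 2 := by
  have hsu : s - u ≠ 0 := sub_ne_zero.mpr hs.ne'
  obtain ⟨h1, h2⟩ := center_eq hT hs hu hsc
  have hc := hT.cond_pos hs
  have h3 : ((c - u) / (s - u)).im = Γ.cond u s / 2 := by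
    rcases sq_eq_sq_iff_eq_or_eq_neg.mp h2 with h | h
    · exact h
    · linarith
  have h4 : (c - u) / (s - u) = (1 + Γ.cond u s * Complex.I) / 2 := by
    apply Complex.ext
    · simp [h1]
    · simp [h3]
  rw [div_eq_iff hsu] at h4
  rw [h4]; ring

theorem center_eq_right (hT : Γ.CondBounded T) {u s c : ℂ} (hs : Γ.graph.Adj u s)
    (hu : dist u c = δ) (hsc : dist s c = δ) (him : ((c - u) / (s - u)).im < 0) :
    c - u = (s - u) * (1 - Γ.cond u s * Complex.I) / 2 := by
  have hsu : s - u ≠ 0 := sub_ne_zero.mpr hs.ne'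
  obtain ⟨h1, h2⟩ := center_eq hT hs hu hsc
  have hc := hT.cond_pos hs
  have h3 : ((c - u) / (s - u)).im = -(Γ.cond u s / 2) := by
    rcases sq_eq_sq_iff_eq_or_eq_neg.mp h2 with h | h
    · linarith
    · exact h
  have h4 : (c - u) / (s - u) = (1 - Γ.cond u s * Complex.I) / 2 := by
    apply Complex.ext
    · simp [h1]
    · simp [h3]; ring
  rw [div_eq_iff hsu] at h4
  rw [h4]; ring

/-- The face between two consecutive edges at `u` and the position of its center. -/
theorem IsNext.exists_face (hT : Γ.CondBounded T) {u s t : ℂ} {β a : ℝ}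
    (h : Γ.IsNext u s t β a) :
    ∃ f ∈ Γ.faces, ∃ c, (∀ v ∈ Γ.verts ∩ frontier f, dist v c = δ) ∧ u ∈ frontier f ∧
      (∃ ε > 0, ∀ r ∈ Ioo 0 ε, ∀ φ ∈ Ioo 0 β,
        u + (r : ℝ) * Complex.exp ((φ : ℝ) * Complex.I) * (s - u) ∈ f) ∧
      c - u = (s - u) * (1 + Γ.cond u s * Complex.I) / 2 ∧
      c - u = (t - u) * (1 - Γ.cond u t * Complex.I) / 2 ∧
      (∀ p ∈ f, 0 < ((p - u) / (s - u)).im) ∧ (∀ p ∈ f, ((p - u) / (t - u)).im < 0) := by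
  have hsu : s - u ≠ 0 := sub_ne_zero.mpr h.adj_left.ne'
  have htu : t - u ≠ 0 := sub_ne_zero.mpr h.adj_right.ne'
  have hu : u ∈ Γ.verts := PlaneGraph.mem_verts_left h.adj_left
  have hpi := Real.pi_pos
  have hβ := h.angle_pos
  obtain ⟨f, hf, ε, hε, hgerm⟩ := exists_face_sector hT hu hsu h.angle_pos h.minimal
  have hcl := sector_closure h.angle_pos hε hgerm
  obtain ⟨c, hc, hball, hcirc⟩ := Γ.isoradial f hf
  have huf : u ∈ frontier f := mem_frontier_of_mem_closure hT hf
    (by simpa using hcl 0 ⟨le_rfl, hε.le⟩ 0 ⟨le_rfl, hβ.le⟩) (Or.inl hu)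
  have hsf : s ∈ frontier f := by
    set b := min ε (1 / 2) with hb
    have hb0 : 0 < b := by positivity
    refine (endpoints_mem_frontier hT hf h.adj_left (q := u + (b : ℂ) * (s - u)) ?_ ?_).2
    · rw [openSegment_eq_image']
      exact ⟨b, ⟨hb0, lt_of_le_of_lt (min_le_right _ _) (by norm_num)⟩, by simp⟩
    · simpa using hcl b ⟨hb0.le, min_le_left _ _⟩ 0 ⟨le_rfl, hβ.le⟩
  have htf : t ∈ frontier f := by
    set b := min ε (a / 2) with hb
    have ha := h.ratio_pos
    have hb0 : 0 < b := by positivity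
    refine (endpoints_mem_frontier hT hf h.adj_right
      (q := u + (b : ℂ) * Complex.exp (β * Complex.I) * (s - u)) ?_ ?_).2
    · rw [openSegment_eq_image']
      refine ⟨b / a, ⟨by positivity, ?_⟩, ?_⟩
      · rw [div_lt_one ha]
        exact lt_of_le_of_lt (min_le_right _ _) (by linarith)
      · have ha0 : (a : ℂ) ≠ 0 := by exact_mod_cast ha.ne'
        simp only [h.eq, Complex.real_smul]
        push_cast
        field_simp
    · exact hcl b ⟨hb0.le, min_le_left _ _⟩ β ⟨hβ.le, le_rfl⟩
  have huc := hcirc u ⟨hu, huf⟩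
  have hsc := hcirc s ⟨PlaneGraph.mem_verts_right h.adj_left, hsf⟩
  have htc := hcirc t ⟨PlaneGraph.mem_verts_right h.adj_right, htf⟩
  have hside := face_side hf hc hball h.adj_left huc hsc
  have hside' := face_side hf hc hball h.adj_right huc htc
  -- test points of the sector near its two sides
  have hφ0 : 0 < min β Real.pi / 2 := by positivity
  have hφ1 : min β Real.pi / 2 < β := by
    have := min_le_left β Real.pi; linarith
  have hφ2 : min β Real.pi / 2 < Real.pi := by
    have := min_le_right β Real.pi; linarith
  set φ := min β Real.pi / 2
  -- Halving `min β π` keeps the sine positive even when the sector is wider than a half plane.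
  have hsin : 0 < Real.sin φ := Real.sin_pos_of_pos_of_lt_pi hφ0 hφ2
  have him1 : 0 < ((u + ((ε / 2 : ℝ) : ℂ) * Complex.exp (φ * Complex.I) * (s - u) - u)
      / (s - u)).im := by
    rw [add_sub_cancel_left, mul_div_cancel_right₀ _ hsu, Complex.im_ofReal_mul,
      Complex.exp_ofReal_mul_I_im]
    positivity
  have him2 : ((u + ((ε / 2 : ℝ) : ℂ) * Complex.exp ((β - φ : ℝ) * Complex.I) * (s - u) - u)
      / (t - u)).im < 0 := by
    have ha0 : (a : ℂ) ≠ 0 := by exact_mod_cast h.ratio_pos.ne'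
    have : ((u + ((ε / 2 : ℝ) : ℂ) * Complex.exp ((β - φ : ℝ) * Complex.I) * (s - u) - u)
      / (t - u)) = ((ε / 2 / a : ℝ) : ℂ) * Complex.exp ((-φ : ℝ) * Complex.I) := by
      rw [div_eq_iff htu, h.eq]
      push_cast
      rw [sub_mul, Complex.exp_sub, neg_mul, Complex.exp_neg]
      field_simp [Complex.exp_ne_zero]
      ring
    rw [this, Complex.im_ofReal_mul, Complex.exp_ofReal_mul_I_im, Real.sin_neg]
    have := h.ratio_pos
    have h5 : 0 < ε / 2 / a := by positivity
    nlinarith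
  have hp1 := hside _ (hgerm (ε / 2) ⟨by linarith, by linarith⟩ φ ⟨hφ0, hφ1⟩)
  have hp2 := hside' _ (hgerm (ε / 2) ⟨by linarith, by linarith⟩ (β - φ) ⟨by linarith, by linarith⟩)
  have hcs : 0 < ((c - u) / (s - u)).im := (pos_iff_pos_of_mul_pos hp1).mp him1
  have hct : ((c - u) / (t - u)).im < 0 := (neg_iff_neg_of_mul_pos hp2).mp him2
  refine ⟨f, hf, c, hcirc, huf, ⟨ε, hε, hgerm⟩, center_eq_left hT h.adj_left huc hsc hcs,
    center_eq_right hT h.adj_right huc htc hct, fun p hp => ?_, fun p hp => ?_⟩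
  · exact (pos_iff_pos_of_mul_pos (hside p hp)).mpr hcs
  · exact (neg_iff_neg_of_mul_pos (hside' p hp)).mpr hct

/-! ### Discrete harmonicity of z and z². -/

/-- The finite set of neighbours of a vertex. -/
def nbrs (hT : Γ.CondBounded T) (u : ℂ) : Finset ℂ := (finite_neighbors hT u).toFinset

theorem mem_nbrs {hT : Γ.CondBounded T} {u s : ℂ} : s ∈ nbrs hT u ↔ Γ.graph.Adj u s := by
  simp [nbrs]

/-- The coordinate functions and the quadratic function `z ↦ z²` are discrete harmonic. -/
theorem sum_cond_eq_zero (hT : Γ.CondBounded T) (u : ℂ) :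
    ∑ s ∈ nbrs hT u, (Γ.cond u s : ℂ) * (s - u) = 0 ∧
    ∑ s ∈ nbrs hT u, (Γ.cond u s : ℂ) * (s - u) ^ 2 = 0 := by
  have hnext : ∀ s : ℂ, ∃ t, Γ.graph.Adj u s → ∃ β a, Γ.IsNext u s t β a := fun s => by
    by_cases hs : Γ.graph.Adj u s
    · obtain ⟨t, h⟩ := exists_isNext hT hs
      exact ⟨t, fun _ => h⟩
    · exact ⟨0, fun h => absurd h hs⟩
  choose σ hσ using hnext
  have hmaps : ∀ s ∈ nbrs hT u, σ s ∈ nbrs hT u := fun s hs => by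
    obtain ⟨β, a, h⟩ := hσ s (mem_nbrs.mp hs)
    exact mem_nbrs.mpr h.adj_right
  have hinj : ∀ s ∈ nbrs hT u, ∀ s' ∈ nbrs hT u, σ s = σ s' → s = s' := fun s hs s' hs' he => by
    obtain ⟨β, a, h⟩ := hσ s (mem_nbrs.mp hs)
    obtain ⟨β', a', h'⟩ := hσ s' (mem_nbrs.mp hs')
    rw [← he] at h'
    exact h.injective h'
  -- Both sides are the center, relative to `u`, of the face between the edges to `s` and to `σ s`,
  -- computed from either edge. As `σ` permutes the neighbours, the sums of any `F` over the left
  -- and over the right centers agree. Their termwise difference is iτ(s - u) for F = z and iτ(s -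
  -- u)² for F = z², where τ is the conductance.
  have hcenter : ∀ s ∈ nbrs hT u, (s - u) * (1 + Γ.cond u s * Complex.I) / 2 =
      (σ s - u) * (1 - Γ.cond u (σ s) * Complex.I) / 2 := fun s hs => by
    obtain ⟨β, a, h⟩ := hσ s (mem_nbrs.mp hs)
    obtain ⟨f, -, c, -, -, -, h1, h2, -, -⟩ := h.exists_face hT
    exact h1.symm.trans h2
  have hsum : ∀ F : ℂ → ℂ, ∑ s ∈ nbrs hT u, F ((s - u) * (1 + Γ.cond u s * Complex.I) / 2) =
      ∑ s ∈ nbrs hT u, F ((s - u) * (1 - Γ.cond u s * Complex.I) / 2) := fun F => by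
    rw [Finset.sum_congr rfl fun s hs => by rw [hcenter s hs]]
    refine Finset.sum_bij (fun s _ => σ s) hmaps (fun s hs s' hs' => hinj s hs s' hs') ?_
      (fun s hs => rfl)
    intro t ht
    have := Finset.surj_on_of_inj_on_of_card_le (s := nbrs hT u) (t := nbrs hT u)
      (fun s _ => σ s) hmaps (fun s s' hs hs' he => hinj s hs s' hs' he) le_rfl t ht
    obtain ⟨s, hs, h⟩ := this
    exact ⟨s, hs, h.symm⟩
  constructor
  · have h := sub_eq_zero.mpr (hsum fun z => z)
    rw [← Finset.sum_sub_distrib] at h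
    have h2 : ∑ s ∈ nbrs hT u, (Γ.cond u s : ℂ) * (s - u) = -Complex.I *
        ∑ s ∈ nbrs hT u, ((s - u) * (1 + Γ.cond u s * Complex.I) / 2 -
          (s - u) * (1 - Γ.cond u s * Complex.I) / 2) := by
      rw [Finset.mul_sum]
      refine Finset.sum_congr rfl fun s _ => ?_
      linear_combination (Γ.cond u s : ℂ) * (s - u) * Complex.I_sq
    rw [h2, h, mul_zero]
  · have h := sub_eq_zero.mpr (hsum fun z => z ^ 2)
    rw [← Finset.sum_sub_distrib] at h
    have h2 : ∑ s ∈ nbrs hT u, (Γ.cond u s : ℂ) * (s - u) ^ 2 = -Complex.I *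
        ∑ s ∈ nbrs hT u, (((s - u) * (1 + Γ.cond u s * Complex.I) / 2) ^ 2 -
          ((s - u) * (1 - Γ.cond u s * Complex.I) / 2) ^ 2) := by
      rw [Finset.mul_sum]
      refine Finset.sum_congr rfl fun s _ => ?_
      linear_combination (Γ.cond u s : ℂ) * (s - u) ^ 2 * Complex.I_sq
    rw [h2, h, mul_zero]

end IsoradialGraph

/-! ### Separation of the vertices. -/

namespace IsoradialGraph

variable {δ : ℝ} {Γ : IsoradialGraph δ} {T : ℝ}

/-- Every direction at `u` points along an edge or into a sector between consecutive edges. -/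
theorem exists_sector_of_direction (hT : Γ.CondBounded T) {u e : ℂ} (hu : u ∈ Γ.verts)
    (he : e ≠ 0) :
    (∃ s, Γ.graph.Adj u s ∧ ∃ a > (0 : ℝ), e = a * (s - u)) ∨
    ∃ s t β b, Γ.IsNext u s t β b ∧ ∃ φ ∈ Ioo 0 β, ∃ a > (0 : ℝ),
      e = a * Complex.exp (φ * Complex.I) * (s - u) := by
  have hsu : ∀ t : {t // Γ.graph.Adj u t}, (t : ℂ) - u ≠ 0 := fun t => sub_ne_zero.mpr t.2.ne'
  have hex : ∀ t : {t // Γ.graph.Adj u t}, ∃ a > (0 : ℝ), ∃ φ ∈ Ico 0 (2 * Real.pi),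
      e / (t - u) = a * Complex.exp (φ * Complex.I) := fun t =>
    exists_polar_Ico (div_ne_zero he (hsu t))
  choose a ha φ hφ h using hex
  have : Finite {t // Γ.graph.Adj u t} := (finite_neighbors hT u).to_subtype
  obtain ⟨s₀, hs₀⟩ := exists_neighbor hT hu
  have : Nonempty {t // Γ.graph.Adj u t} := ⟨⟨s₀, hs₀⟩⟩
  obtain ⟨s, hs⟩ := Finite.exists_min φ
  have hes : e = a s * Complex.exp (φ s * Complex.I) * (s - u) := by
    rw [← h s, div_mul_cancel₀ _ (hsu s)]
  rcases (hφ s).1.eq_or_lt with h0 | h0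
  · left
    refine ⟨s, s.2, a s, ha s, ?_⟩
    rw [← h0] at hes
    simpa using hes
  · right
    obtain ⟨t, β, b, hn⟩ := exists_isNext hT s.2
    refine ⟨s, t, β, b, hn, φ s, ⟨h0, ?_⟩, a s, ha s, hes⟩
    -- Otherwise `e` would make the smaller angle `φ s - β` with the edge to `t`, against the choice
    -- of `s`.
    by_contra hle
    have hle := not_lt.mp hle
    have hb := hn.ratio_pos
    have hb0 : (b : ℂ) ≠ 0 := by exact_mod_cast hb.ne'
    have h1 := h ⟨t, hn.adj_right⟩
    have h2 : e / (t - u) = ((a s / b : ℝ) : ℂ) * Complex.exp (((φ s - β : ℝ) : ℂ) * Complex.I) := by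
      rw [div_eq_iff (hsu ⟨t, hn.adj_right⟩), hn.eq, hes]
      push_cast
      rw [sub_mul, Complex.exp_sub]
      have hE : Complex.exp (β * Complex.I) ≠ 0 := Complex.exp_ne_zero _
      generalize Complex.exp (β * Complex.I) = B at *
      field_simp
    rw [h1] at h2
    have h3 := (polar_unique (ha _) (div_pos (ha s) hb) (by
      rw [abs_lt]
      have := hφ ⟨t, hn.adj_right⟩
      have := hφ s
      constructor <;> linarith [(hφ ⟨t, hn.adj_right⟩).1, (hφ ⟨t, hn.adj_right⟩).2, (hφ s).1,
        (hφ s).2, hn.angle_pos]) h2).2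
    have h4 := hs ⟨t, hn.adj_right⟩
    linarith [hn.angle_pos]

theorem exists_mem_frontier {X : Type*} [TopologicalSpace X] {S f : Set X} (hS : IsPreconnected S)
    (hf : IsOpen f) (h1 : (S ∩ f).Nonempty) (h2 : (S ∩ fᶜ).Nonempty) : ∃ p ∈ S, p ∈ frontier f := by
  by_contra hcon
  push Not at hcon
  obtain ⟨q, hqS, hqf⟩ := h2
  refine hqf (hS.subset_left_of_subset_union hf isClosed_closure.isOpen_compl
    (Set.disjoint_left.mpr fun x hx hx' => hx' (subset_closure hx)) (fun x hx => ?_) h1 hqS)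
  by_contra hxx
  rw [mem_union, not_or] at hxx
  refine hcon x hx ?_
  rw [hf.frontier_eq]
  exact ⟨not_not.mp hxx.2, hxx.1⟩

theorem im_nonneg_of_mem_closure {f : Set ℂ} {u d p : ℂ} {σ : ℝ}
    (h : ∀ p ∈ f, 0 < σ * ((p - u) / d).im) (hp : p ∈ closure f) :
    0 ≤ σ * ((p - u) / d).im := by
  have hc : IsClosed {p : ℂ | 0 ≤ σ * ((p - u) / d).im} :=
    isClosed_le continuous_const (by fun_prop)
  exact closure_minimal (fun p hp => (h p hp).le) hc hp

/-- The radial coordinate, from `u`, of the other vertices of a face at `u`. -/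
theorem re_div_center_ge {u s t c x : ℂ} {τ τ' : ℝ} (hT : 1 ≤ T) (hδ : 0 < δ) (hτ : 0 ≤ τ)
    (hτT : τ ≤ T) (hτ' : 0 ≤ τ') (hτT' : τ' ≤ T)
    (hcs : c - u = (s - u) * (1 + τ * Complex.I) / 2)
    (hct : c - u = (t - u) * (1 - τ' * Complex.I) / 2)
    (hu : dist u c = δ) (hx : dist x c = δ) (hxu : x ≠ u)
    (h1 : 0 ≤ ((x - u) / (s - u)).im) (h2 : ((x - u) / (t - u)).im ≤ 0) :
    2 / (1 + T ^ 2) ≤ ((x - u) / (c - u)).re := by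
  have hz : c - u ≠ 0 := by
    intro h0
    rw [dist_comm, dist_eq_norm, h0, norm_zero] at hu
    linarith
  have hs : s - u ≠ 0 := by
    intro h0; rw [h0] at hcs; simp at hcs; exact hz hcs
  have ht : t - u ≠ 0 := by
    intro h0; rw [h0] at hct; simp at hct; exact hz hct
  set w := (x - u) / (c - u) with hw
  have hxw : x - u = w * (c - u) := by rw [hw, div_mul_cancel₀ _ hz]
  have hw0 : w ≠ 0 := by
    intro h0; rw [h0, zero_mul] at hxw; exact hxu (sub_eq_zero.mp hxw)
  have e1 : (x - u) / (s - u) = w * (1 + τ * Complex.I) / 2 := by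
    rw [div_eq_iff hs, hxw, hcs]; ring
  have e2 : (x - u) / (t - u) = w * (1 - τ' * Complex.I) / 2 := by
    rw [div_eq_iff ht, hxw, hct]; ring
  have e1' : ((x - u) / (s - u)).im = (w.im + w.re * τ) / 2 := by
    rw [e1]; simp; ring
  have e2' : ((x - u) / (t - u)).im = (w.im - w.re * τ') / 2 := by
    rw [e2]; simp; ring
  rw [e1'] at h1
  rw [e2'] at h2
  have hcirc : ‖1 - w‖ ^ 2 * δ ^ 2 = δ ^ 2 := by
    have : ‖1 - w‖ * δ = δ := by
      conv_lhs => rw [← hu, dist_comm u c, dist_eq_norm]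
      rw [← norm_mul, ← hx, dist_comm, dist_eq_norm]
      congr 1; linear_combination hxw
    rw [← mul_pow, this]
  -- `w` lies on the unit circle around 1, so |w|² = 2 Re w. The two side conditions give |Im w| ≤ T
  -- Re w, and therefore 2 Re w ≤ (1 + T²)(Re w)².
  have hn : w.re ^ 2 + w.im ^ 2 = 2 * w.re := by
    have h3 : ‖1 - w‖ ^ 2 = 1 := by
      have : 0 < δ ^ 2 := by positivity
      have h5 : (‖1 - w‖ ^ 2 - 1) * δ ^ 2 = 0 := by linear_combination hcirc
      rcases mul_eq_zero.mp h5 with h | h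
      · linarith
      · exact absurd h this.ne'
    simp only [Complex.sq_norm, Complex.normSq_apply, Complex.sub_re, Complex.sub_im,
      Complex.one_re, Complex.one_im] at h3
    linarith
  have hre : 0 ≤ w.re := by nlinarith [sq_nonneg w.re, sq_nonneg w.im]
  have hre0 : 0 < w.re := by
    rcases hre.eq_or_lt with h | h
    · exfalso
      apply hw0
      have : w.im = 0 := by rw [← h] at hn; nlinarith
      exact Complex.ext h.symm this
    · exact h
  have him : w.im ^ 2 ≤ (w.re * T) ^ 2 := by
    apply sq_le_sq'
    · nlinarith
    · nlinarith
  rw [div_le_iff₀ (by positivity)]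
  have : w.re * 2 ≤ w.re * (w.re * (1 + T ^ 2)) := by nlinarith
  exact le_of_mul_le_mul_left this hre0

/-- Vertices are separated. -/
theorem le_dist_of_mem_verts (hT : Γ.CondBounded T) {u v : ℂ} (hu : u ∈ Γ.verts)
    (hv : v ∈ Γ.verts) (huv : u ≠ v) : 2 / (1 + T ^ 2) * δ ≤ dist u v := by
  have hδ := Γ.mesh_pos
  have hT1 := hT.one_le
  have hT2 : 0 < 1 + T ^ 2 := by positivity
  have he : v - u ≠ 0 := sub_ne_zero.mpr huv.symm
  rcases exists_sector_of_direction hT hu he with ⟨s, hs, a, ha, hes⟩ |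
    ⟨s, t, β, b, hn, φ, hφ, a, ha, hes⟩
  · have ha1 : 1 ≤ a := by
      by_contra hlt
      refine PlaneGraph.notMem_verts_of_mem_openSegment hs (q := v) ?_ hv
      rw [openSegment_eq_image']
      refine ⟨a, ⟨ha, not_le.mp hlt⟩, ?_⟩
      simp only [Complex.real_smul]
      linear_combination -hes
    have h1 : dist u s ≤ dist u v := by
      rw [dist_comm u s, dist_comm u v, dist_eq_norm, dist_eq_norm, hes, norm_mul,
        Complex.norm_real, Real.norm_eq_abs, abs_of_pos ha]
      exact le_mul_of_one_le_left (norm_nonneg _) ha1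
    refine le_trans ?_ h1
    have h2 := hT.le_dist_sq hs
    refine le_of_sq_le_sq ?_ dist_nonneg
    refine le_trans ?_ h2
    rw [mul_pow, div_pow]
    rw [div_mul_eq_mul_div, div_le_div_iff₀ (by positivity) (by positivity)]
    have : (1 + T ^ 2) ≤ (1 + T ^ 2) ^ 2 := by nlinarith [sq_nonneg T]
    nlinarith [sq_nonneg δ]
  · obtain ⟨f, hf, c, hcirc, huf, ⟨ε, hε, hgerm⟩, hcs, hct, him1, him2⟩ := hn.exists_face hT
    have huc := hcirc u ⟨hu, huf⟩
    have hz : c - u ≠ 0 := by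
      intro h0
      rw [dist_comm, dist_eq_norm, h0, norm_zero] at huc
      linarith
    have hvert : ∀ x ∈ Γ.verts, x ∈ frontier f → x ≠ u →
        2 / (1 + T ^ 2) ≤ ((x - u) / (c - u)).re := by
      intro x hx hxf hxu
      have hcl := frontier_subset_closure hxf
      refine re_div_center_ge hT1 hδ (hT.cond_pos hn.adj_left).le (hT.upper _ _ hn.adj_left)
        (hT.cond_pos hn.adj_right).le (hT.upper _ _ hn.adj_right) hcs hct huc
        (hcirc x ⟨hx, hxf⟩) hxu ?_ ?_
      · have := im_nonneg_of_mem_closure (σ := 1) (u := u) (d := s - u) (f := f) (p := x)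
          (fun p hp => by simpa using him1 p hp) hcl
        simpa using this
      · have := im_nonneg_of_mem_closure (σ := -1) (u := u) (d := t - u) (f := f) (p := x)
          (fun p hp => by simpa using him2 p hp) hcl
        simpa using this
    -- the segment from `u` to `v` leaves the face
    have hpre : IsPreconnected ((fun r : ℝ => u + r * (v - u)) '' Ioc 0 1) :=
      isPreconnected_Ioc.image _ (by fun_prop)
    have hmeet : (((fun r : ℝ => u + r * (v - u)) '' Ioc 0 1) ∩ f).Nonempty := by
      set r := min 1 (ε / a) / 2 with hr
      have hr0 : 0 < r := by positivity
      have hr1 : r < 1 := by have := min_le_left 1 (ε / a); linarith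
      have hr2 : r < ε / a := by
        have := min_le_right 1 (ε / a)
        have : 0 < min 1 (ε / a) := by positivity
        linarith
      refine ⟨u + r * (v - u), ⟨r, ⟨hr0, hr1.le⟩, rfl⟩, ?_⟩
      have := hgerm (r * a) ⟨by positivity, (lt_div_iff₀ ha).mp hr2⟩ φ hφ
      rw [hes]
      convert! this using 2
      push_cast; ring
    have hout : (((fun r : ℝ => u + r * (v - u)) '' Ioc 0 1) ∩ fᶜ).Nonempty :=
      ⟨v, ⟨1, ⟨one_pos, le_rfl⟩, by simp⟩, fun hvf => face_subset hf hvf (Or.inl hv)⟩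
    obtain ⟨_, ⟨r, hr, rfl⟩, hpf⟩ := exists_mem_frontier hpre (face_isOpen hT hf) hmeet hout
    simp only at hpf
    -- The exit point is a vertex of the face or lies on a boundary edge not issuing from `u`; in
    -- the second case the bound for the two endpoints passes to it by convexity. Since |c - u| = δ,
    -- this bounds the distance from below.
    have hre : 2 / (1 + T ^ 2) ≤ ((u + r * (v - u) - u) / (c - u)).re := by
      rcases PlaneGraph.mem_skeleton_iff.mp (frontier_face_subset hT hf hpf) with h | h
      · refine hvert _ h hpf ?_
        intro h0
        have : (r : ℂ) * (v - u) = 0 := by linear_combination h0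
        exact mul_ne_zero (by exact_mod_cast hr.1.ne') he this
      · obtain ⟨x, y, hxy, hp⟩ := h
        obtain ⟨hxf, hyf⟩ := endpoints_mem_frontier hT hf hxy hp (frontier_subset_closure hpf)
        have hnot : ∀ w, Γ.graph.Adj u w → u + (r : ℂ) * (v - u) ∉ openSegment ℝ u w := by
          intro w hw hmem
          rw [openSegment_eq_image'] at hmem
          obtain ⟨b', hb', h⟩ := hmem
          have hb0 : (b' : ℂ) ≠ 0 := by exact_mod_cast hb'.1.ne'
          refine hn.minimal w hw φ hφ (r * a / b') (by have := hr.1; have := hb'.1; positivity) ?_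
          simp only [Complex.real_smul, hes] at h
          push_cast
          field_simp
          linear_combination h
        have hxu : x ≠ u := by rintro rfl; exact hnot y hxy hp
        have hyu : y ≠ u := by
          rintro rfl; rw [openSegment_symm] at hp; exact hnot x hxy.symm hp
        have hx := hvert x (PlaneGraph.mem_verts_left hxy) hxf hxu
        have hy := hvert y (PlaneGraph.mem_verts_right hxy) hyf hyu
        obtain ⟨α, β', hα, hβ', hab, h⟩ := hp
        have hab' : (α : ℂ) + β' = 1 := by exact_mod_cast hab
        have : (u + r * (v - u) - u) / (c - u) =
            α * ((x - u) / (c - u)) + β' * ((y - u) / (c - u)) := by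
          rw [← h]
          simp only [Complex.real_smul]
          field_simp
          linear_combination u * hab'
        rw [this, Complex.add_re, Complex.re_ofReal_mul, Complex.re_ofReal_mul]
        calc 2 / (1 + T ^ 2) = α * (2 / (1 + T ^ 2)) + β' * (2 / (1 + T ^ 2)) := by
              rw [← add_mul, hab, one_mul]
          _ ≤ _ := add_le_add (mul_le_mul_of_nonneg_left hx hα.le)
              (mul_le_mul_of_nonneg_left hy hβ'.le)
    have hle := hre.trans (Complex.re_le_norm _)
    rw [norm_div, le_div_iff₀ (norm_pos_iff.mpr hz), ← dist_eq_norm c u, dist_comm c u, huc,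
      add_sub_cancel_left, norm_mul, Complex.norm_real, Real.norm_eq_abs, abs_of_pos hr.1] at hle
    refine hle.trans ?_
    rw [dist_comm, dist_eq_norm]
    exact mul_le_of_le_one_left (norm_nonneg _) hr.2

end IsoradialGraph

/-! ### Power functions on the graph have no local maximum. -/

/-- Second-order Taylor expansion of (1 + ε)^α, with an error controlled by the product |α||ε|
alone: the exponent will be of order ρ/δ and only this product stays small. -/
theorem norm_exp_mul_log_sub_le {α ε : ℂ} (hα : 1 ≤ ‖α‖) (hε : ‖ε‖ ≤ 1 / 2)
    (hk : ‖α‖ * ‖ε‖ ≤ 1 / 4) :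
    ‖Complex.exp (α * Complex.log (1 + ε)) - 1 - α * ε - (α ^ 2 - α) / 2 * ε ^ 2‖
      ≤ 12 * (‖α‖ * ‖ε‖) ^ 3 := by
  have hε0 := norm_nonneg ε
  set x := ‖ε‖ with hx
  set A := ‖α‖ with hA
  have hA0 : 0 ≤ A := by linarith
  set r := Complex.log (1 + ε) - ε + ε ^ 2 / 2 with hr
  have hinv : (1 - x)⁻¹ ≤ 2 := by
    rw [inv_le_comm₀ (by linarith) (by norm_num)]; linarith
  have hrn : ‖r‖ ≤ x ^ 3 := by
    have h := Complex.norm_log_sub_logTaylor_le 2 (z := ε) (by rw [← hx]; linarith)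
    have h2 : Complex.log (1 + ε) - Complex.logTaylor (2 + 1) ε = r := by
      simp [Complex.logTaylor, Finset.sum_range_succ, hr]; ring
    rw [h2] at h
    refine h.trans ?_
    norm_num
    have : x ^ 3 * (1 - x)⁻¹ ≤ x ^ 3 * 2 := by gcongr
    nlinarith [pow_nonneg hε0 3]
  set d := Complex.log (1 + ε) - ε with hd
  have hdr : d = r - ε ^ 2 / 2 := by rw [hr, hd]; ring
  have hdn : ‖d‖ ≤ x ^ 2 := by
    rw [hdr]
    refine (norm_sub_le _ _).trans ?_
    have : ‖ε ^ 2 / 2‖ = x ^ 2 / 2 := by simp [hx]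
    rw [this]
    have : x ^ 3 ≤ x ^ 2 * (1 / 2) := by
      rw [pow_succ]; gcongr
    linarith
  set y := α * Complex.log (1 + ε) with hy
  have hyd : y = α * (ε + d) := by rw [hy, hd]; ring
  have hyn : ‖y‖ ≤ 2 * (A * x) := by
    rw [hyd, norm_mul]
    have : ‖ε + d‖ ≤ 2 * x := by
      refine (norm_add_le _ _).trans ?_
      nlinarith
    calc A * ‖ε + d‖ ≤ A * (2 * x) := by gcongr
      _ = _ := by ring
  have hexp : ‖Complex.exp y - 1 - y - y ^ 2 / 2‖ ≤ 8 * (A * x) ^ 3 := by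
    have h := Complex.exp_bound (x := y) (by linarith) (n := 3) (by norm_num)
    have h2 : Complex.exp y - ∑ m ∈ Finset.range 3, y ^ m / (m.factorial : ℂ)
        = Complex.exp y - 1 - y - y ^ 2 / 2 := by
      simp [Finset.sum_range_succ]; ring
    rw [h2] at h
    refine h.trans ?_
    have h3 : ‖y‖ ^ 3 ≤ (2 * (A * x)) ^ 3 := by gcongr
    have h4 : ((Nat.succ 3 : ℕ) : ℝ) * (((Nat.factorial 3 : ℕ) : ℝ) * ((3 : ℕ) : ℝ))⁻¹ ≤ 1 := by
      norm_num [Nat.factorial]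
    calc _ ≤ ‖y‖ ^ 3 * 1 := by gcongr
      _ ≤ _ := by linarith [h3]
  have hdecomp : Complex.exp y - 1 - α * ε - (α ^ 2 - α) / 2 * ε ^ 2 =
      (Complex.exp y - 1 - y - y ^ 2 / 2) + α * r + α ^ 2 * ε * d + α ^ 2 / 2 * d ^ 2 := by
    rw [hyd]
    have : r = d + ε ^ 2 / 2 := by rw [hdr]; ring
    rw [this]; ring
  rw [hdecomp]
  have t1 : ‖α * r‖ ≤ (A * x) ^ 3 := by
    rw [norm_mul]
    calc A * ‖r‖ ≤ A * x ^ 3 := by gcongr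
      _ ≤ A ^ 3 * x ^ 3 := by
        gcongr
        exact le_self_pow₀ hα (by norm_num)
      _ = _ := by ring
  have t2 : ‖α ^ 2 * ε * d‖ ≤ (A * x) ^ 3 := by
    rw [norm_mul, norm_mul, norm_pow]
    calc A ^ 2 * x * ‖d‖ ≤ A ^ 2 * x * x ^ 2 := by gcongr
      _ = A ^ 2 * x ^ 3 := by ring
      _ ≤ A ^ 3 * x ^ 3 := by
        gcongr
        norm_num
      _ = _ := by ring
  have t3 : ‖α ^ 2 / 2 * d ^ 2‖ ≤ (A * x) ^ 3 := by
    have : ‖α ^ 2 / 2 * d ^ 2‖ = A ^ 2 / 2 * ‖d‖ ^ 2 := by simp [hA]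
    rw [this]
    calc A ^ 2 / 2 * ‖d‖ ^ 2 ≤ A ^ 2 / 2 * (x ^ 2) ^ 2 := by gcongr
      _ = A ^ 2 * x ^ 3 * (x / 2) := by ring
      _ ≤ A ^ 2 * x ^ 3 * 1 := by gcongr; linarith
      _ = A ^ 2 * x ^ 3 := by ring
      _ ≤ A ^ 3 * x ^ 3 := by
        gcongr
        norm_num
      _ = _ := by ring
  have := norm_add_le (Complex.exp y - 1 - y - y ^ 2 / 2 + α * r + α ^ 2 * ε * d) (α ^ 2 / 2 * d ^ 2)
  have := norm_add_le (Complex.exp y - 1 - y - y ^ 2 / 2 + α * r) (α ^ 2 * ε * d)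
  have := norm_add_le (Complex.exp y - 1 - y - y ^ 2 / 2) (α * r)
  have : 0 ≤ (A * x) ^ 3 := by positivity
  linarith

/-- The real part of an approximately harmonic power function has no local maximum. -/
theorem exists_re_lt_of_sum_eq_zero {ι : Type*} {N : Finset ι} {c : ι → ℝ} {ε : ι → ℂ}
    (hc : ∀ s ∈ N, 0 < c s) (hN : N.Nonempty) (h1 : ∑ s ∈ N, (c s : ℂ) * ε s = 0)
    (h2 : ∑ s ∈ N, (c s : ℂ) * ε s ^ 2 = 0) {α P : ℂ} (hα : 1 ≤ ‖α‖) (hP : P ≠ 0) {k₁ k₂ : ℝ}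
    (hk₁ : 0 ≤ k₁) (hk₂ : k₂ ≤ 1 / 100) (hk : 112 * k₂ ^ 4 < k₁ ^ 2)
    (hlo : ∀ s ∈ N, k₁ ≤ ‖α‖ * ‖ε s‖) (hhi : ∀ s ∈ N, ‖α‖ * ‖ε s‖ ≤ k₂) :
    ∃ s ∈ N, P.re < (P * Complex.exp (α * Complex.log (1 + ε s))).re := by
  by_contra hcon
  push Not at hcon
  set D : ι → ℂ := fun s => Complex.exp (α * Complex.log (1 + ε s)) with hD
  set R : ι → ℂ := fun s => D s - 1 - α * ε s - (α ^ 2 - α) / 2 * ε s ^ 2 with hR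
  set x : ι → ℝ := fun s => P.re - (P * D s).re with hx
  set p := ‖P‖ with hp
  have hp0 : 0 < p := norm_pos_iff.mpr hP
  have hk20 : 0 ≤ k₂ := by
    obtain ⟨s, hs⟩ := hN
    exact (by positivity : 0 ≤ ‖α‖ * ‖ε s‖).trans (hhi s hs)
  have hx0 : ∀ s ∈ N, 0 ≤ x s := fun s hs => sub_nonneg.mpr (hcon s hs)
  have hRn : ∀ s ∈ N, ‖R s‖ ≤ 12 * k₂ ^ 3 := fun s hs => by
    have hks := hhi s hs
    refine (norm_exp_mul_log_sub_le hα ?_ (by linarith)).trans (by gcongr)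
    have : ‖ε s‖ ≤ ‖α‖ * ‖ε s‖ := le_mul_of_one_le_left (norm_nonneg _) hα
    linarith
  set R' : ι → ℂ := fun s => (α ^ 2 - α) / 2 * ε s ^ 2 + R s with hR'
  have hR'n : ∀ s ∈ N, ‖R' s‖ ≤ 2 * k₂ ^ 2 := fun s hs => by
    refine (norm_add_le _ _).trans ?_
    have e1 : ‖(α ^ 2 - α) / 2 * ε s ^ 2‖ ≤ k₂ ^ 2 := by
      rw [norm_mul, norm_div, norm_pow]
      have : ‖α ^ 2 - α‖ ≤ 2 * ‖α‖ ^ 2 := by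
        refine (norm_sub_le _ _).trans ?_
        rw [norm_pow]
        nlinarith
      calc ‖α ^ 2 - α‖ / ‖(2 : ℂ)‖ * ‖ε s‖ ^ 2 ≤ 2 * ‖α‖ ^ 2 / ‖(2 : ℂ)‖ * ‖ε s‖ ^ 2 := by gcongr
        _ = (‖α‖ * ‖ε s‖) ^ 2 := by norm_num; ring
        _ ≤ k₂ ^ 2 := by gcongr; exact hhi s hs
    have e2 := hRn s hs
    have : 12 * k₂ ^ 3 ≤ k₂ ^ 2 := by nlinarith [sq_nonneg k₂]
    linarith
  have hxR : ∀ s, x s = -(P * (α * ε s)).re - (P * R' s).re := fun s => by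
    have : P * D s = P + P * (α * ε s) + P * R' s := by
      simp only [hR', hR]; ring
    simp only [hx, this, Complex.add_re]; ring
  -- The terms of first and second order cancel by harmonicity, so the weighted sum of the
  -- nonnegative `x s` is of third order in `k₂`.
  have hsum1 : ∑ s ∈ N, c s * x s ≤ p * (12 * k₂ ^ 3) * ∑ s ∈ N, c s := by
    have e : ∑ s ∈ N, c s * x s = -(P * ∑ s ∈ N, (c s : ℂ) * R s).re := by
      have e3 : ∑ s ∈ N, ((c s : ℂ) * (P - P * D s)) = -(P * ∑ s ∈ N, (c s : ℂ) * R s) := by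
        have : ∀ s ∈ N, (c s : ℂ) * (P - P * D s) = -(P * α) * ((c s : ℂ) * ε s) -
            P * ((α ^ 2 - α) / 2) * ((c s : ℂ) * ε s ^ 2) - P * ((c s : ℂ) * R s) := fun s _ => by
          simp only [hR]; ring
        rw [Finset.sum_congr rfl this, Finset.sum_sub_distrib, Finset.sum_sub_distrib,
          ← Finset.mul_sum, ← Finset.mul_sum, ← Finset.mul_sum, h1, h2]
        ring
      rw [← Complex.neg_re, ← e3, Complex.re_sum]
      refine Finset.sum_congr rfl fun s _ => ?_
      rw [Complex.re_ofReal_mul, Complex.sub_re]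
    rw [e]
    refine (neg_le_abs _).trans ((Complex.abs_re_le_norm _).trans ?_)
    rw [norm_mul, mul_assoc]
    gcongr
    refine (norm_sum_le _ _).trans ?_
    rw [Finset.mul_sum]
    refine Finset.sum_le_sum fun s hs => ?_
    rw [norm_mul, Complex.norm_real, Real.norm_eq_abs, abs_of_pos (hc s hs), mul_comm]
    gcongr
    · exact (hc s hs).le
    · exact hRn s hs
  have hxle : ∀ s ∈ N, x s ≤ 2 * k₂ * p := fun s hs => by
    rw [hxR]
    have e1 := Complex.abs_re_le_norm (P * (α * ε s))
    have e2 := Complex.abs_re_le_norm (P * R' s)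
    rw [norm_mul, norm_mul] at e1
    rw [norm_mul] at e2
    have e3 : p * (‖α‖ * ‖ε s‖) ≤ p * k₂ := by gcongr; exact hhi s hs
    have e4 : p * ‖R' s‖ ≤ p * (2 * k₂ ^ 2) := by gcongr; exact hR'n s hs
    have e5 : p * (2 * k₂ ^ 2) ≤ p * k₂ := by gcongr; nlinarith
    linarith [neg_abs_le (P * (α * ε s)).re, neg_abs_le (P * R' s).re]
  -- Each `x s` is of first order and their sum of third order, so the sum of their squares is of
  -- fourth order. The squares of the remainders `R'` are of fourth order too.
  have hsq : ∑ s ∈ N, c s * (P * (α * ε s)).re ^ 2 ≤ 56 * k₂ ^ 4 * p ^ 2 * ∑ s ∈ N, c s := by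
    have : ∀ s ∈ N, c s * (P * (α * ε s)).re ^ 2 ≤
        2 * (2 * k₂ * p) * (c s * x s) + 8 * k₂ ^ 4 * p ^ 2 * c s := fun s hs => by
      have e1 : (P * (α * ε s)).re ^ 2 ≤ 2 * x s ^ 2 + 2 * (P * R' s).re ^ 2 := by
        have : (P * (α * ε s)).re = -x s - (P * R' s).re := by linarith [hxR s]
        rw [this]
        nlinarith [sq_nonneg (x s - (P * R' s).re)]
      have e2 : (P * R' s).re ^ 2 ≤ (p * (2 * k₂ ^ 2)) ^ 2 := by
        rw [← sq_abs]
        gcongr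
        refine (Complex.abs_re_le_norm _).trans ?_
        rw [norm_mul]
        gcongr; exact hR'n s hs
      have e3 : x s ^ 2 ≤ 2 * k₂ * p * x s := by
        rw [sq]
        exact mul_le_mul_of_nonneg_right (hxle s hs) (hx0 s hs)
      have e4 : (P * (α * ε s)).re ^ 2 ≤ 2 * (2 * k₂ * p) * x s + 8 * k₂ ^ 4 * p ^ 2 := by
        nlinarith
      calc _ ≤ c s * (2 * (2 * k₂ * p) * x s + 8 * k₂ ^ 4 * p ^ 2) := by
            gcongr; exact (hc s hs).le
        _ = _ := by ring
    refine (Finset.sum_le_sum this).trans ?_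
    rw [Finset.sum_add_distrib, ← Finset.mul_sum, ← Finset.mul_sum]
    have : 2 * (2 * k₂ * p) * ∑ s ∈ N, c s * x s ≤
        2 * (2 * k₂ * p) * (p * (12 * k₂ ^ 3) * ∑ s ∈ N, c s) := by gcongr
    linarith
  -- As the squares (Pαε)² have weighted sum zero, their squared real parts carry half of the
  -- squared moduli. This second-order quantity exceeds the fourth-order bound once `112 * k₂ ^ 4 <
  -- k₁ ^ 2`.
  have hsq2 : ∑ s ∈ N, c s * (P * (α * ε s)).re ^ 2 =
      ∑ s ∈ N, c s * (p * (‖α‖ * ‖ε s‖)) ^ 2 / 2 := by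
    have hid : ∀ z : ℂ, z.re ^ 2 = ‖z‖ ^ 2 / 2 + (z ^ 2).re / 2 := fun z => by
      rw [Complex.sq_norm, Complex.normSq_apply, sq z, Complex.mul_re]; ring
    have e : ∑ s ∈ N, c s * ((P * (α * ε s)) ^ 2).re = 0 := by
      have e1 : ∑ s ∈ N, (c s : ℂ) * (P * (α * ε s)) ^ 2 = 0 := by
        have : ∀ s ∈ N, (c s : ℂ) * (P * (α * ε s)) ^ 2 = (P * α) ^ 2 * ((c s : ℂ) * ε s ^ 2) :=
          fun s _ => by ring
        rw [Finset.sum_congr rfl this, ← Finset.mul_sum, h2, mul_zero]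
      have := congrArg Complex.re e1
      rw [Complex.re_sum] at this
      simpa [Complex.re_ofReal_mul] using this
    have : ∀ s ∈ N, c s * (P * (α * ε s)).re ^ 2 =
        c s * (p * (‖α‖ * ‖ε s‖)) ^ 2 / 2 + (1 / 2) * (c s * ((P * (α * ε s)) ^ 2).re) :=
      fun s _ => by
        rw [hid, norm_mul, norm_mul]; ring
    rw [Finset.sum_congr rfl this, Finset.sum_add_distrib, ← Finset.mul_sum, e, mul_zero, add_zero]
  have hlow : (p * k₁) ^ 2 / 2 * ∑ s ∈ N, c s ≤ ∑ s ∈ N, c s * (p * (‖α‖ * ‖ε s‖)) ^ 2 / 2 := by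
    rw [Finset.mul_sum]
    refine Finset.sum_le_sum fun s hs => ?_
    have e1 : (p * k₁) ^ 2 ≤ (p * (‖α‖ * ‖ε s‖)) ^ 2 := by gcongr; exact hlo s hs
    have := hc s hs
    nlinarith
  have hC : 0 < ∑ s ∈ N, c s := Finset.sum_pos hc hN
  have hfin : (p * k₁) ^ 2 / 2 * ∑ s ∈ N, c s ≤ 56 * k₂ ^ 4 * p ^ 2 * ∑ s ∈ N, c s := by
    rw [hsq2] at hsq; exact hlow.trans hsq
  have := le_of_mul_le_mul_right hfin hC
  have hp2 : 0 < p ^ 2 := by positivity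
  nlinarith

/-! ### Branches of the logarithm on a simply connected discrete domain. -/

namespace DiscreteDomain

variable {δ : ℝ} {Γ : IsoradialGraph δ} {T : ℝ} {Ω : DiscreteDomain Γ}

theorem verts_subset_region : Ω.verts ⊆ Ω.region := fun _ h => Or.inr h

/-- All edges at an interior vertex belong to the domain. -/
theorem openSegment_mem_edges {v w : ℂ} (hv : v ∈ Ω.verts) (h : Γ.graph.Adj v w) :
    openSegment ℝ v w ∈ Ω.edges := by
  have hd : 0 < ‖w - v‖ := norm_pos_iff.mpr (sub_ne_zero.mpr h.ne')
  obtain ⟨ε, hε, hball⟩ := Metric.isOpen_iff.mp Ω.isOpen_union v (verts_subset_region hv)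
  set r := min (1 / 2) (ε / ‖w - v‖ / 2) with hr
  have hr0 : 0 < r := by positivity
  have hr1 : r < 1 := lt_of_le_of_lt (min_le_left _ _) (by norm_num)
  have hr2 : r < ε / ‖w - v‖ :=
    lt_of_le_of_lt (min_le_right _ _) (half_lt_self (by positivity))
  have hq : v + r • (w - v) ∈ openSegment ℝ v w := by
    rw [openSegment_eq_image']; exact ⟨r, ⟨hr0, hr1⟩, rfl⟩
  have hqb : v + r • (w - v) ∈ Metric.ball v ε := by
    rw [Metric.mem_ball, dist_eq_norm, add_sub_cancel_left, norm_smul, Real.norm_eq_abs,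
      abs_of_pos hr0]
    exact (lt_div_iff₀ hd).mp hr2
  rcases hball hqb with (⟨f, hf, hqf⟩ | ⟨e, he, hqe⟩) | hqv
  · exact absurd (PlaneGraph.openSegment_subset_skeleton h hq)
      (IsoradialGraph.face_subset (Ω.faces_subset hf) hqf)
  · obtain ⟨x, y, hxy, rfl⟩ := Ω.edges_subset he
    rwa [PlaneGraph.openSegment_eq_of_sym2_eq (PlaneGraph.edge_eq_of_mem h hxy hq hqe)]
  · exact absurd (Ω.verts_subset hqv) (PlaneGraph.notMem_verts_of_mem_openSegment h hq)

theorem openSegment_subset_region {v w : ℂ} (hv : v ∈ Ω.verts) (h : Γ.graph.Adj v w) :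
    openSegment ℝ v w ⊆ Ω.region := fun _ hq =>
  Or.inl (Or.inr ⟨_, openSegment_mem_edges hv h, hq⟩)

theorem notMem_region {a : ℂ} (ha : a ∈ Γ.verts) (haΩ : a ∉ Ω.verts) : a ∉ Ω.region := by
  rintro ((⟨f, hf, haf⟩ | ⟨e, he, hae⟩) | h)
  · exact IsoradialGraph.face_subset (Ω.faces_subset hf) haf (Or.inl ha)
  · obtain ⟨x, y, hxy, rfl⟩ := Ω.edges_subset he
    exact PlaneGraph.notMem_verts_of_mem_openSegment hxy hae ha
  · exact haΩ h

theorem exists_log (hsc : IsSimplyConnected Ω.region) {a : ℂ} (ha : a ∉ Ω.region) :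
    ∃ L : ℂ → ℂ, ContinuousOn L Ω.region ∧ ∀ z ∈ Ω.region, Complex.exp (L z) = z - a := by
  obtain ⟨L, hL, hexp⟩ := Complex.exists_continuousOn_eqOn_exp_comp hsc Ω.isOpen_union
    (g := fun z => z - a) (by fun_prop) (by
      rintro ⟨z, hz, h⟩
      exact ha (by rwa [← sub_eq_zero.mp h]))
  exact ⟨L, hL, fun z hz => hexp hz⟩

end DiscreteDomain

/-- A continuous logarithm of the constant function `1` on an interval is constant. -/
theorem eq_of_exp_eq_one {h : ℝ → ℂ} (hc : ContinuousOn h (Icc 0 1))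
    (he : ∀ t ∈ Icc (0 : ℝ) 1, Complex.exp (h t) = 1) (h0 : h 0 = 0) : h 1 = 0 := by
  obtain ⟨n, hn⟩ := Complex.exp_eq_one_iff.mp (he 1 ⟨zero_le_one, le_rfl⟩)
  suffices hn0 : n = 0 by rw [hn, hn0]; simp
  by_contra hne
  set g : ℝ → ℝ := fun t => (h t).im / (2 * Real.pi * n) with hg
  have hpi := Real.pi_pos
  have hn' : (n : ℝ) ≠ 0 := by exact_mod_cast hne
  have hgc : ContinuousOn g (Icc 0 1) := by
    have : ContinuousOn (fun t => (h t).im) (Icc 0 1) :=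
      Complex.continuous_im.comp_continuousOn hc
    exact this.div_const _
  have hg0 : g 0 = 0 := by simp [hg, h0]
  have hg1 : g 1 = 1 := by
    have : (h 1).im = 2 * Real.pi * n := by rw [hn]; simp; ring
    simp only [hg, this]
    field_simp
  -- At this value the imaginary part of `h` would be ±π, where the exponential is not 1.
  have hmem : 1 / (2 * (|(n : ℝ)|)) ∈ Icc (g 0) (g 1) := by
    rw [hg0, hg1]
    have h1 : (1 : ℝ) ≤ |(n : ℝ)| := by exact_mod_cast Int.one_le_abs hne
    refine ⟨by positivity, ?_⟩
    rw [div_le_one (by positivity)]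
    linarith
  obtain ⟨t, ht, hgt⟩ := intermediate_value_Icc zero_le_one hgc hmem
  obtain ⟨m, hm⟩ := Complex.exp_eq_one_iff.mp (he t ht)
  have him : (h t).im = 2 * Real.pi * m := by rw [hm]; simp; ring
  simp only [hg, him] at hgt
  have hm2 : 2 * (m : ℝ) * |(n : ℝ)| = n := by
    have : 0 < |(n : ℝ)| := abs_pos.mpr hn'
    field_simp at hgt
    linarith
  have hm3 : 2 * m * |n| = n := by exact_mod_cast hm2
  rcases abs_choice n with h | h
  · rw [h] at hm3
    have : (2 * m - 1) * n = 0 := by linarith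
    rcases mul_eq_zero.mp this with h | h
    · omega
    · exact hne h
  · rw [h] at hm3
    have : (2 * m + 1) * n = 0 := by linarith
    rcases mul_eq_zero.mp this with h | h
    · omega
    · exact hne h

namespace DiscreteDomain

variable {δ : ℝ} {Γ : IsoradialGraph δ} {T : ℝ} {Ω : DiscreteDomain Γ}

/-- Along the segment from `v` to `w` both sides are logarithms of the same function and they agree
at `v`. The bound on the quotient keeps the principal logarithm continuous there. -/
theorem log_increment {a : ℂ} {L : ℂ → ℂ} (hL : ContinuousOn L Ω.region)
    (hexp : ∀ z ∈ Ω.region, Complex.exp (L z) = z - a) {v w : ℂ} (hv : v ∈ Ω.verts)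
    (hw : w ∈ Ω.verts) (h : Γ.graph.Adj v w) (hva : v ≠ a) (hlt : ‖(w - v) / (v - a)‖ < 1) :
    L w = L v + Complex.log (1 + (w - v) / (v - a)) := by
  set ε := (w - v) / (v - a) with hε
  have hva' : v - a ≠ 0 := sub_ne_zero.mpr hva
  have hseg : ∀ t ∈ Icc (0 : ℝ) 1, v + t * (w - v) ∈ Ω.region := by
    intro t ht
    have hmem : v + t * (w - v) ∈ segment ℝ v w := by
      rw [segment_eq_image']; exact ⟨t, ht, by simp⟩
    by_cases h1 : v + t * (w - v) = v
    · rw [h1]; exact verts_subset_region hv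
    by_cases h2 : v + t * (w - v) = w
    · rw [h2]; exact verts_subset_region hw
    exact openSegment_subset_region hv h (PlaneGraph.mem_openSegment_of_mem_segment hmem h1 h2)
  have hslit : ∀ t ∈ Icc (0 : ℝ) 1, 1 + t * ε ∈ Complex.slitPlane := by
    intro t ht
    refine Complex.mem_slitPlane_of_norm_lt_one ?_
    rw [norm_mul, Complex.norm_real, Real.norm_eq_abs, abs_of_nonneg ht.1]
    nlinarith [ht.2, norm_nonneg ε]
  have key := eq_of_exp_eq_one
    (h := fun t => L (v + t * (w - v)) - L v - Complex.log (1 + t * ε)) ?_ ?_ ?_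
  · simp only [Complex.ofReal_one, one_mul, add_sub_cancel] at key
    linear_combination key
  · refine ContinuousOn.sub (ContinuousOn.sub ?_ continuousOn_const) ?_
    · exact hL.comp (by fun_prop) fun t ht => hseg t ht
    · exact ContinuousOn.clog (by fun_prop) hslit
  · intro t ht
    have h0 : 1 + t * ε ≠ 0 := Complex.slitPlane_ne_zero (hslit t ht)
    rw [Complex.exp_sub, Complex.exp_sub, hexp _ (hseg t ht), hexp _ (verts_subset_region hv),
      Complex.exp_log h0, div_div, div_eq_one_iff_eq (mul_ne_zero hva' h0), hε]
    field_simp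
    ring
  · simp

end DiscreteDomain

/-! ### Reaching the complement of the domain inside a thin annulus. -/

namespace IsoradialGraph

variable {δ : ℝ}

/-- The subgraph of `Γ` induced by the points of `Z`. -/
def induce (Γ : IsoradialGraph δ) (Z : Set ℂ) : SimpleGraph ℂ where
  Adj x y := Γ.graph.Adj x y ∧ x ∈ Z ∧ y ∈ Z
  symm := ⟨fun _ _ h => ⟨h.1.symm, h.2.2, h.2.1⟩⟩
  loopless := ⟨fun _ h => h.1.ne rfl⟩

theorem mem_of_reachable_induce {Γ : IsoradialGraph δ} {Z : Set ℂ} {v w : ℂ} (hv : v ∈ Z)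
    (h : (Γ.induce Z).Reachable v w) : w ∈ Z := by
  rw [SimpleGraph.reachable_iff_reflTransGen] at h
  induction h with
  | refl => exact hv
  | tail _ h _ => exact h.2.2

end IsoradialGraph

/-- A small constant depending on the conductance bound. -/
def stripConst (T : ℝ) : ℝ := 1 / (200 * (1 + T ^ 2))

theorem stripConst_pos (T : ℝ) : 0 < stripConst T := by unfold stripConst; positivity

theorem stripConst_le {T : ℝ} (hT : 1 ≤ T) : stripConst T ≤ 1 / 400 := by
  unfold stripConst
  apply one_div_le_one_div_of_le (by norm_num)
  nlinarith

namespace DiscreteDomain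

variable {δ : ℝ} {Γ : IsoradialGraph δ} {T : ℝ} {Ω : DiscreteDomain Γ}

/-- In a simply connected domain, every interior vertex is connected to the complement of the
domain in a thin annulus around any exterior point. -/
theorem exists_reachable_notMem (hT : Γ.CondBounded T) (hsc : IsSimplyConnected Ω.region) {a : ℂ}
    (ha : a ∉ Ω.region) {v : ℂ}
    (hρ : 8 * δ / stripConst T ≤ dist v a) :
    ∃ b ∉ Ω.verts, (Γ.induce {z | |dist z a - dist v a| ≤ 4 * δ / stripConst T}).Reachable v b := by
  have hδ := Γ.mesh_pos
  have hκ := stripConst_pos T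
  have hT1 := hT.one_le
  have hκ' := stripConst_le hT1
  set κ := stripConst T with hκdef
  set ρ := dist v a with hρdef
  have hρ' : 8 * δ ≤ ρ * κ := (div_le_iff₀ hκ).mp hρ
  have hρ0 : 0 < ρ := lt_of_lt_of_le (by positivity) hρ
  -- In the coordinate log(z - a) an edge near radius ρ has length of order δ/ρ, so after
  -- multiplication by μ of order κ. The strip of half-width π/(2μ) corresponds to an annulus of
  -- width of order δ.
  set μ := κ * ρ / δ with hμ
  have hμ4 : 8 ≤ μ := by rw [hμ, le_div_iff₀ hδ]; linarith
  have hμ0 : 0 < μ := by linarith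
  have hpi3 := Real.pi_gt_three
  have hpi4 := Real.pi_le_four
  -- the strip in logarithmic coordinates
  set S : Set ℂ := {z | 0 < dist z a ∧ μ * |Real.log (dist z a) - Real.log ρ| < Real.pi / 2} with hS
  have hSb : ∀ z ∈ S, |dist z a - ρ| ≤ 4 * δ / κ ∧ ρ / 2 ≤ dist z a ∧ dist z a ≤ 2 * ρ := by
    rintro z ⟨hz0, hz⟩
    set x := Real.log (dist z a) - Real.log ρ with hx
    have hzx : dist z a = ρ * Real.exp x := by
      rw [hx, Real.exp_sub, Real.exp_log hz0, Real.exp_log hρ0]; field_simp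
    have hx2 : μ * |x| < 2 := by linarith
    have hx1 : |x| ≤ 2 / μ := by rw [le_div_iff₀ hμ0]; linarith
    have hx3 : 2 / μ ≤ 1 / 4 := by rw [div_le_div_iff₀ hμ0 (by norm_num)]; linarith
    have hE : |Real.exp x - 1| ≤ 2 * |x| := Real.abs_exp_sub_one_le (by linarith)
    have hE2 : |dist z a - ρ| ≤ ρ * (2 * |x|) := by
      have : dist z a - ρ = ρ * (Real.exp x - 1) := by rw [hzx]; ring
      rw [this, abs_mul, abs_of_pos hρ0]
      gcongr
    have hE3 : ρ * (2 * |x|) ≤ 4 * δ / κ := by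
      calc ρ * (2 * |x|) ≤ ρ * (2 * (2 / μ)) := by gcongr
        _ = 4 * δ / κ := by rw [hμ]; field_simp; norm_num
    have hE4 : ρ * (2 * |x|) ≤ ρ * (1 / 2) := by gcongr; linarith
    have hE5 := abs_le.mp (hE2.trans hE4)
    exact ⟨hE2.trans hE3, by linarith [hE5.1], by linarith [hE5.2]⟩
  have hvS : v ∈ S := ⟨hρ0, by simp [← hρdef]; positivity⟩
  by_contra hcon
  push Not at hcon
  -- Assuming that the component `W` of `v` in the strip stays in the domain, a branch of the
  -- logarithm makes Re P = exp(μ arg) cos(μ log(|z - a|/ρ)) well defined and positive on `W`. Its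
  -- maximum over this finite set is then examined.
  obtain ⟨L, hL, hexp⟩ := exists_log hsc ha
  set W : Set ℂ := {w | (Γ.induce S).Reachable v w} with hW
  have hWS : W ⊆ S := fun w hw => IsoradialGraph.mem_of_reachable_induce hvS hw
  have hWV : W ⊆ Ω.verts := by
    intro w hw
    by_contra hwV
    refine hcon w hwV (SimpleGraph.Reachable.mono ?_ hw)
    intro x y hxy
    exact ⟨hxy.1, (hSb x hxy.2.1).1, (hSb y hxy.2.2).1⟩
  have hWfin : W.Finite := (Γ.locallyFinite a (3 * ρ)).subset fun w hw =>
    ⟨Ω.verts_subset (hWV hw), by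
      rw [Metric.mem_ball]; linarith [(hSb w (hWS hw)).2.2]⟩
  set α : ℂ := -(μ * Complex.I) with hα
  have hαn : ‖α‖ = μ := by simp [hα, abs_of_pos hμ0]
  set P : ℂ → ℂ := fun z => Complex.exp (α * (L z - Real.log ρ)) with hP
  have hre : ∀ ζ : ℂ, (Complex.exp (α * ζ)).re = Real.exp (μ * ζ.im) * Real.cos (μ * ζ.re) := by
    intro ζ
    rw [Complex.exp_re]
    have e1 : (α * ζ).re = μ * ζ.im := by simp [hα]
    have e2 : (α * ζ).im = -(μ * ζ.re) := by simp [hα]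
    rw [e1, e2, Real.cos_neg]
  obtain ⟨w, hwW, hmax⟩ := Set.exists_max_image W (fun z => (P z).re) hWfin
    ⟨v, SimpleGraph.Reachable.refl v⟩
  have hwS := hWS hwW
  have hwV := hWV hwW
  obtain ⟨-, hwlo, hwhi⟩ := hSb w hwS
  have hwa : w - a ≠ 0 := by
    rw [← norm_pos_iff, ← dist_eq_norm]; exact hwS.1
  have hwan : ‖w - a‖ = dist w a := (dist_eq_norm w a).symm
  have hLre : (L w).re = Real.log (dist w a) := by
    have := congrArg norm (hexp w (verts_subset_region hwV))
    rw [Complex.norm_exp, hwan] at this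
    rw [← this, Real.log_exp]
  have hPpos : 0 < (P w).re := by
    rw [hP]; simp only
    rw [hre]
    refine mul_pos (Real.exp_pos _) (Real.cos_pos_of_mem_Ioo ?_)
    have : |μ * (Real.log (dist w a) - Real.log ρ)| < Real.pi / 2 := by
      rw [abs_mul, abs_of_pos hμ0]; exact hwS.2
    rw [abs_lt] at this
    rw [Complex.sub_re, hLre, Complex.ofReal_re]
    exact ⟨by linarith [this.1], this.2⟩
  have hεn : ∀ s, ‖(s - w) / (w - a)‖ = dist w s / dist w a := fun s => by
    rw [norm_div, hwan, dist_comm w s, dist_eq_norm s w]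
  have hdwa : 0 < dist w a := hwS.1
  obtain ⟨s, hsN, hs⟩ := exists_re_lt_of_sum_eq_zero (N := IsoradialGraph.nbrs hT w)
    (c := Γ.cond w) (ε := fun s => (s - w) / (w - a)) (α := α) (P := P w)
    (k₁ := κ / (1 + T ^ 2)) (k₂ := 4 * κ)
    (fun s hs => hT.cond_pos (IsoradialGraph.mem_nbrs.mp hs))
    (by
      obtain ⟨s, hs⟩ := IsoradialGraph.exists_neighbor hT (Ω.verts_subset hwV)
      exact ⟨s, IsoradialGraph.mem_nbrs.mpr hs⟩)
    (by
      have := (IsoradialGraph.sum_cond_eq_zero hT w).1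
      rw [← zero_div (w - a), ← this, Finset.sum_div]
      exact Finset.sum_congr rfl fun s _ => by ring)
    (by
      have := (IsoradialGraph.sum_cond_eq_zero hT w).2
      rw [← zero_div ((w - a) ^ 2), ← this, Finset.sum_div]
      exact Finset.sum_congr rfl fun s _ => by rw [div_pow]; ring)
    (by rw [hαn]; linarith) (Complex.exp_ne_zero _) (by positivity) (by linarith)
    (by
      -- This is what fixes the 200 in `stripConst`: with k₂ = 4κ and k₁ = κ/(1 + T²) the
      -- requirement reads 112 · 4⁴ / 200² < 1.
      have e1 : κ * (1 + T ^ 2) = 1 / 200 := by rw [hκdef, stripConst]; field_simp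
      have e2 : κ ^ 2 = (κ / (1 + T ^ 2)) ^ 2 * (1 + T ^ 2) ^ 2 := by field_simp
      have e3 : 0 < (κ / (1 + T ^ 2)) ^ 2 := by positivity
      have e4 : κ ^ 4 = (κ / (1 + T ^ 2)) ^ 2 * (κ * (1 + T ^ 2)) ^ 2 := by
        rw [mul_pow, mul_left_comm, mul_comm, ← e2]
        ring
      rw [mul_pow, e4, e1]
      nlinarith)
    (fun s hs => by
      have hadj := IsoradialGraph.mem_nbrs.mp hs
      have hsep := IsoradialGraph.le_dist_of_mem_verts hT (Ω.verts_subset hwV)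
        (PlaneGraph.mem_verts_right hadj) hadj.ne
      rw [hαn, hεn, hμ]
      calc κ / (1 + T ^ 2) = κ * ρ / δ * ((2 / (1 + T ^ 2) * δ) / (2 * ρ)) := by field_simp
        _ ≤ _ := by gcongr)
    (fun s hs => by
      have hadj := IsoradialGraph.mem_nbrs.mp hs
      have hd := hT.dist_lt hadj
      rw [hαn, hεn, hμ]
      calc κ * ρ / δ * (dist w s / dist w a) ≤ κ * ρ / δ * (2 * δ / (ρ / 2)) := by gcongr
        _ = 4 * κ := by field_simp; norm_num)
  have hadj := IsoradialGraph.mem_nbrs.mp hsN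
  set ε := (s - w) / (w - a) with hε
  have hεsmall : ‖ε‖ * μ ≤ 4 * κ := by
    have hd := hT.dist_lt hadj
    rw [hεn, hμ, mul_comm]
    calc κ * ρ / δ * (dist w s / dist w a) ≤ κ * ρ / δ * (2 * δ / (ρ / 2)) := by gcongr
      _ = 4 * κ := by field_simp; norm_num
  have hε2 : ‖ε‖ ≤ 1 / 2 := by nlinarith [norm_nonneg ε]
  have h1ε : 1 + ε ≠ 0 := Complex.slitPlane_ne_zero
    (Complex.mem_slitPlane_of_norm_lt_one (by linarith))
  have hsa : s - a = (w - a) * (1 + ε) := by rw [hε]; field_simp; ring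
  have hPs : P w * Complex.exp (α * Complex.log (1 + ε)) =
      Complex.exp (α * (L w + Complex.log (1 + ε) - Real.log ρ)) := by
    rw [hP]; simp only
    rw [← Complex.exp_add]; congr 1; ring
  -- The neighbour `s` carries a larger value of the function continued from `w`. Inside the strip
  -- `s` belongs to `W`, against maximality. Outside it the phase is between π/2 and π in modulus,
  -- so the continued value is not positive; here `s` may lie outside the domain, and `P s` itself
  -- has no meaning.
  by_cases hsS : s ∈ S
  · have hsW : s ∈ W := by
      have h1 : (Γ.induce S).Adj w s := ⟨hadj, hwS, hsS⟩
      exact SimpleGraph.Reachable.trans hwW h1.reachable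
    have h1 := hmax s hsW
    have h2 := log_increment hL hexp hwV (hWV hsW) hadj (sub_ne_zero.mp hwa) (by rw [← hε]; linarith)
    rw [hPs] at hs
    rw [← hε] at h2
    simp only [hP, h2] at h1
    simp only [hP] at hs
    linarith
  · have hsa0 : 0 < dist s a := by
      rw [dist_eq_norm, hsa]
      exact norm_pos_iff.mpr (mul_ne_zero hwa h1ε)
    have hlog : Real.log (dist s a) = Real.log (dist w a) + (Complex.log (1 + ε)).re := by
      rw [Complex.log_re, dist_eq_norm, hsa, norm_mul, hwan,
        Real.log_mul hdwa.ne' (norm_ne_zero_iff.mpr h1ε)]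
    have hout : Real.pi / 2 ≤ μ * |Real.log (dist s a) - Real.log ρ| := by
      by_contra hlt
      exact hsS ⟨hsa0, not_le.mp hlt⟩
    have hlogn : μ * |(Complex.log (1 + ε)).re| ≤ 6 * κ := by
      have h1 := Complex.abs_re_le_norm (Complex.log (1 + ε))
      have h2 := Complex.norm_log_one_add_half_le_self hε2
      calc μ * |(Complex.log (1 + ε)).re| ≤ μ * (3 / 2 * ‖ε‖) := by gcongr; linarith
        _ = 3 / 2 * (‖ε‖ * μ) := by ring
        _ ≤ 3 / 2 * (4 * κ) := by gcongr
        _ = _ := by ring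
    have hup : μ * |Real.log (dist s a) - Real.log ρ| ≤ Real.pi := by
      have h1 : |Real.log (dist s a) - Real.log ρ| ≤
          |Real.log (dist w a) - Real.log ρ| + |(Complex.log (1 + ε)).re| := by
        rw [hlog, add_sub_right_comm]; exact abs_add_le _ _
      have h2 := mul_le_mul_of_nonneg_left h1 hμ0.le
      have h3 := hwS.2
      rw [mul_add] at h2
      linarith
    rw [hPs] at hs
    have hs' := hs.trans_eq (hre _)
    have hcos : Real.cos (μ * (L w + Complex.log (1 + ε) - Real.log ρ).re) ≤ 0 := by
      have e : (L w + Complex.log (1 + ε) - Real.log ρ).re = Real.log (dist s a) - Real.log ρ := by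
        rw [Complex.sub_re, Complex.add_re, hLre, Complex.ofReal_re, hlog]
      rw [e, ← Real.cos_abs, abs_mul, abs_of_pos hμ0]
      exact Real.cos_nonpos_of_pi_div_two_le_of_le hout (by linarith)
    have := mul_nonpos_of_nonneg_of_nonpos
      (Real.exp_pos (μ * (L w + Complex.log (1 + ε) - Real.log ρ).im)).le hcos
    linarith

end DiscreteDomain

/-! ### Packing bounds and energy inequalities. -/

/-- Packing bound for separated points of a ball or of an annulus. -/
theorem card_mul_sq_le {S : Finset ℂ} {a : ℂ} {s lo hi : ℝ} (hs : 0 < s) (hlo : 0 ≤ lo)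
    (hsep : ∀ x ∈ S, ∀ y ∈ S, x ≠ y → s ≤ dist x y)
    (hmem : ∀ x ∈ S, lo + s / 2 ≤ dist x a ∨ lo = 0) (hmem' : ∀ x ∈ S, dist x a ≤ hi)
    (hlohi : lo ≤ hi + s / 2) :
    (S.card : ℝ) * (s / 2) ^ 2 ≤ (hi + s / 2) ^ 2 - lo ^ 2 := by
  have hdisj : (S : Set ℂ).PairwiseDisjoint fun x => Metric.ball x (s / 2) := by
    intro x hx y hy hxy
    exact Metric.ball_disjoint_ball (by linarith [hsep x hx y hy hxy])
  have hhi : 0 ≤ hi + s / 2 := hlo.trans hlohi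
  -- Areas are compared: the balls around the points of `S` are disjoint from each other and from
  -- the inner ball.
  have hsub : (⋃ x ∈ S, Metric.ball x (s / 2)) ∪ Metric.ball a lo ⊆ Metric.ball a (hi + s / 2) := by
    rintro z (hz | hz)
    · obtain ⟨x, hx, hzx⟩ := mem_iUnion₂.mp hz
      have h1 := hmem' x hx
      have h2 := dist_triangle z x a
      rw [Metric.mem_ball] at hzx ⊢
      linarith
    · exact Metric.ball_subset_ball hlohi hz
  have hdisj2 : Disjoint (⋃ x ∈ S, Metric.ball x (s / 2)) (Metric.ball a lo) := by
    rw [Set.disjoint_left]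
    intro z hz hza
    obtain ⟨x, hx, hzx⟩ := mem_iUnion₂.mp hz
    rw [Metric.mem_ball] at hzx hza
    rcases hmem x hx with h | h
    · have h2 := dist_triangle x z a
      rw [dist_comm x z] at h2
      linarith
    · rw [h] at hza
      exact absurd hza (not_lt.mpr dist_nonneg)
  have hvol := MeasureTheory.measure_mono (μ := MeasureTheory.volume) hsub
  rw [MeasureTheory.measure_union hdisj2 measurableSet_ball,
    MeasureTheory.measure_biUnion_finset hdisj (fun _ _ => measurableSet_ball)] at hvol
  simp only [Complex.volume_ball, Finset.sum_const, nsmul_eq_mul] at hvol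
  have e : ∀ r : ℝ, 0 ≤ r → ENNReal.ofReal r ^ 2 * (NNReal.pi : ℝ≥0∞) = ENNReal.ofReal (r ^ 2 * Real.pi) := by
    intro r hr
    rw [ENNReal.ofReal_mul (by positivity), ENNReal.ofReal_pow hr]
    congr 1
    rw [← NNReal.coe_real_pi, ENNReal.ofReal_coe_nnreal]
  rw [e _ (by positivity), e _ hlo, e _ hhi, ← ENNReal.ofReal_natCast S.card,
    ← ENNReal.ofReal_mul (by positivity), ← ENNReal.ofReal_add (by positivity) (by positivity),
    ENNReal.ofReal_le_ofReal_iff (by positivity)] at hvol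
  have hpi := Real.pi_pos
  have : ((S.card : ℝ) * (s / 2) ^ 2 + lo ^ 2) * Real.pi ≤ (hi + s / 2) ^ 2 * Real.pi := by linarith
  linarith [le_of_mul_le_mul_right this hpi]

/-- Discrete Caccioppoli inequality. -/
theorem sum_sq_sub_le_of_subharmonic {B : Finset ℂ} {w : ℂ → ℂ → ℝ} (hw : ∀ x y, w x y = w y x)
    {g χ : ℂ → ℝ}
    (hsub : ∀ x ∈ B, 0 ≤ χ x ^ 2 * g x * ∑ y ∈ B, w x y * (g y - g x)) :
    ∑ x ∈ B, ∑ y ∈ B, w x y * (χ y * g y - χ x * g x) ^ 2 ≤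
      ∑ x ∈ B, ∑ y ∈ B, w x y * (g x * g y * (χ y - χ x) ^ 2) := by
  have hA : 0 ≤ ∑ x ∈ B, ∑ y ∈ B, w x y * (χ x ^ 2 * g x * (g y - g x)) := by
    refine Finset.sum_nonneg fun x hx => ?_
    have := hsub x hx
    rw [Finset.mul_sum] at this
    refine this.trans_eq (Finset.sum_congr rfl fun y _ => by ring)
  have hA' : ∑ x ∈ B, ∑ y ∈ B, w x y * (χ x ^ 2 * g x * (g y - g x)) =
      ∑ x ∈ B, ∑ y ∈ B, w x y * (χ y ^ 2 * g y * (g x - g y)) := by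
    rw [Finset.sum_comm]
    exact Finset.sum_congr rfl fun x _ => Finset.sum_congr rfl fun y _ => by rw [hw]
  -- An identity valid pair by pair. The two sums on the right are equal by symmetry of `w` and
  -- nonnegative by subharmonicity.
  have key : ∑ x ∈ B, ∑ y ∈ B, w x y * (g x * g y * (χ y - χ x) ^ 2) -
      ∑ x ∈ B, ∑ y ∈ B, w x y * (χ y * g y - χ x * g x) ^ 2 =
      ∑ x ∈ B, ∑ y ∈ B, w x y * (χ x ^ 2 * g x * (g y - g x)) +
      ∑ x ∈ B, ∑ y ∈ B, w x y * (χ y ^ 2 * g y * (g x - g y)) := by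
    simp only [← Finset.sum_sub_distrib, ← Finset.sum_add_distrib]
    exact Finset.sum_congr rfl fun x _ => Finset.sum_congr rfl fun y _ => by ring
  rw [← hA'] at key
  linarith

theorem log_le_sum_inv {b : ℝ} (hb : 0 < b) (n : ℕ) :
    Real.log ((b + n + 1) / (b + 1)) ≤ ∑ j ∈ Finset.range n, 1 / (b + (j + 1)) := by
  induction n with
  | zero => simp [div_self (by positivity : b + 1 ≠ 0)]
  | succ n ih =>
    rw [Finset.sum_range_succ]
    have h1 : (0 : ℝ) < b + n + 1 := by positivity
    have e : (b + (n + 1 : ℕ) + 1) / (b + 1) = (b + n + 1) / (b + 1) * (1 + 1 / (b + (n + 1))) := by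
      push_cast; field_simp; ring
    rw [e, Real.log_mul (by positivity) (by positivity)]
    have h2 : Real.log (1 + 1 / (b + (n + 1))) ≤ 1 / (b + (n + 1)) := by
      have := Real.log_le_sub_one_of_pos (x := 1 + 1 / (b + ((n : ℝ) + 1))) (by positivity)
      linarith
    linarith

/-- Lower bound (relative to the mesh) for the distance between vertices. -/
def sepConst (T : ℝ) : ℝ := 2 / (1 + T ^ 2)

/-- Upper bound for the number of neighbours of a vertex. -/
def degConst (T : ℝ) : ℝ := 36 / sepConst T ^ 2

theorem sepConst_pos (T : ℝ) : 0 < sepConst T := by unfold sepConst; positivity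

theorem sepConst_le_one {T : ℝ} (hT : 1 ≤ T) : sepConst T ≤ 1 := by
  unfold sepConst
  rw [div_le_one (by positivity)]
  nlinarith

theorem degConst_pos (T : ℝ) : 0 < degConst T := by
  have := sepConst_pos T
  unfold degConst; positivity

namespace IsoradialGraph

variable {δ : ℝ} {Γ : IsoradialGraph δ} {T : ℝ}

/-- The vertices in a ball. -/
def vertsIn (Γ : IsoradialGraph δ) (z : ℂ) (R : ℝ) : Finset ℂ := (Γ.locallyFinite z R).toFinset

theorem mem_vertsIn {z x : ℂ} {R : ℝ} : x ∈ Γ.vertsIn z R ↔ x ∈ Γ.verts ∧ dist x z < R := by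
  simp [vertsIn]

theorem card_vertsIn_le (hT : Γ.CondBounded T) {z : ℂ} {R : ℝ} (hR : δ ≤ R) :
    ((Γ.vertsIn z R).card : ℝ) ≤ 9 * R ^ 2 / (sepConst T * δ) ^ 2 := by
  have hδ := Γ.mesh_pos
  have hs := sepConst_pos T
  have hs1 := sepConst_le_one hT.one_le
  have hsδ : sepConst T * δ ≤ δ := mul_le_of_le_one_left hδ.le hs1
  have h := card_mul_sq_le (S := Γ.vertsIn z R) (a := z) (s := sepConst T * δ) (lo := 0) (hi := R)
    (by positivity) le_rfl
    (fun x hx y hy hxy => le_dist_of_mem_verts hT (mem_vertsIn.mp hx).1 (mem_vertsIn.mp hy).1 hxy)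
    (fun _ _ => Or.inr rfl) (fun x hx => (mem_vertsIn.mp hx).2.le)
    (by linarith [mul_pos hs hδ])
  rw [le_div_iff₀ (by positivity)]
  have : (R + sepConst T * δ / 2) ^ 2 ≤ (3 / 2 * R) ^ 2 := by
    have : R + sepConst T * δ / 2 ≤ 3 / 2 * R := by linarith
    have : 0 ≤ R + sepConst T * δ / 2 := by linarith [mul_pos hs hδ]
    gcongr
  nlinarith

theorem card_nbrs_le (hT : Γ.CondBounded T) (u : ℂ) : ((nbrs hT u).card : ℝ) ≤ degConst T := by
  have hδ := Γ.mesh_pos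
  have hs := sepConst_pos T
  have hsub : nbrs hT u ⊆ Γ.vertsIn u (2 * δ) := fun s hs => by
    have := mem_nbrs.mp hs
    exact mem_vertsIn.mpr ⟨PlaneGraph.mem_verts_right this, by
      rw [dist_comm]; exact hT.dist_lt this⟩
  calc ((nbrs hT u).card : ℝ) ≤ (Γ.vertsIn u (2 * δ)).card := by
        exact_mod_cast Finset.card_le_card hsub
    _ ≤ 9 * (2 * δ) ^ 2 / (sepConst T * δ) ^ 2 := card_vertsIn_le hT (by linarith)
    _ = degConst T := by unfold degConst; field_simp; norm_num

/-- The bound is linear in ρ: a ring of width of order δ has only O(ρ/δ) vertices. This is why the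
ring energies add up to a logarithm. -/
theorem card_annulus_le (hT : Γ.CondBounded T) {S : Finset ℂ} {a : ℂ} {ρ w : ℝ} (hw : δ ≤ w)
    (hρ : 2 * w ≤ ρ) (hS : ∀ x ∈ S, x ∈ Γ.verts ∧ |dist x a - ρ| ≤ w) :
    (S.card : ℝ) ≤ 24 * ρ * w / (sepConst T * δ) ^ 2 := by
  have hδ := Γ.mesh_pos
  have hs := sepConst_pos T
  have hs1 := sepConst_le_one hT.one_le
  have hsδ : sepConst T * δ ≤ δ := mul_le_of_le_one_left hδ.le hs1
  have hsδ0 : 0 < sepConst T * δ := by positivity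
  have h := card_mul_sq_le (S := S) (a := a) (s := sepConst T * δ)
    (lo := ρ - w - sepConst T * δ / 2) (hi := ρ + w)
    (by positivity) (by linarith)
    (fun x hx y hy hxy => le_dist_of_mem_verts hT (hS x hx).1 (hS y hy).1 hxy)
    (fun x hx => Or.inl (by linarith [(abs_le.mp (hS x hx).2).1]))
    (fun x hx => by linarith [(abs_le.mp (hS x hx).2).2]) (by linarith)
  rw [le_div_iff₀ (by positivity)]
  have h2 : ρ * (sepConst T * δ) ≤ ρ * w := mul_le_mul_of_nonneg_left (by linarith) (by linarith)
  nlinarith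

open Classical in
/-- The conductance as a function of pairs of points. -/
def wt (Γ : IsoradialGraph δ) (x y : ℂ) : ℝ := if Γ.graph.Adj x y then Γ.cond x y else 0

theorem wt_of_adj {x y : ℂ} (h : Γ.graph.Adj x y) : Γ.wt x y = Γ.cond x y := by simp [wt, h]

theorem wt_of_not_adj {x y : ℂ} (h : ¬Γ.graph.Adj x y) : Γ.wt x y = 0 := by simp [wt, h]

theorem wt_comm (x y : ℂ) : Γ.wt x y = Γ.wt y x := by
  by_cases h : Γ.graph.Adj x y
  · rw [wt_of_adj h, wt_of_adj h.symm, cond_comm]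
  · rw [wt_of_not_adj h, wt_of_not_adj (fun h' => h h'.symm)]

theorem wt_nonneg (hT : Γ.CondBounded T) (x y : ℂ) : 0 ≤ Γ.wt x y := by
  by_cases h : Γ.graph.Adj x y
  · rw [wt_of_adj h]; exact (hT.cond_pos h).le
  · rw [wt_of_not_adj h]

theorem wt_le (hT : Γ.CondBounded T) (x y : ℂ) : Γ.wt x y ≤ T := by
  by_cases h : Γ.graph.Adj x y
  · rw [wt_of_adj h]; exact hT.upper x y h
  · rw [wt_of_not_adj h]; linarith [hT.one_le]

theorem sum_wt_eq (hT : Γ.CondBounded T) {B : Finset ℂ} {x : ℂ} (hB : nbrs hT x ⊆ B)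
    (F : ℂ → ℝ) : ∑ y ∈ B, Γ.wt x y * F y = ∑ y ∈ nbrs hT x, Γ.cond x y * F y := by
  rw [← Finset.sum_subset hB fun y _ hy => by
    rw [wt_of_not_adj (fun h => hy (mem_nbrs.mpr h)), zero_mul]]
  exact Finset.sum_congr rfl fun y hy => by rw [wt_of_adj (mem_nbrs.mp hy)]

/-- Energy of a function with small gradient. -/
theorem sum_wt_mul_le (hT : Γ.CondBounded T) {B B' : Finset ℂ} {F : ℂ → ℂ → ℝ} {c : ℝ}
    (hc : 0 ≤ c) (hF : ∀ x ∈ B, ∀ y ∈ B, Γ.graph.Adj x y → F x y ≤ c)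
    (hF0 : ∀ x ∈ B, ∀ y ∈ B, Γ.graph.Adj x y → x ∉ B' → F x y = 0) :
    ∑ x ∈ B, ∑ y ∈ B, Γ.wt x y * F x y ≤ B'.card * (degConst T * (T * c)) := by
  classical
  have hT1 := hT.one_le
  have h1 : ∀ x ∈ B, ∑ y ∈ B, Γ.wt x y * F x y ≤ if x ∈ B' then degConst T * (T * c) else 0 := by
    intro x hx
    split_ifs with hxB
    · calc ∑ y ∈ B, Γ.wt x y * F x y ≤ ∑ y ∈ B, if y ∈ nbrs hT x then T * c else 0 := by
            refine Finset.sum_le_sum fun y hy => ?_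
            split_ifs with hyn
            · have hadj := mem_nbrs.mp hyn
              calc Γ.wt x y * F x y ≤ Γ.wt x y * c :=
                    mul_le_mul_of_nonneg_left (hF x hx y hy hadj) (wt_nonneg hT x y)
                _ ≤ T * c := mul_le_mul_of_nonneg_right (wt_le hT x y) hc
            · rw [wt_of_not_adj (fun h => hyn (mem_nbrs.mpr h)), zero_mul]
        _ = ((B ∩ nbrs hT x).card : ℝ) * (T * c) := by
            rw [Finset.sum_ite_mem, Finset.sum_const, nsmul_eq_mul]
        _ ≤ degConst T * (T * c) := by
            have : ((B ∩ nbrs hT x).card : ℝ) ≤ degConst T :=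
              le_trans (by exact_mod_cast Finset.card_le_card Finset.inter_subset_right)
                (card_nbrs_le hT x)
            gcongr
    · refine le_of_eq (Finset.sum_eq_zero fun y hy => ?_)
      by_cases hadj : Γ.graph.Adj x y
      · rw [hF0 x hx y hy hadj hxB, mul_zero]
      · rw [wt_of_not_adj hadj, zero_mul]
  refine (Finset.sum_le_sum h1).trans ?_
  rw [Finset.sum_ite_mem, Finset.sum_const, nsmul_eq_mul]
  have : ((B ∩ B').card : ℝ) ≤ B'.card := by
    exact_mod_cast Finset.card_le_card Finset.inter_subset_right
  have := degConst_pos T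
  gcongr

open Classical in
/-- The oriented edges between points of a finite set. -/
def arcs (Γ : IsoradialGraph δ) (S : Finset ℂ) : Finset (ℂ × ℂ) :=
  (S ×ˢ S).filter fun p => Γ.graph.Adj p.1 p.2

theorem mem_arcs {S : Finset ℂ} {p : ℂ × ℂ} :
    p ∈ Γ.arcs S ↔ p.1 ∈ S ∧ p.2 ∈ S ∧ Γ.graph.Adj p.1 p.2 := by
  simp [arcs, and_assoc]

theorem card_arcs_le (hT : Γ.CondBounded T) (S : Finset ℂ) :
    ((Γ.arcs S).card : ℝ) ≤ S.card * degConst T := by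
  classical
  have h1 : Γ.arcs S ⊆ (S.sigma fun x => nbrs hT x).image (fun p => (p.1, p.2)) := by
    intro p hp
    obtain ⟨h1, h2, h3⟩ := mem_arcs.mp hp
    exact Finset.mem_image.mpr ⟨⟨p.1, p.2⟩, Finset.mem_sigma.mpr ⟨h1, mem_nbrs.mpr h3⟩, rfl⟩
  have h2 : (Γ.arcs S).card ≤ ∑ x ∈ S, (nbrs hT x).card :=
    (Finset.card_le_card h1).trans (Finset.card_image_le.trans (Finset.card_sigma _ _).le)
  calc ((Γ.arcs S).card : ℝ) ≤ ∑ x ∈ S, ((nbrs hT x).card : ℝ) := by exact_mod_cast h2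
    _ ≤ ∑ x ∈ S, degConst T := Finset.sum_le_sum fun x _ => card_nbrs_le hT x
    _ = _ := by rw [Finset.sum_const, nsmul_eq_mul]

theorem sub_le_sum_darts {G : SimpleGraph ℂ} (g : ℂ → ℝ) {v b : ℂ} (p : G.Walk v b) :
    g v - g b ≤ (p.darts.map fun d => |g d.fst - g d.snd|).sum := by
  induction p with
  | nil => simp
  | @cons u w b h p ih =>
    simp only [SimpleGraph.Walk.darts_cons, List.map_cons, List.sum_cons]
    linarith [le_abs_self (g u - g w)]

theorem sub_le_sum_arcs_of_reachable {Z : Set ℂ} {S : Finset ℂ}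
    (hS : ∀ x ∈ Γ.verts, x ∈ Z → x ∈ S) {v b : ℂ} (h : (Γ.induce Z).Reachable v b) (g : ℂ → ℝ) :
    g v - g b ≤ ∑ p ∈ Γ.arcs S, |g p.1 - g p.2| := by
  classical
  -- A path without repeated vertices uses each oriented edge at most once, so its increments form a
  -- subfamily of those over all arcs.
  obtain ⟨p, hp⟩ := h.exists_isPath
  refine (sub_le_sum_darts g p).trans ?_
  rw [← List.sum_toFinset _ (SimpleGraph.Walk.darts_nodup_of_support_nodup hp.support_nodup)]
  have e : ∑ d ∈ p.darts.toFinset, |g d.fst - g d.snd| =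
      ∑ q ∈ p.darts.toFinset.image SimpleGraph.Dart.toProd, |g q.1 - g q.2| := by
    rw [Finset.sum_image fun d _ d' _ hdd => SimpleGraph.Dart.toProd_injective hdd]
  rw [e]
  refine Finset.sum_le_sum_of_subset_of_nonneg (fun q hq => ?_) fun _ _ _ => abs_nonneg _
  obtain ⟨d, -, rfl⟩ := Finset.mem_image.mp hq
  have hd : Γ.graph.Adj d.fst d.snd ∧ d.fst ∈ Z ∧ d.snd ∈ Z := d.adj
  exact mem_arcs.mpr ⟨hS _ (PlaneGraph.mem_verts_left hd.1) hd.2.1,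
    hS _ (PlaneGraph.mem_verts_right hd.1) hd.2.2, hd.1⟩

/-- A function that varies along a path in a set has some energy in this set. -/
theorem sq_le_of_reachable {Z : Set ℂ} {S : Finset ℂ}
    (hS : ∀ x ∈ Γ.verts, x ∈ Z → x ∈ S) {v b : ℂ} (h : (Γ.induce Z).Reachable v b) {g : ℂ → ℝ}
    (hg : g b ≤ g v) :
    (g v - g b) ^ 2 ≤ (Γ.arcs S).card * ∑ p ∈ Γ.arcs S, (g p.1 - g p.2) ^ 2 := by
  have h1 := sub_le_sum_arcs_of_reachable hS h g
  calc (g v - g b) ^ 2 ≤ (∑ p ∈ Γ.arcs S, |g p.1 - g p.2|) ^ 2 := by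
        have : 0 ≤ g v - g b := sub_nonneg.mpr hg
        gcongr
    _ ≤ (Γ.arcs S).card * ∑ p ∈ Γ.arcs S, |g p.1 - g p.2| ^ 2 := sq_sum_le_card_mul_sum_sq
    _ = _ := by simp only [sq_abs]

end IsoradialGraph

/-! ### Cutoff functions and the constants of the ring argument. -/

/-- The cutoff function of an annulus, in terms of the distance to its center. -/
def cutoffIn (r t : ℝ) : ℝ := max 0 (min 1 (2 * t / r - 1))

/-- The cutoff function of a disc, in terms of the distance to its center. -/
def cutoffOut (R t : ℝ) : ℝ := max 0 (min 1 (2 - t / R))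

theorem abs_clamp_sub_le (x y : ℝ) : |max 0 (min 1 x) - max 0 (min 1 y)| ≤ |x - y| := by
  have h1 := abs_max_sub_max_le_abs (min 1 x) (min 1 y) 0
  have h2 := abs_min_sub_min_le_max 1 x 1 y
  rw [max_comm 0, max_comm 0]
  refine h1.trans (h2.trans ?_)
  simp

theorem clamp_mem (x : ℝ) : 0 ≤ max 0 (min 1 x) ∧ max 0 (min 1 x) ≤ 1 :=
  ⟨le_max_left _ _, max_le zero_le_one (min_le_left _ _)⟩

theorem cutoffIn_eq_one {r t : ℝ} (hr : 0 < r) (h : r ≤ t) : cutoffIn r t = 1 := by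
  have : 1 ≤ 2 * t / r - 1 := by
    have : 2 ≤ 2 * t / r := by rw [le_div_iff₀ hr]; linarith
    linarith
  rw [cutoffIn, min_eq_left this, max_eq_right zero_le_one]

theorem cutoffIn_eq_zero {r t : ℝ} (hr : 0 < r) (h : t ≤ r / 2) : cutoffIn r t = 0 := by
  have : 2 * t / r - 1 ≤ 0 := by
    have : 2 * t / r ≤ 1 := by rw [div_le_one hr]; linarith
    linarith
  rw [cutoffIn, max_eq_left ((min_le_right _ _).trans this)]

theorem cutoffOut_eq_one {R t : ℝ} (hR : 0 < R) (h : t ≤ R) : cutoffOut R t = 1 := by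
  have : 1 ≤ 2 - t / R := by
    have : t / R ≤ 1 := by rw [div_le_one hR]; linarith
    linarith
  rw [cutoffOut, min_eq_left this, max_eq_right zero_le_one]

theorem cutoffOut_eq_zero {R t : ℝ} (hR : 0 < R) (h : 2 * R ≤ t) : cutoffOut R t = 0 := by
  have : 2 - t / R ≤ 0 := by
    have : 2 ≤ t / R := by rw [le_div_iff₀ hR]; linarith
    linarith
  rw [cutoffOut, max_eq_left ((min_le_right _ _).trans this)]

/-- The (relative) half-width of the annuli in which vertices are connected to the boundary. -/
def widthConst (T : ℝ) : ℝ := 4 / stripConst T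

/-- The spacing of disjoint annuli. -/
def spacing (T : ℝ) : ℝ := 2 * widthConst T + 5

/-- The bound for the energy of a subharmonic function in an annulus. -/
def energyConst (T : ℝ) : ℝ := 1800 * degConst T * T / sepConst T ^ 2

/-- The inverse of the energy of a function on an annulus that is not small there. -/
def ringConst (T : ℝ) : ℝ := 96 * T * degConst T * spacing T ^ 2 / sepConst T ^ 2

/-- A ratio of radii for which subharmonic functions decrease by a factor `2`. -/
def ratio (T : ℝ) : ℝ := 2 * Real.exp (energyConst T * ringConst T + 1) + 1

theorem widthConst_ge {T : ℝ} (hT : 1 ≤ T) : 1600 ≤ widthConst T := by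
  have h1 := stripConst_le hT
  have h2 := stripConst_pos T
  unfold widthConst
  rw [le_div_iff₀ h2]; linarith

theorem energyConst_pos {T : ℝ} (hT : 1 ≤ T) : 0 < energyConst T := by
  have := sepConst_pos T
  have := degConst_pos T
  unfold energyConst; positivity

theorem ringConst_pos {T : ℝ} (hT : 1 ≤ T) : 0 < ringConst T := by
  have := sepConst_pos T
  have := degConst_pos T
  have := widthConst_ge hT
  unfold ringConst spacing; positivity

theorem ratio_ge {T : ℝ} (hT : 1 ≤ T) : 5 ≤ ratio T := by
  have h1 := energyConst_pos hT
  have h2 := ringConst_pos hT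
  have := Real.add_one_le_exp (energyConst T * ringConst T + 1)
  have : 0 < energyConst T * ringConst T := by positivity
  unfold ratio; linarith

/-! ### Energy of a subharmonic function in an annulus. -/

namespace DiscreteDomain

variable {δ : ℝ} {Γ : IsoradialGraph δ} {T : ℝ} {Ω : DiscreteDomain Γ}

/-- A nonnegative function vanishing outside the domain and subharmonic in an annulus. -/
structure SubharmonicIn (hT : Γ.CondBounded T) (Ω : DiscreteDomain Γ) (a : ℂ) (r R : ℝ)
    (g : ℂ → ℝ) : Prop where
  nonneg : ∀ v, 0 ≤ g v
  eq_zero : ∀ v ∉ Ω.verts, g v = 0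
  le_one : ∀ v ∈ Ω.verts, r / 4 < dist v a → dist v a < 4 * R → g v ≤ 1
  sub : ∀ v ∈ Ω.verts, r / 2 < dist v a → dist v a < 2 * R →
    0 ≤ ∑ s ∈ IsoradialGraph.nbrs hT v, Γ.cond v s * (g s - g v)

/-- Caccioppoli's inequality leaves the energy of the cutoffs. The inner one varies by O(δ/r) per
edge over O(r²/δ²) vertices, the outer one by O(δ/R) over O(R²/δ²); in dimension two the scales
cancel. -/
theorem SubharmonicIn.energy_le {hT : Γ.CondBounded T} {a : ℂ} {r R : ℝ} {g : ℂ → ℝ}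
    (h : SubharmonicIn hT Ω a r R g) (hr : 8 * δ ≤ r) (hR : r ≤ R) :
    ∑ x ∈ Γ.vertsIn a (3 * R), ∑ y ∈ Γ.vertsIn a (3 * R), Γ.wt x y *
      (cutoffIn r (dist y a) * cutoffOut R (dist y a) * g y -
        cutoffIn r (dist x a) * cutoffOut R (dist x a) * g x) ^ 2 ≤ energyConst T := by
  have hδ := Γ.mesh_pos
  have hT1 := hT.one_le
  have hr0 : 0 < r := by linarith
  have hR0 : 0 < R := by linarith
  set B := Γ.vertsIn a (3 * R) with hB
  set χ : ℂ → ℝ := fun x => cutoffIn r (dist x a) * cutoffOut R (dist x a) with hχ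
  have hdist : ∀ x y, Γ.graph.Adj x y → |dist x a - dist y a| < 2 * δ := fun x y hxy =>
    lt_of_le_of_lt (abs_dist_sub_le x y a) (hT.dist_lt hxy)
  have hχ0 : ∀ x, χ x ≠ 0 → r / 2 < dist x a ∧ dist x a < 2 * R := by
    intro x hx
    constructor
    · by_contra hle
      exact hx (by simp only [hχ]; rw [cutoffIn_eq_zero hr0 (not_lt.mp hle), zero_mul])
    · by_contra hle
      exact hx (by simp only [hχ]; rw [cutoffOut_eq_zero hR0 (not_lt.mp hle), mul_zero])
  have hcac := sum_sq_sub_le_of_subharmonic (B := B) (w := Γ.wt) (g := g) (χ := χ)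
    IsoradialGraph.wt_comm (fun x hx => by
      by_cases h0 : χ x ^ 2 * g x = 0
      · rw [h0, zero_mul]
      have hχx : χ x ≠ 0 := fun he => h0 (by rw [he]; ring)
      have hgx : g x ≠ 0 := fun he => h0 (by rw [he]; ring)
      have hxV : x ∈ Ω.verts := by
        by_contra hxV; exact hgx (h.eq_zero x hxV)
      obtain ⟨h1, h2⟩ := hχ0 x hχx
      have hnb : IsoradialGraph.nbrs hT x ⊆ B := fun s hs => by
        have hadj := IsoradialGraph.mem_nbrs.mp hs
        refine IsoradialGraph.mem_vertsIn.mpr ⟨PlaneGraph.mem_verts_right hadj, ?_⟩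
        have := (abs_lt.mp (hdist x s hadj)).1
        linarith
      rw [IsoradialGraph.sum_wt_eq hT hnb]
      exact mul_nonneg (mul_nonneg (sq_nonneg _) (h.nonneg x)) (h.sub x hxV h1 h2))
  refine hcac.trans ?_
  -- the two transition zones
  have hsplit : ∀ x ∈ B, ∀ y ∈ B, Γ.graph.Adj x y → g x * g y * (χ y - χ x) ^ 2 ≤
      2 * (cutoffIn r (dist y a) - cutoffIn r (dist x a)) ^ 2 +
      2 * (cutoffOut R (dist y a) - cutoffOut R (dist x a)) ^ 2 := by
    intro x hx y hy hxy
    have hrhs : 0 ≤ 2 * (cutoffIn r (dist y a) - cutoffIn r (dist x a)) ^ 2 +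
      2 * (cutoffOut R (dist y a) - cutoffOut R (dist x a)) ^ 2 := by positivity
    by_cases hxy0 : g x * g y * (χ y - χ x) ^ 2 = 0
    · rw [hxy0]; exact hrhs
    have hgx : g x ≠ 0 := fun he => hxy0 (by rw [he]; ring)
    have hgy : g y ≠ 0 := fun he => hxy0 (by rw [he]; ring)
    have hxV : x ∈ Ω.verts := by
      by_contra hxV; exact hgx (h.eq_zero x hxV)
    have hyV : y ∈ Ω.verts := by
      by_contra hyV; exact hgy (h.eq_zero y hyV)
    have hd := abs_lt.mp (hdist x y hxy)
    -- One endpoint lies in the support of `χ` and the other is within 2δ ≤ r/4 of it. Hence the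
    -- zone for `le_one` is larger than the one for `sub`.
    have hzone : (r / 4 < dist x a ∧ dist x a < 4 * R) ∧ r / 4 < dist y a ∧ dist y a < 4 * R := by
      by_cases hx0 : χ x = 0
      · have hy0 : χ y ≠ 0 := fun hy0 => hxy0 (by rw [hx0, hy0]; ring)
        have := hχ0 y hy0
        refine ⟨⟨?_, ?_⟩, ?_, ?_⟩ <;> linarith
      · have := hχ0 x hx0
        refine ⟨⟨?_, ?_⟩, ?_, ?_⟩ <;> linarith
    have hgx1 := h.le_one x hxV hzone.1.1 hzone.1.2
    have hgy1 := h.le_one y hyV hzone.2.1 hzone.2.2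
    have h1 : g x * g y ≤ 1 := mul_le_one₀ hgx1 (h.nonneg y) hgy1
    have h2 : g x * g y * (χ y - χ x) ^ 2 ≤ (χ y - χ x) ^ 2 :=
      mul_le_of_le_one_left (sq_nonneg _) h1
    refine h2.trans ?_
    obtain ⟨p0, p1⟩ := clamp_mem (2 * dist y a / r - 1)
    obtain ⟨q0, q1⟩ := clamp_mem (2 - dist x a / R)
    change 0 ≤ cutoffIn r (dist y a) at p0
    change cutoffIn r (dist y a) ≤ 1 at p1
    change 0 ≤ cutoffOut R (dist x a) at q0
    change cutoffOut R (dist x a) ≤ 1 at q1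
    have e : χ y - χ x = (cutoffIn r (dist y a) - cutoffIn r (dist x a)) * cutoffOut R (dist x a) +
        cutoffIn r (dist y a) * (cutoffOut R (dist y a) - cutoffOut R (dist x a)) := by
      simp only [hχ]; ring
    rw [e]
    have e1 := mul_le_of_le_one_right (sq_nonneg (cutoffIn r (dist y a) - cutoffIn r (dist x a)))
      (pow_le_one₀ (n := 2) q0 q1)
    have e2 := mul_le_of_le_one_right
      (sq_nonneg (cutoffOut R (dist y a) - cutoffOut R (dist x a))) (pow_le_one₀ (n := 2) p0 p1)
    refine (add_sq_le).trans ?_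
    rw [mul_pow, mul_pow]
    linarith
  have hsum : ∑ x ∈ B, ∑ y ∈ B, Γ.wt x y * (g x * g y * (χ y - χ x) ^ 2) ≤
      ∑ x ∈ B, ∑ y ∈ B, Γ.wt x y * (2 * (cutoffIn r (dist y a) - cutoffIn r (dist x a)) ^ 2) +
      ∑ x ∈ B, ∑ y ∈ B, Γ.wt x y *
        (2 * (cutoffOut R (dist y a) - cutoffOut R (dist x a)) ^ 2) := by
    simp only [← Finset.sum_add_distrib, ← mul_add]
    refine Finset.sum_le_sum fun x hx => Finset.sum_le_sum fun y hy => ?_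
    by_cases hxy : Γ.graph.Adj x y
    · exact mul_le_mul_of_nonneg_left (by linarith [hsplit x hx y hy hxy]) (IsoradialGraph.wt_nonneg hT x y)
    · rw [IsoradialGraph.wt_of_not_adj hxy, zero_mul, zero_mul]
  refine hsum.trans ?_
  have hs := sepConst_pos T
  have hDg := degConst_pos T
  have hin : ∑ x ∈ B, ∑ y ∈ B, Γ.wt x y *
      (2 * (cutoffIn r (dist y a) - cutoffIn r (dist x a)) ^ 2) ≤
      (Γ.vertsIn a (2 * r)).card * (degConst T * (T * (2 * (4 * δ / r) ^ 2))) := by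
    refine IsoradialGraph.sum_wt_mul_le hT (by positivity) (fun x hx y hy hxy => ?_)
      (fun x hx y hy hxy hxB => ?_)
    · have h1 : |cutoffIn r (dist y a) - cutoffIn r (dist x a)| ≤ 4 * δ / r := by
        refine (abs_clamp_sub_le _ _).trans ?_
        have : 2 * dist y a / r - 1 - (2 * dist x a / r - 1) = 2 * (dist y a - dist x a) / r := by ring
        rw [this, abs_div, abs_of_pos hr0, abs_mul, abs_two]
        have := hdist y x hxy.symm
        calc 2 * |dist y a - dist x a| / r ≤ 2 * (2 * δ) / r := by gcongr
          _ = 4 * δ / r := by ring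
      rw [← sq_abs (cutoffIn r (dist y a) - cutoffIn r (dist x a))]
      gcongr
    · have hxr : 2 * r ≤ dist x a := by
        by_contra hlt
        exact hxB (IsoradialGraph.mem_vertsIn.mpr
          ⟨(IsoradialGraph.mem_vertsIn.mp hx).1, not_le.mp hlt⟩)
      have := abs_lt.mp (hdist x y hxy)
      rw [cutoffIn_eq_one hr0 (by linarith), cutoffIn_eq_one hr0 (by linarith)]
      ring
  have hout : ∑ x ∈ B, ∑ y ∈ B, Γ.wt x y *
      (2 * (cutoffOut R (dist y a) - cutoffOut R (dist x a)) ^ 2) ≤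
      B.card * (degConst T * (T * (2 * (2 * δ / R) ^ 2))) := by
    refine IsoradialGraph.sum_wt_mul_le hT (by positivity) (fun x hx y hy hxy => ?_)
      (fun x hx y hy hxy hxB => absurd hx hxB)
    have h1 : |cutoffOut R (dist y a) - cutoffOut R (dist x a)| ≤ 2 * δ / R := by
      refine (abs_clamp_sub_le _ _).trans ?_
      have : 2 - dist y a / R - (2 - dist x a / R) = (dist x a - dist y a) / R := by ring
      rw [this, abs_div, abs_of_pos hR0]
      have := hdist x y hxy
      gcongr
    rw [← sq_abs (cutoffOut R (dist y a) - cutoffOut R (dist x a))]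
    gcongr
  have hc1 := IsoradialGraph.card_vertsIn_le hT (z := a) (R := 2 * r) (by linarith)
  have hc2 := IsoradialGraph.card_vertsIn_le hT (z := a) (R := 3 * R) (by linarith)
  have hin' : (Γ.vertsIn a (2 * r)).card * (degConst T * (T * (2 * (4 * δ / r) ^ 2))) ≤
      1152 * degConst T * T / sepConst T ^ 2 := by
    calc _ ≤ 9 * (2 * r) ^ 2 / (sepConst T * δ) ^ 2 *
          (degConst T * (T * (2 * (4 * δ / r) ^ 2))) := by gcongr
      _ = _ := by field_simp; norm_num
  have hout' : B.card * (degConst T * (T * (2 * (2 * δ / R) ^ 2))) ≤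
      648 * degConst T * T / sepConst T ^ 2 := by
    calc _ ≤ 9 * (3 * R) ^ 2 / (sepConst T * δ) ^ 2 *
          (degConst T * (T * (2 * (2 * δ / R) ^ 2))) := by gcongr
      _ = _ := by field_simp; norm_num
  have : energyConst T = 1152 * degConst T * T / sepConst T ^ 2 +
      648 * degConst T * T / sepConst T ^ 2 := by unfold energyConst; ring
  linarith

end DiscreteDomain

/-! ### A ring on which a subharmonic function is at most 1/2. -/

namespace DiscreteDomain

variable {δ : ℝ} {Γ : IsoradialGraph δ} {T : ℝ} {Ω : DiscreteDomain Γ}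

/-- A function that is large at a vertex and vanishes outside a simply connected domain has some
energy in the annulus around the vertex. -/
theorem ring_energy_ge (hT : Γ.CondBounded T) (hsc : IsSimplyConnected Ω.region) {a : ℂ}
    (ha : a ∉ Ω.region) {g : ℂ → ℝ} (hg : ∀ v ∉ Ω.verts, g v = 0) {v : ℂ} {ρ : ℝ}
    (hρ : spacing T * δ ≤ ρ) (hv : ρ ≤ dist v a) (hv' : dist v a ≤ ρ + 2 * δ) (hgv : 1 / 2 < g v)
    {S : Finset ℂ} (hS : ∀ x, x ∈ S ↔ x ∈ Γ.verts ∧ |dist x a - ρ| ≤ (widthConst T + 2) * δ) :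
    sepConst T ^ 2 * δ / (96 * T * degConst T * spacing T * ρ) ≤
      ∑ p ∈ Γ.arcs S, Γ.wt p.1 p.2 * (g p.1 - g p.2) ^ 2 := by
  have hδ := Γ.mesh_pos
  have hT1 := hT.one_le
  have hs := sepConst_pos T
  have hDg := degConst_pos T
  have hW := widthConst_ge hT1
  have hsp : spacing T = 2 * widthConst T + 5 := rfl
  have hsp0 : 0 < spacing T := by linarith
  have hρ0 : 0 < ρ := lt_of_lt_of_le (by positivity) hρ
  have hWδ : 4 * δ / stripConst T = widthConst T * δ := by unfold widthConst; ring
  have hWδ' : 8 * δ / stripConst T = 2 * widthConst T * δ := by unfold widthConst; ring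
  -- Along a path from `v` to `b` the function falls from above 1/2 to 0; Cauchy–Schwarz over the
  -- O(ρ/δ) arcs leaves energy at least of order δ/ρ. The path follows the circle through `v`, whose
  -- radius is within 2δ of ρ, hence the `+ 2` in the width.
  obtain ⟨b, hb, hreach⟩ := exists_reachable_notMem hT hsc ha (v := v) (by
    rw [hWδ']; rw [hsp] at hρ; nlinarith)
  rw [hWδ] at hreach
  have h1 := IsoradialGraph.sq_le_of_reachable (S := S) (fun x hx hxZ => by
    refine (hS x).mpr ⟨hx, ?_⟩
    have hxZ' : |dist x a - dist v a| ≤ widthConst T * δ := hxZ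
    rw [abs_le] at hxZ' ⊢
    constructor <;> linarith [hxZ'.1, hxZ'.2]) hreach (g := g)
    (by rw [hg b hb]; linarith)
  rw [hg b hb, sub_zero] at h1
  have h2 : 1 / 4 ≤ g v ^ 2 := by nlinarith
  have hcS := IsoradialGraph.card_annulus_le hT (S := S) (a := a) (ρ := ρ)
    (w := (widthConst T + 2) * δ) (by nlinarith) (by rw [hsp] at hρ; linarith)
    (fun x hx => (hS x).mp hx)
  have hcA : ((Γ.arcs S).card : ℝ) ≤ 24 * ρ * spacing T * degConst T / (sepConst T ^ 2 * δ) := by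
    refine (IsoradialGraph.card_arcs_le hT S).trans ?_
    calc _ ≤ 24 * ρ * ((widthConst T + 2) * δ) / (sepConst T * δ) ^ 2 * degConst T := by gcongr
      _ ≤ 24 * ρ * (spacing T * δ) / (sepConst T * δ) ^ 2 * degConst T := by
          gcongr; linarith
      _ = _ := by field_simp
  set E := ∑ p ∈ Γ.arcs S, (g p.1 - g p.2) ^ 2 with hE
  have hE0 : 0 ≤ E := Finset.sum_nonneg fun _ _ => sq_nonneg _
  have h3 : 1 / 4 ≤ 24 * ρ * spacing T * degConst T / (sepConst T ^ 2 * δ) * E :=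
    h2.trans (h1.trans (by gcongr))
  have h4 : T⁻¹ * E ≤ ∑ p ∈ Γ.arcs S, Γ.wt p.1 p.2 * (g p.1 - g p.2) ^ 2 := by
    rw [hE, Finset.mul_sum]
    refine Finset.sum_le_sum fun p hp => ?_
    have hadj := (IsoradialGraph.mem_arcs.mp hp).2.2
    rw [IsoradialGraph.wt_of_adj hadj]
    exact mul_le_mul_of_nonneg_right (hT.lower _ _ hadj) (sq_nonneg _)
  refine le_trans ?_ h4
  rw [div_le_iff₀ (by positivity)]
  rw [div_mul_eq_mul_div, div_le_div_iff₀ (by norm_num) (by positivity)] at h3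
  calc sepConst T ^ 2 * δ ≤ 24 * ρ * spacing T * degConst T * E * 4 := by linarith
    _ = T⁻¹ * E * (96 * T * degConst T * spacing T * ρ) := by field_simp; ring

/-- Between two well separated circles, a subharmonic function is at most `1 / 2` on some ring. -/
theorem SubharmonicIn.exists_ring (hT : Γ.CondBounded T) (hsc : IsSimplyConnected Ω.region) {a : ℂ}
    (ha : a ∉ Ω.region) {g : ℂ → ℝ} {r : ℝ} (hr : spacing T * δ ≤ r)
    (h : SubharmonicIn hT Ω a r (ratio T * r) g) :
    ∃ ρ, r ≤ ρ ∧ ρ + 2 * δ ≤ ratio T * r ∧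
      ∀ v ∈ Ω.verts, ρ ≤ dist v a → dist v a ≤ ρ + 2 * δ → g v ≤ 1 / 2 := by
  classical
  by_contra hcon
  push Not at hcon
  have hδ := Γ.mesh_pos
  have hT1 := hT.one_le
  have hs := sepConst_pos T
  have hDg := degConst_pos T
  have hW := widthConst_ge hT1
  have hsp : spacing T = 2 * widthConst T + 5 := rfl
  have hsp0 : 0 < spacing T := by linarith
  have hΛ := ratio_ge hT1
  have hr0 : 0 < r := lt_of_lt_of_le (by positivity) hr
  set d := spacing T * δ with hd
  have hd0 : 0 < d := by positivity
  set b := r / d with hb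
  have hb1 : 1 ≤ b := (one_le_div hd0).mpr hr
  have hrb : r = b * d := by rw [hb]; field_simp
  -- The number of annuli of spacing `d` between `r` and `ratio T * r`; the `- 1` leaves room beyond
  -- the last one.
  set n := ⌊(ratio T - 1) * b⌋₊ - 1 with hn
  have hfl : 1 ≤ ⌊(ratio T - 1) * b⌋₊ := by
    rw [Nat.one_le_floor_iff]; nlinarith
  have hn1 : (n : ℝ) + 1 = ⌊(ratio T - 1) * b⌋₊ := by
    have : n + 1 = ⌊(ratio T - 1) * b⌋₊ := by omega
    exact_mod_cast this
  have hn2 : (n : ℝ) + 1 ≤ (ratio T - 1) * b := by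
    rw [hn1]; exact Nat.floor_le (by nlinarith)
  have hn3 : (ratio T - 1) * b < n + 1 + 1 := by
    rw [hn1]; exact Nat.lt_floor_add_one _
  set ρ : ℕ → ℝ := fun j => r + (j + 1) * d with hρ
  -- The full width of an annulus is smaller than the spacing by δ, which makes the annuli disjoint.
  have hwd : 2 * ((widthConst T + 2) * δ) = d - δ := by rw [hd, hsp]; ring
  have hδd : 3204 * δ ≤ d := by rw [hd, hsp]; nlinarith
  have hρr : ∀ j, r + d ≤ ρ j := fun j => by
    have : (0 : ℝ) ≤ j := Nat.cast_nonneg j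
    simp only [hρ]; nlinarith
  have hρR : ∀ j ∈ Finset.range n, ρ j + d ≤ ratio T * r := fun j hj => by
    have hj' : (j : ℝ) + 1 ≤ n := by exact_mod_cast Finset.mem_range.mp hj
    have : (j : ℝ) + 1 + 1 ≤ (ratio T - 1) * b := by linarith
    have := mul_le_mul_of_nonneg_right this hd0.le
    simp only [hρ]
    have e : (ratio T - 1) * b * d = ratio T * r - r := by rw [hrb]; ring
    linarith
  set Z : ℕ → Finset ℂ := fun j =>
    (Γ.vertsIn a (ρ j + d)).filter fun x => |dist x a - ρ j| ≤ (widthConst T + 2) * δ with hZ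
  have hZmem : ∀ j x, x ∈ Z j ↔ x ∈ Γ.verts ∧ |dist x a - ρ j| ≤ (widthConst T + 2) * δ := by
    intro j x
    simp only [hZ, Finset.mem_filter, IsoradialGraph.mem_vertsIn]
    constructor
    · rintro ⟨⟨h1, -⟩, h2⟩; exact ⟨h1, h2⟩
    · rintro ⟨h1, h2⟩
      exact ⟨⟨h1, by linarith [(abs_le.mp h2).2]⟩, h2⟩
  have hring : ∀ j ∈ Finset.range n, sepConst T ^ 2 * δ / (96 * T * degConst T * spacing T * ρ j) ≤
      ∑ p ∈ Γ.arcs (Z j), Γ.wt p.1 p.2 * (g p.1 - g p.2) ^ 2 := by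
    intro j hj
    have h1 := hρr j
    have h2 := hρR j hj
    obtain ⟨v, hv, hv1, hv2, hgv⟩ := hcon (ρ j) (by linarith) (by linarith)
    exact ring_energy_ge hT hsc ha h.eq_zero (by linarith) hv1 hv2 hgv (hZmem j)
  have hE := h.energy_le (by linarith) (by nlinarith)
  set R := ratio T * r with hR
  set B := Γ.vertsIn a (3 * R) with hB
  set F : ℂ × ℂ → ℝ := fun p => Γ.wt p.1 p.2 *
      (cutoffIn r (dist p.2 a) * cutoffOut R (dist p.2 a) * g p.2 -
        cutoffIn r (dist p.1 a) * cutoffOut R (dist p.1 a) * g p.1) ^ 2 with hF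
  have hE' : ∑ p ∈ B ×ˢ B, F p ≤ energyConst T := by
    rw [Finset.sum_product]; exact hE
  have hR0 : 0 < R := by nlinarith
  have hZin : ∀ j ∈ Finset.range n, ∀ x ∈ Z j, r ≤ dist x a ∧ dist x a ≤ R := by
    intro j hj x hx
    have h1 := hρr j
    have h2 := hρR j hj
    have h3 := abs_le.mp ((hZmem j x).mp hx).2
    constructor <;> linarith [h3.1, h3.2]
  have hdisj : ((Finset.range n : Finset ℕ) : Set ℕ).PairwiseDisjoint fun j => Γ.arcs (Z j) := by
    intro i hi j hj hij
    refine Finset.disjoint_left.mpr fun p hp hp' => ?_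
    have h1 := abs_le.mp ((hZmem i _).mp (IsoradialGraph.mem_arcs.mp hp).1).2
    have h2 := abs_le.mp ((hZmem j _).mp (IsoradialGraph.mem_arcs.mp hp').1).2
    have hij' : d ≤ |ρ i - ρ j| := by
      have e : ρ i - ρ j = ((i : ℤ) - (j : ℤ) : ℤ) * d := by simp only [hρ]; push_cast; ring
      rw [e, abs_mul, abs_of_pos hd0]
      have : (1 : ℤ) ≤ |(i : ℤ) - j| := Int.one_le_abs (sub_ne_zero.mpr (by exact_mod_cast hij))
      exact le_mul_of_one_le_left hd0.le (by exact_mod_cast this)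
    rcases le_abs.mp hij' with h3 | h3 <;> linarith [h1.1, h1.2, h2.1, h2.2]
  have hsum : ∑ j ∈ Finset.range n, ∑ p ∈ Γ.arcs (Z j), Γ.wt p.1 p.2 * (g p.1 - g p.2) ^ 2 ≤
      energyConst T := by
    calc _ = ∑ j ∈ Finset.range n, ∑ p ∈ Γ.arcs (Z j), F p := by
          refine Finset.sum_congr rfl fun j hj => Finset.sum_congr rfl fun p hp => ?_
          obtain ⟨hp1, hp2, -⟩ := IsoradialGraph.mem_arcs.mp hp
          have h1 := hZin j hj _ hp1
          have h2 := hZin j hj _ hp2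
          simp only [hF]
          rw [cutoffIn_eq_one hr0 h1.1, cutoffIn_eq_one hr0 h2.1, cutoffOut_eq_one hR0 h1.2,
            cutoffOut_eq_one hR0 h2.2]
          ring
      _ = ∑ p ∈ (Finset.range n).biUnion fun j => Γ.arcs (Z j), F p :=
          (Finset.sum_biUnion hdisj).symm
      _ ≤ ∑ p ∈ B ×ˢ B, F p := by
          refine Finset.sum_le_sum_of_subset_of_nonneg (fun p hp => ?_) fun p _ _ =>
            mul_nonneg (IsoradialGraph.wt_nonneg hT _ _) (sq_nonneg _)
          obtain ⟨j, hj, hp⟩ := Finset.mem_biUnion.mp hp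
          obtain ⟨hp1, hp2, -⟩ := IsoradialGraph.mem_arcs.mp hp
          have h1 := hZin j hj _ hp1
          have h2 := hZin j hj _ hp2
          exact Finset.mem_product.mpr
            ⟨IsoradialGraph.mem_vertsIn.mpr ⟨((hZmem j _).mp hp1).1, by linarith⟩,
              IsoradialGraph.mem_vertsIn.mpr ⟨((hZmem j _).mp hp2).1, by linarith⟩⟩
      _ ≤ energyConst T := hE'
  have hRC := ringConst_pos hT1
  have hlow : (ringConst T)⁻¹ * ∑ j ∈ Finset.range n, 1 / (b + (j + 1)) ≤ energyConst T := by
    refine le_trans ?_ hsum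
    rw [Finset.mul_sum]
    refine Finset.sum_le_sum fun j hj => le_trans (le_of_eq ?_) (hring j hj)
    have : ρ j = (b + (j + 1)) * (spacing T * δ) := by simp only [hρ, hrb, hd]; ring
    rw [this, ringConst]
    have : 0 < b + ((j : ℝ) + 1) := by positivity
    field_simp
  have hlog := log_le_sum_inv (b := b) (by linarith) n
  -- Since n + 2 > (ratio - 1)b and b ≥ 1, the quotient is at least (ratio - 1)/2. So the ring
  -- energies would sum to more than the total energy allows.
  have hlog2 : energyConst T * ringConst T + 1 ≤ Real.log ((b + n + 1) / (b + 1)) := by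
    rw [Real.le_log_iff_exp_le (by positivity), le_div_iff₀ (by positivity)]
    have : Real.exp (energyConst T * ringConst T + 1) = (ratio T - 1) / 2 := by
      unfold ratio; ring
    rw [this]
    nlinarith
  have h5 : ∑ j ∈ Finset.range n, 1 / (b + ((j : ℝ) + 1)) ≤ energyConst T * ringConst T := by
    rw [inv_mul_le_iff₀ hRC] at hlow
    linarith
  linarith

end DiscreteDomain

/-! ### One step of the random walk and the exit probabilities. -/

namespace IsoradialGraph

variable {δ : ℝ} {Γ : IsoradialGraph δ} {T : ℝ}

theorem tsum_weight (hT : Γ.CondBounded T) (u : ℂ) (F : ℂ → ℝ≥0∞) :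
    ∑' v, Γ.weight u v * F v = ∑ v ∈ nbrs hT u, ENNReal.ofReal (Γ.cond u v) * F v := by
  rw [tsum_eq_sum (s := nbrs hT u) fun v hv => by
    rw [weight, if_neg (fun h => hv (mem_nbrs.mpr h)), zero_mul]]
  refine Finset.sum_congr rfl fun v hv => ?_
  rw [weight, if_pos (mem_nbrs.mp hv), cond]

theorem sum_cond_pos (hT : Γ.CondBounded T) {u : ℂ} (hu : u ∈ Γ.verts) :
    0 < ∑ v ∈ nbrs hT u, Γ.cond u v := by
  obtain ⟨s, hs⟩ := exists_neighbor hT hu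
  exact Finset.sum_pos (fun v hv => hT.cond_pos (mem_nbrs.mp hv)) ⟨s, mem_nbrs.mpr hs⟩

theorem tsum_step (hT : Γ.CondBounded T) {u : ℂ} (hu : u ∈ Γ.verts) (F : ℂ → ℝ≥0∞) :
    ENNReal.ofReal (∑ v ∈ nbrs hT u, Γ.cond u v) * ∑' v, Γ.step u v * F v =
      ∑ v ∈ nbrs hT u, ENNReal.ofReal (Γ.cond u v) * F v := by
  have hpos := sum_cond_pos hT hu
  have hsum : ∑' v, Γ.weight u v = ENNReal.ofReal (∑ v ∈ nbrs hT u, Γ.cond u v) := by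
    have := tsum_weight hT u fun _ => 1
    simp only [mul_one] at this
    rw [this, ENNReal.ofReal_sum_of_nonneg fun v hv => (hT.cond_pos (mem_nbrs.mp hv)).le]
  have h0 : ∑' v, Γ.weight u v ≠ 0 := by rw [hsum]; simpa using hpos
  have htop : ∑' v, Γ.weight u v ≠ ∞ := by rw [hsum]; exact ENNReal.ofReal_ne_top
  rw [← tsum_weight hT u F, ← hsum, ← ENNReal.tsum_mul_left]
  refine tsum_congr fun v => ?_
  rw [step, dif_pos ⟨h0, htop⟩, PMF.normalize_apply]
  calc (∑' v, Γ.weight u v) * (Γ.weight u v * (∑' v, Γ.weight u v)⁻¹ * F v) =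
        ((∑' v, Γ.weight u v) * (∑' v, Γ.weight u v)⁻¹) * (Γ.weight u v * F v) := by ring
    _ = _ := by rw [ENNReal.mul_inv_cancel h0 htop, one_mul]

theorem walk_apply_eq_zero (n : ℕ) (u : ℂ) {x : Fin (n + 1) → ℂ} (hx : x 0 ≠ u) :
    Γ.walk n u x = 0 := by
  cases n with
  | zero =>
    rw [walk, PMF.pure_apply, if_neg]
    rintro rfl; exact hx rfl
  | succ n =>
    rw [PMF.apply_eq_zero_iff, walk, PMF.mem_support_bind_iff]
    rintro ⟨v, -, hv⟩
    rw [PMF.mem_support_map_iff] at hv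
    obtain ⟨y, -, rfl⟩ := hv
    exact hx rfl

end IsoradialGraph

namespace DiscreteDomain

variable {δ : ℝ} {Γ : IsoradialGraph δ} {T : ℝ} {Ω : DiscreteDomain Γ}

/-- The probability that the walk exits through `E` within `n` steps. -/
def exitProb (Ω : DiscreteDomain Γ) (E : Set (ℂ × ℂ)) (n : ℕ) (u : ℂ) : ℝ≥0∞ :=
  (Γ.walk n u).toOuterMeasure (Ω.exitEvent E n)

theorem exitProb_le_one (E : Set (ℂ × ℂ)) (n : ℕ) (u : ℂ) : Ω.exitProb E n u ≤ 1 := by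
  rw [exitProb, PMF.toOuterMeasure_apply]
  calc _ ≤ ∑' x, Γ.walk n u x := ENNReal.tsum_le_tsum fun x => Set.indicator_le_self _ _ _
    _ = 1 := PMF.tsum_coe _

theorem exitProb_zero (E : Set (ℂ × ℂ)) (u : ℂ) : Ω.exitProb E 0 u = 0 := by
  have : Ω.exitEvent E 0 = ∅ := by
    ext x
    simp only [exitEvent, mem_empty_iff_false, iff_false]
    rintro ⟨k, -⟩
    exact k.elim0
  rw [exitProb, this]; simp

theorem exitProb_eq_zero (E : Set (ℂ × ℂ)) (n : ℕ) {u : ℂ} (hu : u ∉ Ω.verts) :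
    Ω.exitProb E n u = 0 := by
  rw [exitProb, PMF.toOuterMeasure_apply, ENNReal.tsum_eq_zero]
  intro x
  by_cases hx : x ∈ Ω.exitEvent E n
  · rw [Set.indicator_of_mem hx]
    obtain ⟨k, hk, -⟩ := hx
    exact IsoradialGraph.walk_apply_eq_zero n u fun h0 => hu (h0 ▸ hk 0 (Fin.zero_le _))
  · exact Set.indicator_of_notMem hx _

-- Markov property at the first step: after a step to `v`, either the edge just crossed belongs to
-- `E`, or the remaining trajectory, which almost surely starts at `v`, has to make the exit. An
-- inequality is enough, because the harmonic measure is only used as a subharmonic function.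
open Classical in
theorem exitProb_succ_le (E : Set (ℂ × ℂ)) (n : ℕ) (u : ℂ) :
    Ω.exitProb E (n + 1) u ≤
      ∑' v, Γ.step u v * (if (v, u) ∈ E then 1 else Ω.exitProb E n v) := by
  rw [exitProb, IsoradialGraph.walk, PMF.toOuterMeasure_bind_apply]
  refine ENNReal.tsum_le_tsum fun v => ?_
  gcongr
  rw [PMF.toOuterMeasure_map_apply]
  split_ifs with hE
  · rw [PMF.toOuterMeasure_apply]
    calc _ ≤ ∑' x, Γ.walk n v x := ENNReal.tsum_le_tsum fun x => Set.indicator_le_self _ _ _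
      _ = 1 := PMF.tsum_coe _
  · rw [exitProb, PMF.toOuterMeasure_apply, PMF.toOuterMeasure_apply]
    refine ENNReal.tsum_le_tsum fun x => ?_
    by_cases hx0 : x 0 = v
    · by_cases hx : x ∈ Fin.cons u ⁻¹' Ω.exitEvent E (n + 1)
      · have hx' : x ∈ Ω.exitEvent E n := by
          obtain ⟨k, hk, hkE⟩ := hx
          induction k using Fin.cases with
          | zero =>
            refine absurd ?_ hE
            simpa [hx0] using hkE
          | succ j =>
            refine ⟨j, fun i hi => ?_, ?_⟩
            · have := hk i.succ (by rw [Fin.castSucc_succ]; exact Fin.succ_le_succ_iff.mpr hi)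
              simpa using this
            · rw [Fin.castSucc_succ] at hkE
              simpa using hkE
        rw [Set.indicator_of_mem hx, Set.indicator_of_mem hx']
      · rw [Set.indicator_of_notMem hx]
        exact zero_le
    · rw [Set.indicator_apply, IsoradialGraph.walk_apply_eq_zero n v hx0]
      simp

end DiscreteDomain

/-! ### Harmonic measure: maximum principle and decay over scales. -/

namespace DiscreteDomain

variable {δ : ℝ} {Γ : IsoradialGraph δ} {T : ℝ} {Ω : DiscreteDomain Γ}

/-- The harmonic measure as a real number. -/
def hm (Ω : DiscreteDomain Γ) (E : Set (ℂ × ℂ)) (u : ℂ) : ℝ := (Ω.harmonicMeasure u E).toReal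

theorem harmonicMeasure_eq_iSup (E : Set (ℂ × ℂ)) (u : ℂ) :
    Ω.harmonicMeasure u E = ⨆ n, Ω.exitProb E n u := rfl

theorem harmonicMeasure_le_one (E : Set (ℂ × ℂ)) (u : ℂ) : Ω.harmonicMeasure u E ≤ 1 :=
  iSup_le fun n => exitProb_le_one E n u

theorem ofReal_hm (E : Set (ℂ × ℂ)) (u : ℂ) :
    ENNReal.ofReal (Ω.hm E u) = Ω.harmonicMeasure u E :=
  ENNReal.ofReal_toReal (ne_top_of_le_ne_top ENNReal.one_ne_top (harmonicMeasure_le_one E u))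

theorem hm_nonneg (E : Set (ℂ × ℂ)) (u : ℂ) : 0 ≤ Ω.hm E u := ENNReal.toReal_nonneg

theorem hm_le_one (E : Set (ℂ × ℂ)) (u : ℂ) : Ω.hm E u ≤ 1 :=
  ENNReal.toReal_mono ENNReal.one_ne_top (harmonicMeasure_le_one E u)

theorem hm_eq_zero (E : Set (ℂ × ℂ)) {u : ℂ} (hu : u ∉ Ω.verts) : Ω.hm E u = 0 := by
  rw [hm, harmonicMeasure_eq_iSup]
  simp [exitProb_eq_zero E _ hu]

theorem exitProb_toReal_le_hm (E : Set (ℂ × ℂ)) (n : ℕ) (u : ℂ) :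
    (Ω.exitProb E n u).toReal ≤ Ω.hm E u :=
  ENNReal.toReal_mono (ne_top_of_le_ne_top ENNReal.one_ne_top (harmonicMeasure_le_one E u))
    (le_iSup (fun n => Ω.exitProb E n u) n)

theorem hm_le_of_forall {E : Set (ℂ × ℂ)} {u : ℂ} {x : ℝ} (hx : 0 ≤ x)
    (h : ∀ n, (Ω.exitProb E n u).toReal ≤ x) : Ω.hm E u ≤ x := by
  refine ENNReal.toReal_le_of_le_ofReal hx (iSup_le fun n => ?_)
  change Ω.exitProb E n u ≤ ENNReal.ofReal x
  rw [← ENNReal.ofReal_toReal (ne_top_of_le_ne_top ENNReal.one_ne_top (exitProb_le_one E n u))]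
  exact ENNReal.ofReal_le_ofReal (h n)

theorem sum_cond_mul_exitProb_le (hT : Γ.CondBounded T) (E : Set (ℂ × ℂ)) (n : ℕ) {u : ℂ}
    (hu : u ∈ Ω.verts) {B : ℂ → ℝ} (hB0 : ∀ v, 0 ≤ B v)
    (hE : ∀ v, Γ.graph.Adj u v → (v, u) ∉ E)
    (hB : ∀ v, Γ.graph.Adj u v → (Ω.exitProb E n v).toReal ≤ B v) :
    (∑ v ∈ IsoradialGraph.nbrs hT u, Γ.cond u v) * (Ω.exitProb E (n + 1) u).toReal ≤
      ∑ v ∈ IsoradialGraph.nbrs hT u, Γ.cond u v * B v := by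
  classical
  have hpos := IsoradialGraph.sum_cond_pos hT (Ω.verts_subset hu)
  have hc : ∀ v ∈ IsoradialGraph.nbrs hT u, 0 ≤ Γ.cond u v := fun v hv =>
    (hT.cond_pos (IsoradialGraph.mem_nbrs.mp hv)).le
  have hfin := ne_top_of_le_ne_top ENNReal.one_ne_top (Ω.exitProb_le_one E (n + 1) u)
  rw [← ENNReal.ofReal_le_ofReal_iff
    (Finset.sum_nonneg fun v hv => mul_nonneg (hc v hv) (hB0 v)), ENNReal.ofReal_mul hpos.le,
    ENNReal.ofReal_toReal hfin,
    ENNReal.ofReal_sum_of_nonneg fun v hv => mul_nonneg (hc v hv) (hB0 v)]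
  refine (mul_le_mul_right (exitProb_succ_le E n u) _).trans ?_
  rw [IsoradialGraph.tsum_step hT (Ω.verts_subset hu)]
  refine Finset.sum_le_sum fun v hv => ?_
  have hadj := IsoradialGraph.mem_nbrs.mp hv
  rw [if_neg (hE v hadj), ENNReal.ofReal_mul (hc v hv)]
  gcongr
  rw [← ENNReal.ofReal_toReal (ne_top_of_le_ne_top ENNReal.one_ne_top (exitProb_le_one E n v))]
  exact ENNReal.ofReal_le_ofReal (hB v hadj)

theorem hm_subharmonic (hT : Γ.CondBounded T) {E : Set (ℂ × ℂ)} {u : ℂ} (hu : u ∈ Ω.verts)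
    (hE : ∀ v, Γ.graph.Adj u v → (v, u) ∉ E) :
    0 ≤ ∑ v ∈ IsoradialGraph.nbrs hT u, Γ.cond u v * (Ω.hm E v - Ω.hm E u) := by
  have hpos := IsoradialGraph.sum_cond_pos hT (Ω.verts_subset hu)
  have hc : ∀ v ∈ IsoradialGraph.nbrs hT u, 0 ≤ Γ.cond u v := fun v hv =>
    (hT.cond_pos (IsoradialGraph.mem_nbrs.mp hv)).le
  have h0 : 0 ≤ ∑ v ∈ IsoradialGraph.nbrs hT u, Γ.cond u v * Ω.hm E v :=
    Finset.sum_nonneg fun v hv => mul_nonneg (hc v hv) (hm_nonneg E v)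
  have h1 : Ω.hm E u ≤ (∑ v ∈ IsoradialGraph.nbrs hT u, Γ.cond u v * Ω.hm E v) /
      ∑ v ∈ IsoradialGraph.nbrs hT u, Γ.cond u v := by
    refine hm_le_of_forall (div_nonneg h0 hpos.le) fun n => ?_
    rw [le_div_iff₀ hpos, mul_comm]
    cases n with
    | zero => rw [exitProb_zero]; simpa using h0
    | succ n =>
      exact sum_cond_mul_exitProb_le hT E n hu (hm_nonneg E) hE
        fun v _ => exitProb_toReal_le_hm E n v
  rw [le_div_iff₀ hpos] at h1
  simp only [mul_sub, Finset.sum_sub_distrib, ← Finset.sum_mul]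
  linarith

/-- Maximum principle for the harmonic measure, on possibly infinite sets. -/
theorem hm_le_of_exit (hT : Γ.CondBounded T) {E : Set (ℂ × ℂ)} {A : Set ℂ} {B : ℝ} (hB : 0 ≤ B)
    (hA : A ⊆ Ω.verts)
    (h : ∀ v ∈ A, ∀ s, Γ.graph.Adj v s → (s, v) ∉ E ∧ (s ∈ A ∨ Ω.hm E s ≤ B)) :
    ∀ v ∈ A, Ω.hm E v ≤ B := by
  -- Induction on the number of steps, starting from probability 0, avoids any finiteness of `A` and
  -- any recurrence of the walk.
  have key : ∀ n, ∀ v ∈ A, (Ω.exitProb E n v).toReal ≤ B := by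
    intro n
    induction n with
    | zero => intro v _; rw [exitProb_zero]; simpa using hB
    | succ n ih =>
      intro v hv
      have h1 := sum_cond_mul_exitProb_le hT E n (hA hv) (B := fun _ => B) (fun _ => hB)
        (fun s hs => (h v hv s hs).1) (fun s hs => by
          rcases (h v hv s hs).2 with hsA | hsB
          · exact ih s hsA
          · exact (exitProb_toReal_le_hm E n s).trans hsB)
      rw [← Finset.sum_mul] at h1
      exact le_of_mul_le_mul_left h1 (IsoradialGraph.sum_cond_pos hT (Ω.verts_subset (hA hv)))
  exact fun v hv => hm_le_of_forall hB fun n => key n v hv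

/-- The ratio between consecutive scales. -/
def scale (T : ℝ) : ℝ := 4 * ratio T

theorem scale_ge {T : ℝ} (hT : 1 ≤ T) : 20 ≤ scale T := by
  have := ratio_ge hT
  unfold scale; linarith

/-- Decay of the harmonic measure when the walk has to go far away from an exterior point. -/
theorem hm_le_outward (hT : Γ.CondBounded T) (hsc : IsSimplyConnected Ω.region) {a : ℂ}
    (ha : a ∉ Ω.region) {E : Set (ℂ × ℂ)} {A : Set ℂ} {R : ℝ} (hA : A ⊆ Ω.verts)
    (h : ∀ v ∈ A, dist v a < R → ∀ s, Γ.graph.Adj v s → (s, v) ∉ E ∧ (s ∈ A ∨ s ∉ Ω.verts))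
    (k : ℕ) : ∀ r, spacing T * δ ≤ r → scale T ^ k * r ≤ R →
      ∀ v ∈ A, dist v a ≤ r → Ω.hm E v ≤ (1 / 2) ^ k := by
  classical
  have hδ := Γ.mesh_pos
  have hT1 := hT.one_le
  have hΛ := ratio_ge hT1
  have hW := widthConst_ge hT1
  induction k with
  | zero => intro r _ _ v _ _; simpa using hm_le_one E v
  | succ k ih =>
    intro r hr hrR v hv hvr
    have hsp : 3200 ≤ spacing T := by unfold spacing; linarith
    have hr0 : 3200 * δ ≤ r := le_trans (by gcongr) hr
    have hrpos : 0 < r := by linarith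
    have hsr : r ≤ scale T * r := le_mul_of_one_le_left hrpos.le (by linarith [scale_ge hT1])
    have hih := ih (scale T * r) (hr.trans hsr) (by rw [← mul_assoc, ← pow_succ]; exact hrR)
    have hpow1 : (1 : ℝ) ≤ scale T ^ k := one_le_pow₀ (by linarith [scale_ge hT1])
    have hsR : scale T * r ≤ R := by
      refine le_trans ?_ hrR
      rw [pow_succ, mul_assoc]
      exact le_mul_of_one_le_left (by linarith) hpow1
    have hscale : scale T * r = 4 * (ratio T * r) := by unfold scale; ring
    -- Neighbours of `A` lie in `A` or outside the domain, where the harmonic measure vanishes, so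
    -- cutting it off outside `A` preserves subharmonicity. The factor `2 ^ k` normalizes the bound
    -- to 1, which is needed up to radius `4 * ratio T * r`, the radius of the induction hypothesis.
    set g : ℂ → ℝ := fun v => if v ∈ A then 2 ^ k * Ω.hm E v else 0 with hg
    have h2k : (0 : ℝ) < 2 ^ k := by positivity
    have hgA : ∀ v ∈ A, g v = 2 ^ k * Ω.hm E v := fun v hv => by simp [hg, hv]
    have hgA' : ∀ v ∉ A, g v = 0 := fun v hv => by simp [hg, hv]
    have hg0 : ∀ v, 0 ≤ g v := fun v => by
      by_cases hvA : v ∈ A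
      · rw [hgA v hvA]; exact mul_nonneg h2k.le (hm_nonneg E v)
      · rw [hgA' v hvA]
    have hsub : SubharmonicIn hT Ω a r (ratio T * r) g := by
      refine ⟨hg0, fun v hv => hgA' v fun hvA => hv (hA hvA), fun v _ _ hvR => ?_,
        fun v _ _ hvR => ?_⟩
      · by_cases hvA : v ∈ A
        · rw [hgA v hvA]
          have := hih v hvA (by linarith)
          calc 2 ^ k * Ω.hm E v ≤ 2 ^ k * (1 / 2) ^ k := by gcongr
            _ = 1 := by rw [← mul_pow]; norm_num
        · rw [hgA' v hvA]; exact zero_le_one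
      · have hc : ∀ s ∈ IsoradialGraph.nbrs hT v, 0 ≤ Γ.cond v s := fun s hs =>
          (hT.cond_pos (IsoradialGraph.mem_nbrs.mp hs)).le
        by_cases hvA : v ∈ A
        · have hh := h v hvA (by nlinarith)
          have h1 := hm_subharmonic hT (hA hvA) fun s hs => (hh s hs).1
          have e : ∑ s ∈ IsoradialGraph.nbrs hT v, Γ.cond v s * (g s - g v) =
              2 ^ k * ∑ s ∈ IsoradialGraph.nbrs hT v, Γ.cond v s * (Ω.hm E s - Ω.hm E v) := by
            rw [Finset.mul_sum]
            refine Finset.sum_congr rfl fun s hs => ?_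
            have : g s = 2 ^ k * Ω.hm E s := by
              rcases (hh s (IsoradialGraph.mem_nbrs.mp hs)).2 with hsA | hsV
              · exact hgA s hsA
              · rw [hgA' s fun hsA => hsV (hA hsA), hm_eq_zero E hsV, mul_zero]
            rw [this, hgA v hvA]; ring
          rw [e]
          exact mul_nonneg h2k.le h1
        · rw [hgA' v hvA]
          exact Finset.sum_nonneg fun s hs => mul_nonneg (hc s hs) (by linarith [hg0 s])
    obtain ⟨ρ, hρr, hρR, hring⟩ := hsub.exists_ring hT hsc ha hr
    have hring' : ∀ s ∈ A, ρ ≤ dist s a → dist s a ≤ ρ + 2 * δ → Ω.hm E s ≤ (1 / 2) ^ (k + 1) := by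
      intro s hs h1 h2
      have := hring s (hA hs) h1 h2
      rw [hgA s hs] at this
      have h3 : (1 / 2 : ℝ) ^ (k + 1) = (1 / 2) / 2 ^ k := by
        rw [pow_succ, one_div_pow]; field_simp
      rw [h3, le_div_iff₀ h2k]
      linarith
    by_cases hvρ : dist v a < ρ
    -- Edges are shorter than 2δ, the thickness of the ring, so the walk cannot jump over it.
    · refine hm_le_of_exit hT (A := {v | v ∈ A ∧ dist v a < ρ}) (by positivity)
        (fun v hv => hA hv.1) (fun w hw s hs => ?_) v ⟨hv, hvρ⟩
      obtain ⟨h1, h2⟩ := h w hw.1 (by linarith [hw.2]) s hs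
      refine ⟨h1, ?_⟩
      rcases h2 with hsA | hsV
      · by_cases hsρ : dist s a < ρ
        · exact Or.inl ⟨hsA, hsρ⟩
        · refine Or.inr (hring' s hsA (not_lt.mp hsρ) ?_)
          have h3 := dist_triangle s w a
          have h4 := hT.dist_lt hs
          rw [dist_comm] at h4
          linarith [hw.2]
      · exact Or.inr (by rw [hm_eq_zero E hsV]; positivity)
    · exact hring' v hv (not_lt.mp hvρ) (by linarith)

/-- Decay of the harmonic measure of a set near an exterior point. -/
theorem hm_le_inward (hT : Γ.CondBounded T) (hsc : IsSimplyConnected Ω.region) {a : ℂ}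
    (ha : a ∉ Ω.region) {E : Set (ℂ × ℂ)} {r₀ : ℝ} (hr₀ : spacing T * δ ≤ r₀)
    (hE : ∀ p ∈ E, dist p.1 a ≤ r₀) (k : ℕ) :
    ∀ v ∈ Ω.verts, scale T ^ k * r₀ ≤ dist v a → Ω.hm E v ≤ (1 / 2) ^ k := by
  have hδ := Γ.mesh_pos
  have hT1 := hT.one_le
  have hΛ := ratio_ge hT1
  have hW := widthConst_ge hT1
  have hsp : 3200 ≤ spacing T := by unfold spacing; linarith
  have hr0 : 3200 * δ ≤ r₀ := le_trans (by gcongr) hr₀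
  have hEfar : ∀ v, 2 * r₀ ≤ dist v a → ∀ s, Γ.graph.Adj v s → (s, v) ∉ E := by
    intro v hv s hs hsE
    have h1 := hE _ hsE
    have h2 := dist_triangle v s a
    have h3 := hT.dist_lt hs
    simp only at h1
    linarith
  induction k with
  | zero => intro v _ _; simpa using hm_le_one E v
  | succ k ih =>
    intro v hv hvr
    -- With this radius the zone `r / 4 < dist v a` is where the induction hypothesis holds, and
    -- `ratio T * r` is the next scale.
    set r := 4 * (scale T ^ k * r₀) with hr
    have hpow1 : (1 : ℝ) ≤ scale T ^ k := one_le_pow₀ (by linarith [scale_ge hT1])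
    have hr0r : 4 * r₀ ≤ r := by
      have : r₀ ≤ scale T ^ k * r₀ := le_mul_of_one_le_left (by linarith) hpow1
      linarith
    have h2k : (0 : ℝ) < 2 ^ k := by positivity
    have hRe : ratio T * r = scale T ^ (k + 1) * r₀ := by rw [hr, pow_succ, scale]; ring
    have hsub : SubharmonicIn hT Ω a r (ratio T * r) fun v => 2 ^ k * Ω.hm E v := by
      refine ⟨fun v => mul_nonneg h2k.le (hm_nonneg E v), fun v hv => ?_, fun v hv hvr' _ => ?_,
        fun v hv hvr' _ => ?_⟩
      · simp only [hm_eq_zero E hv, mul_zero]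
      · have := ih v hv (by linarith)
        calc 2 ^ k * Ω.hm E v ≤ 2 ^ k * (1 / 2) ^ k := by gcongr
          _ = 1 := by rw [← mul_pow]; norm_num
      · have h1 := hm_subharmonic hT hv (hEfar v (by linarith))
        have e : ∑ s ∈ IsoradialGraph.nbrs hT v, Γ.cond v s * (2 ^ k * Ω.hm E s - 2 ^ k * Ω.hm E v) =
            2 ^ k * ∑ s ∈ IsoradialGraph.nbrs hT v, Γ.cond v s * (Ω.hm E s - Ω.hm E v) := by
          rw [Finset.mul_sum]
          exact Finset.sum_congr rfl fun s _ => by ring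
        rw [e]
        exact mul_nonneg h2k.le h1
    obtain ⟨ρ, hρr, hρR, hring⟩ := hsub.exists_ring hT hsc ha (by linarith)
    have hring' : ∀ s ∈ Ω.verts, ρ ≤ dist s a → dist s a ≤ ρ + 2 * δ →
        Ω.hm E s ≤ (1 / 2) ^ (k + 1) := by
      intro s hs h1 h2
      have := hring s hs h1 h2
      have h3 : (1 / 2 : ℝ) ^ (k + 1) = (1 / 2) / 2 ^ k := by
        rw [pow_succ, one_div_pow]; field_simp
      rw [h3, le_div_iff₀ h2k]
      linarith
    by_cases hvρ : ρ + 2 * δ < dist v a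
    · refine hm_le_of_exit hT (A := {v | v ∈ Ω.verts ∧ ρ + 2 * δ < dist v a}) (by positivity)
        (fun v hv => hv.1) (fun w hw s hs => ?_) v ⟨hv, hvρ⟩
      have hw2 := hw.2
      refine ⟨hEfar w (by linarith) s hs, ?_⟩
      by_cases hsV : s ∈ Ω.verts
      · by_cases hsρ : ρ + 2 * δ < dist s a
        · exact Or.inl ⟨hsV, hsρ⟩
        · refine Or.inr (hring' s hsV ?_ (not_lt.mp hsρ))
          have h3 := dist_triangle w s a
          have h4 := hT.dist_lt hs
          linarith
      · exact Or.inr (by rw [hm_eq_zero E hsV]; positivity)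
    · exact hring' v hv (by linarith) (not_lt.mp hvρ)

end DiscreteDomain

/-! ### From geometric decay to a power. -/

/-- Geometric decay over the scales `Q ^ k` is power decay. -/
theorem le_two_mul_div_rpow {Q h x R : ℝ} (hQ : 1 < Q) (hx : 0 < x) (hR : 0 < R) (h1 : h ≤ 1)
    (H : ∀ k : ℕ, Q ^ k * x ≤ R → h ≤ (1 / 2) ^ k) :
    h ≤ 2 * (x / R) ^ (Real.log 2 / Real.log Q) := by
  have hlQ : 0 < Real.log Q := Real.log_pos hQ
  have hl2 : 0 < Real.log 2 := Real.log_pos one_lt_two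
  have hβ : 0 < Real.log 2 / Real.log Q := div_pos hl2 hlQ
  rcases lt_or_ge R x with hRx | hxR
  · have := Real.one_le_rpow ((one_le_div hR).mpr hRx.le) hβ.le
    linarith
  have ht : 0 ≤ Real.log (R / x) := Real.log_nonneg ((one_le_div hx).mpr hxR)
  set y := Real.log (R / x) / Real.log Q with hy
  -- The largest admissible number of scales; rounding down costs the factor 2.
  have hk := H ⌊y⌋₊ (by
    rw [← le_div_iff₀ hx, ← Real.log_le_log_iff (by positivity) (by positivity), Real.log_pow,
      ← le_div_iff₀ hlQ]
    exact Nat.floor_le (div_nonneg ht hlQ.le))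
  have h2 := (Nat.lt_floor_add_one y).le
  refine hk.trans ?_
  have e : (x / R) ^ (Real.log 2 / Real.log Q) = Real.exp (-(y * Real.log 2)) := by
    rw [Real.rpow_def_of_pos (by positivity), ← inv_div R x, Real.log_inv, hy]
    congr 1; ring
  have e2 : ((1 : ℝ) / 2) ^ ⌊y⌋₊ = Real.exp (-(⌊y⌋₊ * Real.log 2)) := by
    rw [Real.exp_neg, Real.exp_nat_mul, Real.exp_log two_pos, one_div, inv_pow]
  rw [e, e2]
  calc Real.exp (-(⌊y⌋₊ * Real.log 2)) ≤ Real.exp (Real.log 2 + -(y * Real.log 2)) :=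
        Real.exp_le_exp.mpr (by nlinarith)
    _ = 2 * Real.exp (-(y * Real.log 2)) := by rw [Real.exp_add, Real.exp_log two_pos]

/-- The radius R = I/2 is strictly below the inner distance, hence the 2c. For I = ∞ every `k` is
admissible and `h` vanishes or is negative; for I = 0 the right-hand side is infinite. -/
theorem ofReal_le_mul_div_rpow {Q h c : ℝ} (hQ : 1 < Q) (hc : 0 < c) (h1 : h ≤ 1) {D I : ℝ≥0∞}
    (hD0 : D ≠ 0) (hD : D ≠ ∞)
    (H : ∀ R : ℝ, 0 < R → ENNReal.ofReal R < I →
      ∀ k : ℕ, Q ^ k * (c * D.toReal) ≤ R → h ≤ (1 / 2) ^ k) :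
    ENNReal.ofReal h ≤ ((2 * (2 * c) ^ (Real.log 2 / Real.log Q)).toNNReal : ℝ≥0∞) *
      (D / I) ^ (Real.log 2 / Real.log Q) := by
  have hβ : 0 < Real.log 2 / Real.log Q :=
    div_pos (Real.log_pos one_lt_two) (Real.log_pos hQ)
  set β := Real.log 2 / Real.log Q with hβdef
  have hd : 0 < D.toReal := ENNReal.toReal_pos hD0 hD
  have hC : 0 < 2 * (2 * c) ^ β := by positivity
  rcases eq_or_ne I ∞ with rfl | hI
  · have : h ≤ 0 := by
      refine ge_of_tendsto' (tendsto_pow_atTop_nhds_zero_of_lt_one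
        (by norm_num : (0 : ℝ) ≤ 1 / 2) (by norm_num)) fun k => ?_
      exact H _ (by positivity) ENNReal.ofReal_lt_top k le_rfl
    rw [ENNReal.ofReal_of_nonpos this]
    exact zero_le
  rcases eq_or_ne I 0 with rfl | hI0
  · rw [ENNReal.div_zero hD0, ENNReal.top_rpow_of_pos hβ, ENNReal.mul_top]
    · exact le_top
    · simpa using hC
  have hi : 0 < I.toReal := ENNReal.toReal_pos hI0 hI
  have hlt : ENNReal.ofReal (I.toReal / 2) < I := by
    rw [ENNReal.ofReal_lt_iff_lt_toReal (by positivity) hI]; linarith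
  have h2 := le_two_mul_div_rpow hQ (x := c * D.toReal) (R := I.toReal / 2) (by positivity)
    (by positivity) h1 (H _ (by positivity) hlt)
  rw [← hβdef] at h2
  have e : c * D.toReal / (I.toReal / 2) = 2 * c * (D.toReal / I.toReal) := by field_simp
  rw [e, Real.mul_rpow (by positivity) (by positivity), ← mul_assoc] at h2
  refine (ENNReal.ofReal_le_ofReal h2).trans ?_
  rw [ENNReal.ofReal_mul hC.le, ← ENNReal.ofReal_rpow_of_nonneg (by positivity) hβ.le,
    ENNReal.ofReal_div_of_pos hi, ENNReal.ofReal_toReal hD, ENNReal.ofReal_toReal hI]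
  rfl

/-- The constant comparing the smallest admissible scale with the distance between vertices. -/
def dilation (T : ℝ) : ℝ := spacing T / sepConst T

theorem dilation_mul_sepConst (T : ℝ) : dilation T * sepConst T = spacing T :=
  div_mul_cancel₀ _ (sepConst_pos T).ne'

theorem dilation_ge {T : ℝ} (hT : 1 ≤ T) : 3200 ≤ dilation T := by
  have h1 := widthConst_ge hT
  have h2 := sepConst_le_one hT
  have h3 := sepConst_pos T
  rw [dilation, le_div_iff₀ h3]
  unfold spacing
  nlinarith

/-! ### The two estimates. -/

namespace DiscreteDomain

variable {δ : ℝ} {Γ : IsoradialGraph δ} {T : ℝ} {Ω : DiscreteDomain Γ}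

/-- The interior vertices that are connected to `u` in the part of the domain lying in a disc. -/
def accessible (Ω : DiscreteDomain Γ) (u : ℂ) (R : ℝ) : Set ℂ :=
  {v | Relation.ReflTransGen
    (fun x y => Γ.graph.Adj x y ∧ openSegment ℝ x y ∈ Ω.edges ∧
      x ∈ Ω.verts ∩ Metric.ball u R ∧ y ∈ Ω.verts ∩ Metric.ball u R) u v}

theorem mem_accessible_self (Ω : DiscreteDomain Γ) (u : ℂ) (R : ℝ) : u ∈ Ω.accessible u R :=
  Relation.ReflTransGen.refl

theorem accessible_subset {u : ℂ} (hu : u ∈ Ω.verts) {R : ℝ} (hR : 0 < R) :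
    Ω.accessible u R ⊆ Ω.verts ∩ Metric.ball u R := by
  intro v hv
  rcases Relation.ReflTransGen.cases_tail hv with rfl | ⟨w, _, hw⟩
  · exact ⟨hu, Metric.mem_ball_self hR⟩
  · exact hw.2.2.2

theorem mem_accessible_of_adj {u : ℂ} (hu : u ∈ Ω.verts) {R : ℝ} (hR : 0 < R) {v s : ℂ}
    (hv : v ∈ Ω.accessible u R) (hs : Γ.graph.Adj v s) (hsV : s ∈ Ω.verts)
    (hsR : s ∈ Metric.ball u R) : s ∈ Ω.accessible u R := by
  have hvV := accessible_subset hu hR hv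
  exact Relation.ReflTransGen.tail hv ⟨hs, openSegment_mem_edges hvV.1 hs, hvV, hsV, hsR⟩

theorem notMem_of_not_connectedInBall {u : ℂ} (hu : u ∈ Ω.verts) {R : ℝ} (hR : 0 < R)
    {E : Set (ℂ × ℂ)} (hE : ¬Ω.ConnectedInBall u E R) {v s : ℂ} (hv : v ∈ Ω.accessible u R)
    (hs : s ∈ Metric.ball u R) : (s, v) ∉ E := fun h =>
  hE ⟨(s, v), h, ⟨hu, Metric.mem_ball_self hR⟩, hs, hv⟩

theorem fst_mem_verts {p : ℂ × ℂ} (hp : p ∈ Ω.boundary) : p.1 ∈ Γ.verts :=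
  PlaneGraph.mem_verts_right hp.1

theorem fst_notMem_region {p : ℂ × ℂ} (hp : p ∈ Ω.boundary) : p.1 ∉ Ω.region :=
  notMem_region (fst_mem_verts hp) hp.2.2.2

theorem sepConst_mul_le_dist_fst (hT : Γ.CondBounded T) {u : ℂ} (hu : u ∈ Ω.verts) {p : ℂ × ℂ}
    (hp : p ∈ Ω.boundary) : sepConst T * δ ≤ dist u p.1 :=
  IsoradialGraph.le_dist_of_mem_verts hT (Ω.verts_subset hu) (fst_mem_verts hp)
    fun h => hp.2.2.2 (h ▸ hu)

theorem spacing_mul_le {T δ d : ℝ} (hT : 1 ≤ T) (hd : sepConst T * δ ≤ d) :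
    spacing T * δ ≤ dilation T * d := by
  have := dilation_ge hT
  rw [← dilation_mul_sepConst, mul_assoc]
  gcongr

/-- Outward decay around the boundary vertex `p.1`, applied to the part of the domain accessible
from `u` within `B(u, R)`. While the walk is within R - d - 2δ of `p.1`, its next position is still
in `B(u, R)`, so it cannot exit through `E`. The factor 3 absorbs d and 2δ. -/
theorem hm_le_of_dist_boundary (hT : Γ.CondBounded T) (hsc : IsSimplyConnected Ω.region) {u : ℂ}
    (hu : u ∈ Ω.verts) {E : Set (ℂ × ℂ)} {R : ℝ} (hR : 0 < R) (hE : ¬Ω.ConnectedInBall u E R)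
    {p : ℂ × ℂ} (hp : p ∈ Ω.boundary) {k : ℕ}
    (hk : scale T ^ k * (3 * (dilation T * dist u p.1)) ≤ R) : Ω.hm E u ≤ (1 / 2) ^ k := by
  have hδ := Γ.mesh_pos
  have hsep := sepConst_mul_le_dist_fst hT hu hp
  have hsp := spacing_mul_le hT.one_le hsep
  have hdil := dilation_ge hT.one_le
  have hs3 : 3200 ≤ spacing T := by
    have := widthConst_ge hT.one_le
    unfold spacing; linarith
  set d := dist u p.1 with hd
  have hd0 : 0 ≤ d := dist_nonneg
  have hdd : d ≤ dilation T * d := le_mul_of_one_le_left hd0 (by linarith)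
  have hδd : 3200 * δ ≤ dilation T * d := le_trans (by gcongr) hsp
  have hpow : (1 : ℝ) ≤ scale T ^ k := one_le_pow₀ (by linarith [scale_ge hT.one_le])
  have hpd : dilation T * d ≤ scale T ^ k * (dilation T * d) :=
    le_mul_of_one_le_left (by linarith) hpow
  have hsub := accessible_subset hu hR
  refine hm_le_outward hT hsc (fst_notMem_region hp) (A := Ω.accessible u R)
    (R := R - d - 2 * δ) (fun v hv => (hsub hv).1) (fun v hv hvR s hs => ?_) k
    (dilation T * d) hsp (by linarith) u (mem_accessible_self Ω u R) hdd
  have hsR : s ∈ Metric.ball u R := by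
    have h1 := dist_triangle s v u
    have h2 := dist_triangle v p.1 u
    have h3 := hT.dist_lt hs
    rw [dist_comm] at h3
    rw [dist_comm p.1 u] at h2
    rw [Metric.mem_ball]; linarith
  refine ⟨notMem_of_not_connectedInBall hu hR hE hv hsR, ?_⟩
  by_cases hsV : s ∈ Ω.verts
  · exact Or.inl (mem_accessible_of_adj hu hR hv hs hsV hsR)
  · exact Or.inr hsV

/-- Inward decay settles all vertices at distance at least R/2 from `a`. If `u` is closer, then `E`
lies in `B(u, R)` and is not connected to `u` there. So a walk that stays in the domain must first
leave `B(u, R)`, and lands at distance at least R/2 from `a`. -/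
theorem hm_le_of_diam (hT : Γ.CondBounded T) (hsc : IsSimplyConnected Ω.region) {u : ℂ}
    (hu : u ∈ Ω.verts) {E : Set (ℂ × ℂ)} {R : ℝ} (hR : 0 < R) (hE : ¬Ω.ConnectedInBall u E R)
    {a : ℂ} (ha : a ∉ Ω.region) {d : ℝ} (hd : sepConst T * δ ≤ d) (hEd : ∀ p ∈ E, dist p.1 a ≤ d)
    {k : ℕ} (hk : scale T ^ k * (2 * (dilation T * d)) ≤ R) : Ω.hm E u ≤ (1 / 2) ^ k := by
  have hδ := Γ.mesh_pos
  have hsp := spacing_mul_le hT.one_le hd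
  have hdil := dilation_ge hT.one_le
  have hd0 : 0 ≤ d := le_trans (mul_nonneg (sepConst_pos T).le hδ.le) hd
  have hdd : 3200 * d ≤ dilation T * d := by gcongr
  have hpow : (1 : ℝ) ≤ scale T ^ k := one_le_pow₀ (by linarith [scale_ge hT.one_le])
  have hpd : dilation T * d ≤ scale T ^ k * (dilation T * d) :=
    le_mul_of_one_le_left (by linarith) hpow
  have hsub := accessible_subset hu hR
  have hfar : ∀ v ∈ Ω.verts, R / 2 ≤ dist v a → Ω.hm E v ≤ (1 / 2) ^ k := fun v hv hva =>
    hm_le_inward hT hsc ha hsp (fun p hp => (hEd p hp).trans (by linarith)) k v hv (by linarith)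
  rcases le_or_gt (R / 2) (dist u a) with hua | hua
  · exact hfar u hu hua
  refine hm_le_of_exit hT (A := Ω.accessible u R) (by positivity) (fun v hv => (hsub hv).1)
    (fun v hv s hs => ⟨fun hsE => ?_, ?_⟩) u (mem_accessible_self Ω u R)
  · refine notMem_of_not_connectedInBall hu hR hE hv ?_ hsE
    have h1 := hEd _ hsE
    have h2 := dist_triangle s a u
    rw [dist_comm a u] at h2
    simp only at h1
    rw [Metric.mem_ball]; linarith
  · by_cases hsV : s ∈ Ω.verts
    · by_cases hsR : s ∈ Metric.ball u R
      · exact Or.inl (mem_accessible_of_adj hu hR hv hs hsV hsR)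
      · refine Or.inr (hfar s hsV ?_)
        have h2 := dist_triangle s a u
        rw [dist_comm a u] at h2
        rw [Metric.mem_ball, not_lt] at hsR
        linarith
    · exact Or.inr (by rw [hm_eq_zero E hsV]; positivity)

theorem harmonicMeasure_empty (u : ℂ) : Ω.harmonicMeasure u ∅ = 0 := by
  simp [harmonicMeasure, exitEvent]

theorem not_connectedInBall_of_lt {u : ℂ} {E : Set (ℂ × ℂ)} {R : ℝ}
    (h : ENNReal.ofReal R < Ω.innerDist u E) : ¬Ω.ConnectedInBall u E R := fun hc =>
  h.not_ge (iInf₂_le R hc)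

theorem distBoundary_ne_zero (hT : Γ.CondBounded T) {u : ℂ} (hu : u ∈ Ω.verts) :
    Ω.distBoundary u ≠ 0 := by
  have h0 : 0 < sepConst T * δ := mul_pos (sepConst_pos T) Γ.mesh_pos
  refine ((ENNReal.ofReal_pos.mpr h0).trans_le (Metric.le_infEDist.mpr ?_)).ne'
  rintro _ ⟨p, hp, rfl⟩
  rw [edist_dist]
  exact ENNReal.ofReal_le_ofReal (sepConst_mul_le_dist_fst hT hu hp)

/-- The weak Beurling estimate in terms of the distance to the boundary. -/
theorem harmonicMeasure_le_distBoundary (hT : Γ.CondBounded T) (hsc : IsSimplyConnected Ω.region)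
    {u : ℂ} (hu : u ∈ Ω.verts) {E : Set (ℂ × ℂ)} (hE : E ⊆ Ω.boundary) (hne : E.Nonempty) :
    Ω.harmonicMeasure u E ≤
      ((2 * (2 * (6 * dilation T)) ^ (Real.log 2 / Real.log (scale T))).toNNReal : ℝ≥0∞) *
        (Ω.distBoundary u / Ω.innerDist u E) ^ (Real.log 2 / Real.log (scale T)) := by
  have hdil := dilation_ge hT.one_le
  have hD0 := distBoundary_ne_zero hT hu
  have hD : Ω.distBoundary u ≠ ∞ :=
    Metric.infEDist_ne_top ((hne.mono hE).image _)
  rw [← ofReal_hm]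
  refine ofReal_le_mul_div_rpow (by linarith [scale_ge hT.one_le]) (by linarith) (hm_le_one E u)
    hD0 hD fun R hR hRI k hk => ?_
  -- A boundary vertex within twice the infimum suffices, so attainment plays no role; with the
  -- factor 3 this gives the constant 6.
  have hlt : Ω.distBoundary u < 2 * Ω.distBoundary u := by
    rw [two_mul]; exact ENNReal.lt_add_right hD hD0
  obtain ⟨_, ⟨p, hp, rfl⟩, hpd⟩ := Metric.infEDist_lt_iff.mp hlt
  refine hm_le_of_dist_boundary hT hsc hu hR (not_connectedInBall_of_lt hRI) hp
    (le_trans ?_ hk)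
  have h1 : dist u p.1 ≤ 2 * (Ω.distBoundary u).toReal := by
    have := ENNReal.toReal_mono (ENNReal.mul_ne_top ENNReal.ofNat_ne_top hD) hpd.le
    rwa [ENNReal.toReal_mul, ENNReal.toReal_ofNat, edist_dist,
      ENNReal.toReal_ofReal dist_nonneg] at this
  have hscale : 0 ≤ scale T := by linarith [scale_ge hT.one_le]
  calc scale T ^ k * (3 * (dilation T * dist u p.1))
      ≤ scale T ^ k * (3 * (dilation T * (2 * (Ω.distBoundary u).toReal))) := by gcongr
    _ = scale T ^ k * (6 * dilation T * (Ω.distBoundary u).toReal) := by ring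

/-- By the convention for one point and by separation of vertices otherwise, the diameter is at
least of order δ, the smallest scale at which the decay starts. -/
theorem sepConst_mul_le_boundaryDiam (hT : Γ.CondBounded T) {E : Set (ℂ × ℂ)}
    (hE : E ⊆ Ω.boundary) (hne : E.Nonempty) :
    ENNReal.ofReal (sepConst T * δ) ≤ Ω.boundaryDiam E := by
  have hδ := Γ.mesh_pos
  unfold boundaryDiam
  split_ifs with h
  · exact ENNReal.ofReal_le_ofReal (mul_le_of_le_one_left hδ.le (sepConst_le_one hT.one_le))
  · obtain ⟨p, hp⟩ := hne
    obtain ⟨q, hq, hqp⟩ : ∃ q ∈ E, q.1 ≠ p.1 := by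
      by_contra! hc
      refine h ⟨p.1, Subset.antisymm ?_ (singleton_subset_iff.mpr ⟨p, hp, rfl⟩)⟩
      rintro _ ⟨q, hq, rfl⟩
      exact hc q hq
    refine le_trans ?_ (Metric.edist_le_ediam_of_mem (mem_image_of_mem _ hq)
      (mem_image_of_mem _ hp))
    rw [edist_dist]
    exact ENNReal.ofReal_le_ofReal (IsoradialGraph.le_dist_of_mem_verts hT
      (fst_mem_verts (hE hq)) (fst_mem_verts (hE hp)) hqp)

theorem edist_le_boundaryDiam {E : Set (ℂ × ℂ)} {p q : ℂ × ℂ} (hp : p ∈ E) (hq : q ∈ E) :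
    edist p.1 q.1 ≤ Ω.boundaryDiam E := by
  have h := Metric.edist_le_ediam_of_mem (mem_image_of_mem Prod.fst hp)
    (mem_image_of_mem Prod.fst hq)
  unfold boundaryDiam
  split_ifs with hs
  · obtain ⟨a, ha⟩ := hs
    rw [ha, Metric.ediam_singleton] at h
    exact h.trans zero_le
  · exact h

/-- The weak Beurling estimate in terms of the diameter of the target set. -/
theorem harmonicMeasure_le_boundaryDiam (hT : Γ.CondBounded T) (hsc : IsSimplyConnected Ω.region)
    {u : ℂ} (hu : u ∈ Ω.verts) {E : Set (ℂ × ℂ)} (hE : E ⊆ Ω.boundary) (hne : E.Nonempty)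
    (hD : Ω.boundaryDiam E ≠ ∞) :
    Ω.harmonicMeasure u E ≤
      ((2 * (2 * (6 * dilation T)) ^ (Real.log 2 / Real.log (scale T))).toNNReal : ℝ≥0∞) *
        (Ω.boundaryDiam E / Ω.innerDist u E) ^ (Real.log 2 / Real.log (scale T)) := by
  have hdil := dilation_ge hT.one_le
  have hsep := sepConst_mul_le_boundaryDiam hT hE hne
  have h0 : 0 < sepConst T * δ := mul_pos (sepConst_pos T) Γ.mesh_pos
  have hD0 : Ω.boundaryDiam E ≠ 0 := ((ENNReal.ofReal_pos.mpr h0).trans_le hsep).ne'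
  rw [← ofReal_hm]
  refine ofReal_le_mul_div_rpow (by linarith [scale_ge hT.one_le]) (by linarith) (hm_le_one E u)
    hD0 hD fun R hR hRI k hk => ?_
  obtain ⟨p, hp⟩ := hne
  have hscale : 0 ≤ scale T := by linarith [scale_ge hT.one_le]
  have hD1 : 0 ≤ (Ω.boundaryDiam E).toReal := ENNReal.toReal_nonneg
  refine hm_le_of_diam hT hsc hu hR (not_connectedInBall_of_lt hRI) (fst_notMem_region (hE hp))
    ((ENNReal.ofReal_le_iff_le_toReal hD).mp hsep) (fun q hq => ?_) (le_trans ?_ hk)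
  · have := ENNReal.toReal_mono hD (edist_le_boundaryDiam hq hp)
    rwa [edist_dist, ENNReal.toReal_ofReal dist_nonneg] at this
  · refine mul_le_mul_of_nonneg_left ?_ (pow_nonneg hscale k)
    nlinarith [mul_nonneg (by linarith : 0 ≤ dilation T) hD1]

end DiscreteDomain

end

theorem proposition2p10 (η : ℝ) (hη : 0 < η) :
    ∃ β : ℝ, 0 < β ∧ ∃ C : ℝ≥0, 0 < C ∧
      ∀ (δ : ℝ) (Γ : IsoradialGraph δ), Γ.AnglesBounded η →
      ∀ Ω : DiscreteDomain Γ, IsSimplyConnected Ω.region →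
      ∀ u ∈ Ω.verts, ∀ E ⊆ Ω.boundary,
        Ω.harmonicMeasure u E ≤ C * (Ω.distBoundary u / Ω.innerDist u E) ^ β ∧
        Ω.harmonicMeasure u E ≤ C * (Ω.boundaryDiam E / Ω.innerDist u E) ^ β := by
  rcases le_or_gt η (Real.pi / 2) with hη2 | hη2
  · set T := Real.tan (Real.pi / 2 - η / 2) with hTdef
    have hT1 : 1 ≤ T := by
      rw [hTdef, ← Real.tan_pi_div_four]
      rcases hη2.eq_or_lt with h | h
      · exact le_of_eq (congrArg Real.tan (by linarith))
      · exact (Real.tan_lt_tan_of_lt_of_lt_pi_div_two (by linarith [Real.pi_pos]) (by linarith)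
          (by linarith)).le
    have hdil := dilation_ge hT1
    have hβ : 0 < Real.log 2 / Real.log (DiscreteDomain.scale T) :=
      div_pos (Real.log_pos one_lt_two) (Real.log_pos (by linarith [DiscreteDomain.scale_ge hT1]))
    have hC : 0 < 2 * (2 * (6 * dilation T)) ^ (Real.log 2 / Real.log (DiscreteDomain.scale T)) := by positivity
    refine ⟨_, hβ, _, Real.toNNReal_pos.mpr hC, fun δ Γ hΓ Ω hsc u hu E hE => ?_⟩
    have hT := hΓ.condBounded hη hη2
    rcases E.eq_empty_or_nonempty with rfl | hne
    · simp only [DiscreteDomain.harmonicMeasure_empty, zero_le, and_self]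
    have h1 := DiscreteDomain.harmonicMeasure_le_distBoundary hT hsc hu hE hne
    refine ⟨h1, ?_⟩
    -- In `ℝ≥0∞` one has ∞/∞ = 0, so when both quantities are infinite the right-hand side is 0. The
    -- first estimate then also has right-hand side 0 and gives the claim.
    rcases eq_or_ne (Ω.boundaryDiam E) ∞ with hD | hD
    · rcases eq_or_ne (Ω.innerDist u E) ∞ with hI | hI
      · rw [hI, ENNReal.div_top, ENNReal.zero_rpow_of_pos hβ, mul_zero] at h1 ⊢
        exact h1
      · rw [hD, ENNReal.top_div_of_ne_top hI, ENNReal.top_rpow_of_pos hβ, ENNReal.mul_top]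
        · exact le_top
        · simpa using hC
    · exact DiscreteDomain.harmonicMeasure_le_boundaryDiam hT hsc hu hE hne hD
  -- For η > π/2 the interval [η, π - η] is empty: the graph has no edges, and hence the domain no
  -- boundary.
  · refine ⟨1, one_pos, 1, one_pos, fun δ Γ hΓ Ω _ u _ E hE => ?_⟩
    have hE0 : E = ∅ := by
      refine eq_empty_of_forall_notMem fun p hp => ?_
      have := hΓ _ _ (hE hp).1
      linarith [this.1, this.2]
    simp only [hE0, DiscreteDomain.harmonicMeasure_empty, zero_le, and_self]
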